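/- **Setting.** Let $M\subset\mathbb C^4$ be a real analytic real hypersurface, with CR bundle $\mathcal H=T^{1,0}\mathbb C^4\cap\mathbb CTM$, and let $p\in M$. An *adapted frame* near $p$ consists of a real vector field $g$ on $M$ transversal to $\mathcal H\oplus\overline{\mathcal H}$ and of sections $f_1,f_2,e$ forming a frame of $\mathcal H$ such that $\frac1{2i}[f_a,\overline{f_b}]\equiv H_{ab}\,g$ and $[e,\overline{f_b}]\equiv[e,\overline e]\equiv0 \pmod{\mathcal H\oplus\overline{\mathcal H}}$ with $H=(H_{ab})$ invertible; so the Levi form has constant rank $2$ and $e$ spans its kernel $\mathcal K$. Define matrices $\Xi,\Omega$ by $$[e,\overline{f_k}]\equiv\sum_l\Xi_{lk}f_l \ \ (\mathrm{mod}\ \mathcal K\oplus\overline{\mathcal H}),\qquad [e,f_k]\equiv\sum_l\Omega_{lk}f_l\ \ (\mathrm{mod}\ \mathcal K\oplus\overline{\mathcal K}),$$ and put $S^{0,2}=\Xi H^{-1}$, $S^{0,-2}=H\overline\Xi$. $M$ is *$2$-nondegenerate* at $p$ if an adapted frame exists near $p$ and $\Xi(p)\ne0$. Given $\mathbf H$,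 $S$ put $T=\mathbf H\overline S\mathbf H^T$ and $\mathfrak g_{0,0}'=\{B\in\mathfrak{gl}(2,\mathbb C): BS+SB^T\in\mathbb CS,\ B^TT+TB\in\mathbb CT\}$. For a space $N$ of symmetric matrices, $M$ *has modified symbol* $(\mathbf H,S,\Omega_0)$ at $p$ with respect to the normalization condition $N$ if there is an adapted frame near $p$ with $H(p)=\mathbf H$, $S^{0,2}(p)=S$, $e(S^{0,-2})(p)\in\mathbb C\,S^{0,-2}(p)$, $e(S^{0,2})(p)\in N+\mathbb CS$, and $\Omega(p)-\Omega_0\in\mathfrak g'_{0,0}$. The *isotropy* of $M$ at $p$ consists of the germs at $p$ of holomorphic vector fields that vanish at $p$ and whose real part is tangent to $M$. Its *weighted degree zero* part is the isotropy modulo the fields of positive weight, i.e. those whose linear part at $p$ maps $T_p\mathbb C^4$ into $\mathcal H_p$, $\mathcal H_p$ into $\mathcal K_p$, and $\mathcal K_p$ to $0$ (the weights of $w,z,\zeta$ below being $2,1,0$). **Table.** Consider the following triples $(\mathbf H,S,\Omega)$ and spaces $N$, with $\epsilon=\pm1$, $\lambda>1$, $0<\theta<\pi$, $\tau\ge0$;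 put $J=\begin{pmatrix}0&1\\1&0\end{pmatrix}$, $D_\epsilon=\begin{pmatrix}1&0\\0&\epsilon\end{pmatrix}$, and let $E_{jk}$ be the matrix units. 1. $D_\epsilon$, $\begin{pmatrix}1&0\\0&\lambda\end{pmatrix}$, $\begin{pmatrix}0&-\tau\lambda\\\tau&0\end{pmatrix}$, $N=\langle E_{22}\rangle$; 2. $J$, $\begin{pmatrix}1&0\\0&e^{i\theta}\end{pmatrix}$, $\begin{pmatrix}0&-\tau e^{i\theta}\\\tau&0\end{pmatrix}$, $N=\langle E_{22}\rangle$; 3. $D_\epsilon$, $J$, $0$, $N=\langle E_{11},E_{22}\rangle$; 4. $D_\epsilon$, $\begin{pmatrix}1&0\\0&0\end{pmatrix}$, $\begin{pmatrix}0&0\\\tau&0\end{pmatrix}$, $N=\langle E_{22}\rangle$; 5. $J$, $J$, $0$, $N=\langle E_{11},E_{22}\rangle$; 6. $J$, $\begin{pmatrix}1&1\\1&0\end{pmatrix}$, $\begin{pmatrix}2\tau&\tau\\0&0\end{pmatrix}$, $N=\langle E_{22}\rangle$; 7. $J$, $\begin{pmatrix}1&0\\0&0\end{pmatrix}$, $0$,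 $N=\langle E_{12}+E_{21},E_{22}\rangle$. **Models.** For such a triple let $\mathbf S(\zeta)$ be the symmetric matrix with $$(\mathbf S(\zeta),0)=\ln\bigl(\exp(S\zeta,\Omega\zeta)\,\exp(0,-\Omega\zeta)\bigr),\qquad (S,L):=\begin{pmatrix}L&S\\0&-L^T\end{pmatrix},$$ and let $M_0$ be the germ at $0$ of the hypersurface in $\mathbb C^4$, with coordinates $(w,z,\zeta)$, $z=(z_1,z_2)^T$, given by $$\Re(w)=z^TH(\zeta,\overline\zeta)\overline z+\Re\bigl(\overline z^TS(\zeta,\overline\zeta)\overline z\bigr),$$ $$H(\zeta,\overline\zeta)=\tfrac12\bigl(\mathbf H(\mathrm{Id}-\overline{\mathbf S}\mathbf H^T\mathbf S\mathbf H)^{-1}+(\mathrm{Id}-\mathbf H\overline{\mathbf S}\mathbf H^T\mathbf S)^{-1}\mathbf H\bigr),\quad S(\zeta,\overline\zeta)=\mathbf H^T(\mathrm{Id}-\mathbf S\mathbf H\overline{\mathbf S}\mathbf H^T)^{-1}\mathbf S\mathbf H,\quad \mathbf S=\mathbf S(\zeta).$$ **Statement.** For each triple $(\mathbf H,S,\Omega)$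 of the table, the model $M_0$ is $2$-nondegenerate and has modified symbol $(\mathbf H,S,\Omega)$ at $0$ with respect to $N$. Moreover, for every real analytic hypersurface $M\subset\mathbb C^4$ with Levi form of constant rank $2$ that is $2$-nondegenerate at a point $p$ and has this modified symbol at $p$ with respect to $N$, the real dimension of the weighted degree zero isotropy of $M$ at $p$ is at most that of $M_0$ at $0$. -/

import Mathlib

open scoped ContDiff Topology Matrix

noncomputable section

namespace CR4

/-- The space `ℂ⁴` with coordinates `(w, z, ζ)`, `z = (z₁, z₂)`. -/
abbrev C4 : Type := ℂ × (Fin 2 → ℂ) × ℂ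

/-- Complex `2 × 2` matrices. -/
abbrev M2 : Type := Matrix (Fin 2) (Fin 2) ℂ

/-- Entrywise complex conjugation. -/
def conjM (A : M2) : M2 := A.map (starRingEnd ℂ)

/-! ### Complex vector fields

A vector of `ℂ ⊗ T ℂ⁴` is a pair `(a, b)` of vectors of `ℂ⁴`, standing for
`∑ aⱼ ∂/∂zⱼ + ∑ conj(bⱼ) ∂/∂z̄ⱼ`.  Complex conjugation is the swap of the two entries,
`(a, 0)` is of type `(1,0)`, `(0, b)` is the conjugate of `(b, 0)`, a real vector `v` is `(v, v)`,
and a complex number `c` multiplies `(a, b)` to `(c a, conj(c) b)`. -/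

/-- The derivative of `F` at `x` in the complex direction `(a, b)`, i.e.
`∑ aⱼ ∂F/∂zⱼ + ∑ conj(bⱼ) ∂F/∂z̄ⱼ`. -/
def along {W : Type*} [NormedAddCommGroup W] [NormedSpace ℂ W]
    (Z : C4 × C4) (F : C4 → W) (x : C4) : W :=
  (1 / 2 : ℂ) • (fderiv ℝ F x Z.1 - Complex.I • fderiv ℝ F x (Complex.I • Z.1)) +
  (1 / 2 : ℂ) • (fderiv ℝ F x Z.2 + Complex.I • fderiv ℝ F x (Complex.I • Z.2))

/-- The Lie bracket of two complex vector fields. -/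
def bracket (Z Z' : C4 → C4 × C4) (x : C4) : C4 × C4 :=
  (along (Z x) (fun y => (Z' y).1) x - along (Z' x) (fun y => (Z y).1) x,
   along (Z x).swap (fun y => (Z' y).2) x - along (Z' x).swap (fun y => (Z y).2) x)

/-- The vector field of type `(1,0)` with coefficients `Y`. -/
def hol (Y : C4 → C4) : C4 → C4 × C4 := fun x => (Y x, 0)

/-- The complex conjugate of `hol Y`. -/
def antihol (Y : C4 → C4) : C4 → C4 × C4 := fun x => (0, Y x)

/-! ### The CR structure of the hypersurface `{ρ = 0}` -/

/-- The fibre at `x` of the CR bundle `ℋ` of the hypersurface `{ρ = ρ x}`: the complex vectors `a`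
such that `a` and `i a` are tangent to it. -/
def holTangent (ρ : C4 → ℝ) (x : C4) : Submodule ℂ C4 where
  carrier := {a | fderiv ℝ ρ x a = 0 ∧ fderiv ℝ ρ x (Complex.I • a) = 0}
  add_mem' := by
    rintro a b ⟨ha, ha'⟩ ⟨hb, hb'⟩
    exact ⟨by rw [map_add, ha, hb, add_zero], by rw [smul_add, map_add, ha', hb', add_zero]⟩
  zero_mem' := by simp
  smul_mem' := by
    rintro c a ⟨ha, ha'⟩
    have h : c • a = c.re • a + c.im • (Complex.I • a) := by
      conv_lhs => rw [← Complex.re_add_im c]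
      rw [add_smul, mul_smul, Complex.coe_smul, Complex.coe_smul]
    have h' : Complex.I • c • a = c.re • (Complex.I • a) - c.im • a := by
      rw [h, smul_add, smul_comm Complex.I c.re, smul_comm Complex.I c.im, smul_smul Complex.I,
        Complex.I_mul_I, neg_one_smul, smul_neg, sub_eq_add_neg]
    exact ⟨by rw [h, map_add, map_smul, map_smul, ha, ha']; simp,
      by
        have k : fderiv ℝ ρ x (c.re • (Complex.I • a)) = c.re • fderiv ℝ ρ x (Complex.I • a) :=
          ContinuousLinearMap.map_smul _ _ _
        rw [h', map_sub, k, ha', map_smul, ha]; simp⟩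

/-- Germs at `p` of smooth sections of `ℋ` (extended off the hypersurface). -/
def IsSection (ρ : C4 → ℝ) (p : C4) (Y : C4 → C4) : Prop :=
  ContDiffAt ℝ ∞ Y p ∧ ∀ᶠ x in 𝓝 p, ρ x = 0 → Y x ∈ holTangent ρ x

/-- `Z ∈ ℋ ⊕ conj ℋ` at `x`. -/
def InHH (ρ : C4 → ℝ) (x : C4) (Z : C4 × C4) : Prop :=
  Z.1 ∈ holTangent ρ x ∧ Z.2 ∈ holTangent ρ x

/-- The Levi kernel `𝒦` at `p`: the values at `p` of sections `A` of `ℋ` such that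
`[A, conj B]` lies in `ℋ ⊕ conj ℋ` at `p` for all sections `B` of `ℋ`. -/
def leviKernel (ρ : C4 → ℝ) (p : C4) : Submodule ℂ C4 where
  carrier := {a | ∃ A : C4 → C4, IsSection ρ p A ∧ A p = a ∧
    ∀ B : C4 → C4, IsSection ρ p B → InHH ρ p (bracket (hol A) (antihol B) p)}
  add_mem' := by
    rintro a b ⟨A, hA, rfl, hA'⟩ ⟨B, hB, rfl, hB'⟩
    refine ⟨fun x => A x + B x, ⟨hA.1.add hB.1, ?_⟩, rfl, fun C hC => ?_⟩
    · filter_upwards [hA.2, hB.2] with x h1 h2 h3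
      exact add_mem (h1 h3) (h2 h3)
    · have h1 := hA' C hC
      have h2 := hB' C hC
      have e : bracket (hol fun x => A x + B x) (antihol C) p =
          bracket (hol A) (antihol C) p + bracket (hol B) (antihol C) p := by
        have dA : DifferentiableAt ℝ A p := hA.1.differentiableAt (by simp)
        have dB : DifferentiableAt ℝ B p := hB.1.differentiableAt (by simp)
        ext1
        · simp [bracket, hol, antihol, along, fderiv_fun_add dA dB]
          module
        · simp [bracket, hol, antihol, along]
          module
      rw [e]
      exact ⟨add_mem h1.1 h2.1, add_mem h1.2 h2.2⟩
  zero_mem' := by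
    refine ⟨fun _ => 0, ⟨contDiffAt_const, ?_⟩, rfl, fun C _ => ?_⟩
    · filter_upwards with x _ using zero_mem _
    · simp [InHH, bracket, hol, antihol, along]
  smul_mem' := by
    rintro c a ⟨A, hA, rfl, hA'⟩
    refine ⟨fun x => c • A x, ⟨hA.1.const_smul c, ?_⟩, rfl, fun C hC => ?_⟩
    · filter_upwards [hA.2] with x h1 h3
      exact Submodule.smul_mem _ _ (h1 h3)
    · have h1 := hA' C hC
      have e : bracket (hol fun x => c • A x) (antihol C) p =
          (c • (bracket (hol A) (antihol C) p).1,
            (starRingEnd ℂ c) • (bracket (hol A) (antihol C) p).2) := by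
        have dA : DifferentiableAt ℝ A p := hA.1.differentiableAt (by simp)
        have key : ∀ v : C4, fderiv ℝ C p (c • v) =
            c.re • fderiv ℝ C p v + c.im • fderiv ℝ C p (Complex.I • v) := by
          intro v
          rw [← map_smul, ← map_smul, ← map_add]
          congr 1
          conv_lhs => rw [← Complex.re_add_im c]
          rw [add_smul, mul_smul, Complex.coe_smul, Complex.coe_smul]
        ext1
        · simp [bracket, hol, antihol, along, fderiv_fun_const_smul dA c]
          module
        · have k1 := key (A p)
          have k2 := key (Complex.I • A p)
          rw [smul_smul Complex.I Complex.I, Complex.I_mul_I, neg_one_smul, map_neg] at k2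
          have hc : (starRingEnd ℂ) c = (c.re : ℂ) - c.im * Complex.I := by
            apply Complex.ext <;> simp
          simp only [bracket, hol, antihol, along, Prod.swap, fderiv_fun_const, Pi.zero_apply,
            zero_apply, map_zero, smul_zero, sub_zero, add_zero, zero_add]
          rw [smul_comm Complex.I c, k1, k2, hc]
          simp only [← Complex.coe_smul]
          match_scalars
          · linear_combination (0 : ℂ) * Complex.I_mul_I
          · linear_combination (c.im / 2 : ℂ) * Complex.I_mul_I
      rw [e]
      exact ⟨Submodule.smul_mem _ _ h1.1, Submodule.smul_mem _ _ h1.2⟩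

/-! ### Adapted frames and modified symbols -/

/-- An adapted frame `(g, f₁, f₂, e)` of the hypersurface `{ρ = 0}` near `p`: `g` is a real
transversal vector field, `f₁, f₂, e` span `ℋ`, and the Levi form
`(1/2i) [·, conj ·] mod ℋ ⊕ conj ℋ` has in it the matrix `diag(levi, 0)` with `levi` invertible,
so that the Levi form has constant rank two and `e` spans the Levi kernel `𝒦`.
The matrices `xi` and `om` are given by
`[e, conj fₖ] ≡ ∑ xiₗₖ fₗ mod 𝒦 ⊕ conj ℋ` and `[e, fₖ] ≡ ∑ omₗₖ fₗ mod 𝒦 ⊕ conj 𝒦`.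
All fields and functions are extended smoothly off the hypersurface; the relations
are required on the hypersurface only. -/
structure AdaptedFrame (ρ : C4 → ℝ) (p : C4) where
  g : C4 → C4
  f : Fin 2 → C4 → C4
  e : C4 → C4
  levi : C4 → M2
  xi : C4 → M2
  om : C4 → M2
  smooth_g : ContDiffAt ℝ ∞ g p
  smooth_f : ∀ k, ContDiffAt ℝ ∞ (f k) p
  smooth_e : ContDiffAt ℝ ∞ e p
  smooth_levi : ∀ i j, ContDiffAt ℝ ∞ (fun x => levi x i j) p
  smooth_xi : ∀ i j, ContDiffAt ℝ ∞ (fun x => xi x i j) p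
  smooth_om : ∀ i j, ContDiffAt ℝ ∞ (fun x => om x i j) p
  tangent_g : ∀ᶠ x in 𝓝 p, ρ x = 0 → fderiv ℝ ρ x (g x) = 0
  tangent_f : ∀ k, ∀ᶠ x in 𝓝 p, ρ x = 0 → f k x ∈ holTangent ρ x
  tangent_e : ∀ᶠ x in 𝓝 p, ρ x = 0 → e x ∈ holTangent ρ x
  isFrame : ∀ᶠ x in 𝓝 p, ρ x = 0 →
    g x ∉ holTangent ρ x ∧ LinearIndependent ℂ ![f 0 x, f 1 x, e x]
  levi_ff : ∀ᶠ x in 𝓝 p, ρ x = 0 → ∀ a b,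
    (bracket (hol (f a)) (antihol (f b)) x).1 - (2 * Complex.I * levi x a b) • g x
        ∈ holTangent ρ x ∧
    (bracket (hol (f a)) (antihol (f b)) x).2
        - (starRingEnd ℂ) (2 * Complex.I * levi x a b) • g x ∈ holTangent ρ x
  levi_ef : ∀ᶠ x in 𝓝 p, ρ x = 0 → ∀ b, InHH ρ x (bracket (hol e) (antihol (f b)) x)
  levi_ee : ∀ᶠ x in 𝓝 p, ρ x = 0 → InHH ρ x (bracket (hol e) (antihol e) x)
  levi_nondeg : ∀ᶠ x in 𝓝 p, ρ x = 0 → IsUnit (levi x).det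
  xi_spec : ∀ᶠ x in 𝓝 p, ρ x = 0 → ∀ k,
    (bracket (hol e) (antihol (f k)) x).1 - ∑ l, xi x l k • f l x ∈ Submodule.span ℂ {e x} ∧
    (bracket (hol e) (antihol (f k)) x).2 ∈ holTangent ρ x
  om_spec : ∀ᶠ x in 𝓝 p, ρ x = 0 → ∀ k,
    (bracket (hol e) (hol (f k)) x).1 - ∑ l, om x l k • f l x ∈ Submodule.span ℂ {e x} ∧
    (bracket (hol e) (hol (f k)) x).2 ∈ Submodule.span ℂ {e x}

namespace AdaptedFrame

variable {ρ : C4 → ℝ} {p : C4}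

/-- The symmetric matrix `S^{0,2}` representing `ι(e)`. -/
def s02 (φ : AdaptedFrame ρ p) (x : C4) : M2 := φ.xi x * (φ.levi x)⁻¹

/-- The symmetric matrix `S^{0,-2}` representing `ι(conj e)`. -/
def s0m2 (φ : AdaptedFrame ρ p) (x : C4) : M2 := φ.levi x * conjM (φ.xi x)

/-- The derivative of a matrix-valued function along `e` at `p`. -/
def derivE (φ : AdaptedFrame ρ p) (F : C4 → M2) : M2 :=
  Matrix.of fun i j => along (φ.e p, 0) (fun x => F x i j) p

end AdaptedFrame

/-- `{ρ = 0}` is, near `p`, a real analytic hypersurface through `p` whose Levi form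
has constant rank two and which is `2`-nondegenerate at `p`. -/
def IsTwoNondegenerate (ρ : C4 → ℝ) (p : C4) : Prop :=
  AnalyticAt ℝ ρ p ∧ ρ p = 0 ∧ fderiv ℝ ρ p ≠ 0 ∧ ∃ φ : AdaptedFrame ρ p, φ.xi p ≠ 0

/-- The algebra `𝔤'₀₀` of the bigraded symbol represented by `H` and `S`: the matrices
whose action preserves the lines of `S^{0,2} = S` and of `S^{0,-2} = H conj(S) Hᵀ`. -/
def g00 (H S : M2) : Submodule ℂ M2 where
  carrier := {B | B * S + S * Bᵀ ∈ Submodule.span ℂ {S} ∧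
    Bᵀ * (H * conjM S * Hᵀ) + (H * conjM S * Hᵀ) * B ∈ Submodule.span ℂ {H * conjM S * Hᵀ}}
  add_mem' := by
    rintro A B ⟨hA, hA'⟩ ⟨hB, hB'⟩
    refine ⟨?_, ?_⟩
    · have := add_mem hA hB
      rwa [show A * S + S * Aᵀ + (B * S + S * Bᵀ) = (A + B) * S + S * (A + B)ᵀ by
        rw [Matrix.transpose_add, add_mul, mul_add]; abel] at this
    · have := add_mem hA' hB'
      rwa [add_add_add_comm, ← add_mul, ← mul_add, ← Matrix.transpose_add] at this
  zero_mem' := by simp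
  smul_mem' := by
    rintro c A ⟨hA, hA'⟩
    refine ⟨?_, ?_⟩
    · have := Submodule.smul_mem _ c hA
      rwa [smul_add, ← smul_mul_assoc, ← mul_smul_comm, ← Matrix.transpose_smul] at this
    · have := Submodule.smul_mem _ c hA'
      rwa [smul_add, ← smul_mul_assoc, ← mul_smul_comm, ← Matrix.transpose_smul] at this

/-- `{ρ = 0}` has at `p` the modified symbol represented by `(H, S, Ω)`, with respect to
the normalization condition given by the space `N`: there is an adapted frame with `levi = H` and
`S^{0,2} = S` at `p`, whose obstructions satisfy `O_{0,-2} = 0` (modulo the line of `S^{0,-2}`)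
and `O_{0,2} ∈ N` (modulo the line of `S^{0,2}`) at `p`, and for which `om` is at `p` equal to `Ω`
modulo `𝔤'₀₀`. -/
def HasModifiedSymbol (ρ : C4 → ℝ) (p : C4) (H S Ω : M2) (N : Submodule ℂ M2) : Prop :=
  ∃ φ : AdaptedFrame ρ p, φ.levi p = H ∧ φ.s02 p = S ∧
    φ.derivE φ.s0m2 ∈ Submodule.span ℂ {φ.s0m2 p} ∧
    φ.derivE φ.s02 ∈ N ⊔ Submodule.span ℂ {φ.s02 p} ∧
    φ.om p - Ω ∈ g00 H S

/-! ### Isotropy -/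

/-- `X` is an infinitesimal symmetry of the germ at `p` of `{ρ = 0}`: a holomorphic vector field
whose real part is tangent to the hypersurface. -/
def IsInfSymmetry (ρ : C4 → ℝ) (p : C4) (X : C4 → C4) : Prop :=
  AnalyticAt ℂ X p ∧ ∀ᶠ x in 𝓝 p, ρ x = 0 → fderiv ℝ ρ x (X x) = 0

/-- The linear isotropy algebra: the linear parts at `p` of the infinitesimal symmetries that
vanish at `p`. -/
def linearIsotropy (ρ : C4 → ℝ) (p : C4) : Submodule ℝ (C4 →L[ℂ] C4) where
  carrier := {L | ∃ X, IsInfSymmetry ρ p X ∧ X p = 0 ∧ fderiv ℂ X p = L}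
  add_mem' := by
    rintro _ _ ⟨X, hX, hX0, rfl⟩ ⟨Y, hY, hY0, rfl⟩
    refine ⟨fun x => X x + Y x, ⟨hX.1.add hY.1, ?_⟩, by simp [hX0, hY0], ?_⟩
    · filter_upwards [hX.2, hY.2] with x h1 h2 h3
      rw [map_add, h1 h3, h2 h3, add_zero]
    · exact fderiv_fun_add hX.1.differentiableAt hY.1.differentiableAt
  zero_mem' := ⟨fun _ => 0, ⟨analyticAt_const, by simp⟩, rfl, by simp⟩
  smul_mem' := by
    rintro c _ ⟨X, hX, hX0, rfl⟩
    refine ⟨fun x => (c : ℂ) • X x, ⟨analyticAt_const.fun_smul hX.1, ?_⟩, by simp [hX0], ?_⟩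
    · filter_upwards [hX.2] with x h1 h3
      rw [Complex.coe_smul, map_smul, h1 h3, smul_zero]
    · rw [fderiv_fun_const_smul hX.1.differentiableAt, Complex.coe_smul]

/-- The endomorphisms of positive weight for the filtration `0 ⊆ 𝒦 ⊆ ℋ ⊆ ℂ⁴` at `p`, whose
successive quotients have the weights `0` (the variable `ζ`), `-1` (the variables `z`) and
`-2` (the variable `w`). -/
def positiveWeight (ρ : C4 → ℝ) (p : C4) : Submodule ℝ (C4 →L[ℂ] C4) where
  carrier := {L | (∀ v, L v ∈ holTangent ρ p) ∧ (∀ v ∈ holTangent ρ p, L v ∈ leviKernel ρ p) ∧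
    ∀ v ∈ leviKernel ρ p, L v = 0}
  add_mem' := by
    rintro A B ⟨h1, h2, h3⟩ ⟨k1, k2, k3⟩
    exact ⟨fun v => add_mem (h1 v) (k1 v), fun v hv => add_mem (h2 v hv) (k2 v hv),
      fun v hv => by rw [add_apply, h3 v hv, k3 v hv, add_zero]⟩
  zero_mem' := by simp
  smul_mem' := by
    rintro c A ⟨h1, h2, h3⟩
    refine ⟨fun v => ?_, fun v hv => ?_, fun v hv => ?_⟩
    · rw [← Complex.coe_smul]; exact Submodule.smul_mem _ (c : ℂ) (h1 v)
    · rw [← Complex.coe_smul]; exact Submodule.smul_mem _ (c : ℂ) (h2 v hv)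
    · rw [smul_apply, h3 v hv, smul_zero]

/-- The dimension of the weighted degree zero isotropy of `{ρ = 0}` at `p`: the real dimension of
the isotropy algebra modulo its part of positive weight. -/
def degreeZeroIsotropyDim (ρ : C4 → ℝ) (p : C4) : ℕ :=
  Module.finrank ℝ ((linearIsotropy ρ p).map (positiveWeight ρ p).mkQ)

/-! ### The distinguished models -/

/-- The element `(S, L)` of `𝔠𝔰𝔭_{0,2} ⊕ 𝔠𝔰𝔭_{0,0}` as a symplectic matrix; in particular
`[(0, L), (S, 0)] = (L S + S Lᵀ, 0)`. -/
def csp (S L : M2) : Matrix (Fin 2 ⊕ Fin 2) (Fin 2 ⊕ Fin 2) ℂ :=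
  Matrix.fromBlocks L S 0 (-Lᵀ)

/-- The power series of the logarithm of a matrix. -/
def matLog (A : Matrix (Fin 2 ⊕ Fin 2) (Fin 2 ⊕ Fin 2) ℂ) :
    Matrix (Fin 2 ⊕ Fin 2) (Fin 2 ⊕ Fin 2) ℂ :=
  ∑' n : ℕ, ((-1) ^ n / (n + 1) : ℂ) • (A - 1) ^ (n + 1)

/-- The matrix `𝐒(ζ)` with `(𝐒(ζ), 0) = ln (exp (S ζ, Ω ζ) exp (0, -Ω ζ))`. -/
def bigS (S Ω : M2) (ζ : ℂ) : M2 :=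
  (matLog (NormedSpace.exp (csp (ζ • S) (ζ • Ω)) *
    NormedSpace.exp (csp 0 (-(ζ • Ω))))).toBlocks₁₂

/-- The coefficient matrix of `z conj(z)` determined by `H` and `T = 𝐒(ζ)`. -/
def coeffH (H T : M2) : M2 :=
  (1 / 2 : ℂ) • (H * (1 - conjM T * Hᵀ * T * H)⁻¹ + (1 - H * conjM T * Hᵀ * T)⁻¹ * H)

/-- The coefficient matrix of `conj(z) conj(z)` determined by `H` and `T = 𝐒(ζ)`. -/
def coeffS (H T : M2) : M2 :=
  Hᵀ * (1 - T * H * conjM T * Hᵀ)⁻¹ * T * H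

/-- The defining function of the distinguished model with data `H`, `S`, `Ω`. -/
def model (H S Ω : M2) : C4 → ℝ := fun x =>
  (x.2.1 ⬝ᵥ (coeffH H (bigS S Ω x.2.2) *ᵥ star x.2.1)).re +
    (star x.2.1 ⬝ᵥ (coeffS H (bigS S Ω x.2.2) *ᵥ star x.2.1)).re - x.1.re

/-- The table of modified symbols `(H, S, Ω)`, with the spaces `N` of the
normalization conditions. -/
inductive IsTableSymbol : M2 → M2 → M2 → Submodule ℂ M2 → Prop
  | row1 (ε : ℂ) (hε : ε = 1 ∨ ε = -1) (l τ : ℝ) (hl : 1 < l) (hτ : 0 ≤ τ) :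
      IsTableSymbol !![1, 0; 0, ε] !![1, 0; 0, (l : ℂ)] !![0, -(τ * l : ℂ); (τ : ℂ), 0]
        (Submodule.span ℂ {!![0, 0; 0, 1]})
  | row2 (θ τ : ℝ) (hθ : 0 < θ) (hθ' : θ < Real.pi) (hτ : 0 ≤ τ) :
      IsTableSymbol !![0, 1; 1, 0] !![1, 0; 0, Complex.exp (Complex.I * θ)]
        !![0, -(τ * Complex.exp (Complex.I * θ)); (τ : ℂ), 0]
        (Submodule.span ℂ {!![0, 0; 0, 1]})
  | row3 (ε : ℂ) (hε : ε = 1 ∨ ε = -1) :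
      IsTableSymbol !![1, 0; 0, ε] !![0, 1; 1, 0] 0
        (Submodule.span ℂ {!![1, 0; 0, 0], !![0, 0; 0, 1]})
  | row4 (ε : ℂ) (hε : ε = 1 ∨ ε = -1) (τ : ℝ) (hτ : 0 ≤ τ) :
      IsTableSymbol !![1, 0; 0, ε] !![1, 0; 0, 0] !![0, 0; (τ : ℂ), 0]
        (Submodule.span ℂ {!![0, 0; 0, 1]})
  | row5 :
      IsTableSymbol !![0, 1; 1, 0] !![0, 1; 1, 0] 0
        (Submodule.span ℂ {!![1, 0; 0, 0], !![0, 0; 0, 1]})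
  | row6 (τ : ℝ) (hτ : 0 ≤ τ) :
      IsTableSymbol !![0, 1; 1, 0] !![1, 1; 1, 0] !![(2 * τ : ℂ), (τ : ℂ); 0, 0]
        (Submodule.span ℂ {!![0, 0; 0, 1]})
  | row7 :
      IsTableSymbol !![0, 1; 1, 0] !![1, 0; 0, 0] 0
        (Submodule.span ℂ {!![0, 1; 1, 0], !![0, 0; 0, 1]})

end CR4

end

/-! Both dimensions are compared with that of one real algebra, `symbolAlgebra H S Ω`: the matrices
B admitting a real a and a complex c with BᵀH + H conj(B) = aH, BS + SBᵀ = (a + c)S and BΩ − ΩB =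
cΩ. It bounds the weighted degree zero isotropy of every hypersurface with the given symbol from
above (`degreeZeroIsotropyDim_le`) and that of the model from below
(`IsModelData.finrank_symbolAlgebra_le`).

Upper bound. Let X be an infinitesimal symmetry vanishing at p. Its Lie derivative preserves ℋ and
the Levi kernel, so it acts on an adapted frame by a matrix B on f₁, f₂ modulo e, a scalar c on e
and a scalar a on g modulo ℋ. Lie derivatives respect brackets, which gives the identities
`levi_lie` and `xi_lie`, hence `s02_lie`, for the structure functions. At the zero p of X they yield
the first two equations; a is real by tangency. The equation for Ω needs one more derivative:
differentiating `s02_lie` along e determines how e(B) acts on S in terms of e(S^{0,2})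
(`isotropy_derivE`), while the invariance of [e, f_k] gives e(B) in terms of `om` (`isotropy_om`).
Eliminating e(B) leaves one equation for the defect BΩ − ΩB − cΩ, up to a multiple of S and a term
from N. In each row of the table it forces the defect to vanish (`IsTableSymbol.commutator_eq`). If
B = 0 then a = c = 0 and the linear part of X has positive weight, so B determines that linear part
modulo positive weight.

Model. Let u solve u = z + 𝐒(ζ) H conj(u) and put y = H conj(u). The defining function is Re(z·y −
w) (`IsModelData.model_eq`), and the derivatives of u cancel in its differential
(`IsModelData.fderiv_model`). This gives an explicit adapted frame with S^{0,2} constantly equal to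
S and with the prescribed data at 0 (`IsModelData.frame`). Since 𝐒' = exp(ζΩ) S exp(ζΩ)ᵀ, each
triple (a, B, c) as above acts compatibly on 𝐒 (`bigS_equivariant`). Hence the linear field (aw, Bz,
cζ) multiplies the defining function by a and is a symmetry (`IsModelData.fderiv_model_diagMap`). -/

noncomputable section

namespace CR4

/-! ### Calculus of derivatives in complex directions. -/

section Along

variable {W : Type*} [NormedAddCommGroup W] [NormedSpace ℂ W]

theorem along_zero_left (F : C4 → W) (x : C4) : along (0, 0) F x = 0 := by
  simp [along]

theorem along_const (Z : C4 × C4) (w : W) (x : C4) : along Z (fun _ => w) x = 0 := by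
  simp [along]

theorem along_add_left (Z Z' : C4 × C4) (F : C4 → W) (x : C4) :
    along (Z + Z') F x = along Z F x + along Z' F x := by
  simp only [along, Prod.fst_add, Prod.snd_add, smul_add, map_add]
  module

theorem real_smul_decomp (c : ℂ) (v : C4) : c • v = c.re • v + c.im • (Complex.I • v) := by
  conv_lhs => rw [← Complex.re_add_im c]
  rw [add_smul, mul_smul, Complex.coe_smul, Complex.coe_smul]

theorem along_hol_smul (c : ℂ) (a : C4) (F : C4 → W) (x : C4) :
    along (c • a, 0) F x = c • along (a, 0) F x := by
  have key : ∀ v : C4, fderiv ℝ F x (c • v) =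
      (c.re : ℂ) • fderiv ℝ F x v + (c.im : ℂ) • fderiv ℝ F x (Complex.I • v) := by
    intro v
    rw [real_smul_decomp, map_add, map_smul, map_smul, Complex.coe_smul, Complex.coe_smul]
  simp only [along, smul_zero, map_zero, add_zero]
  rw [smul_comm Complex.I c a, key, key, smul_smul Complex.I Complex.I, Complex.I_mul_I,
    neg_one_smul, map_neg]
  conv_rhs => rw [← Complex.re_add_im c]
  match_scalars
  · ring
  · linear_combination (c.im / 2 : ℂ) * Complex.I_mul_I

theorem along_antihol_smul (c : ℂ) (b : C4) (F : C4 → W) (x : C4) :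
    along (0, c • b) F x = (starRingEnd ℂ c) • along (0, b) F x := by
  have key : ∀ v : C4, fderiv ℝ F x (c • v) =
      (c.re : ℂ) • fderiv ℝ F x v + (c.im : ℂ) • fderiv ℝ F x (Complex.I • v) := by
    intro v
    rw [real_smul_decomp, map_add, map_smul, map_smul, Complex.coe_smul, Complex.coe_smul]
  have hc : (starRingEnd ℂ) c = (c.re : ℂ) - c.im * Complex.I := by
    apply Complex.ext <;> simp
  simp only [along, smul_zero, map_zero, sub_zero, zero_add]
  rw [smul_comm Complex.I c b, key, key, smul_smul Complex.I Complex.I, Complex.I_mul_I,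
    neg_one_smul, map_neg, hc]
  match_scalars
  · ring
  · linear_combination ((c.im / 2 : ℂ)) * Complex.I_mul_I

theorem along_hol_add (a a' : C4) (F : C4 → W) (x : C4) :
    along (a + a', 0) F x = along (a, 0) F x + along (a', 0) F x := by
  rw [← along_add_left]; simp

theorem along_antihol_add (b b' : C4) (F : C4 → W) (x : C4) :
    along (0, b + b') F x = along (0, b) F x + along (0, b') F x := by
  rw [← along_add_left]; simp

theorem along_diag (v : C4) (F : C4 → W) (x : C4) : along (v, v) F x = fderiv ℝ F x v := by
  simp only [along]
  module

theorem along_add {F G : C4 → W} {x : C4} (hF : DifferentiableAt ℝ F x)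
    (hG : DifferentiableAt ℝ G x) (Z : C4 × C4) :
    along Z (fun y => F y + G y) x = along Z F x + along Z G x := by
  simp only [along, fderiv_fun_add hF hG, add_apply, smul_add]
  module

theorem along_sub {F G : C4 → W} {x : C4} (hF : DifferentiableAt ℝ F x)
    (hG : DifferentiableAt ℝ G x) (Z : C4 × C4) :
    along Z (fun y => F y - G y) x = along Z F x - along Z G x := by
  simp only [along, fderiv_fun_sub hF hG, sub_apply, smul_sub]
  module

theorem along_neg (F : C4 → W) (x : C4) (Z : C4 × C4) :
    along Z (fun y => - F y) x = - along Z F x := by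
  simp only [along, fderiv_fun_neg, neg_apply, smul_neg]
  module

theorem along_sum {ι : Type*} (s : Finset ι) {F : ι → C4 → W} {x : C4}
    (hF : ∀ i ∈ s, DifferentiableAt ℝ (F i) x) (Z : C4 × C4) :
    along Z (fun y => ∑ i ∈ s, F i y) x = ∑ i ∈ s, along Z (F i) x := by
  simp only [along, fderiv_fun_sum hF, sum_apply, Finset.smul_sum, ← Finset.sum_sub_distrib,
    ← Finset.sum_add_distrib]

theorem along_smul {φ : C4 → ℂ} {F : C4 → W} {x : C4} (hφ : DifferentiableAt ℝ φ x)
    (hF : DifferentiableAt ℝ F x) (Z : C4 × C4) :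
    along Z (fun y => φ y • F y) x = φ x • along Z F x + along Z φ x • F x := by
  simp only [along, fderiv_fun_smul hφ hF, add_apply, smul_apply,
    ContinuousLinearMap.smulRight_apply, smul_eq_mul]
  module

theorem along_mul {φ ψ : C4 → ℂ} {x : C4} (hφ : DifferentiableAt ℝ φ x)
    (hψ : DifferentiableAt ℝ ψ x) (Z : C4 × C4) :
    along Z (fun y => φ y * ψ y) x = along Z φ x * ψ x + φ x * along Z ψ x := by
  have := along_smul hφ hψ Z
  simp only [smul_eq_mul] at this
  rw [this]; ring

/-- A complex direction sees the complex linear part of the differential through its (1,0) entry and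
the conjugate linear part through its (0,1) entry. For holomorphic F the second part is absent. -/
theorem along_of_hasFDerivAt {F : C4 → W} {F' : C4 →L[ℝ] W} {x : C4} (h : HasFDerivAt F F' x)
    (α β : C4 → W) (hF : ∀ v, F' v = α v + β v) (hα : ∀ v, α (Complex.I • v) = Complex.I • α v)
    (hβ : ∀ v, β (Complex.I • v) = - Complex.I • β v) (Z : C4 × C4) :
    along Z F x = α Z.1 + β Z.2 := by
  have e : ∀ w : W, Complex.I • Complex.I • w = - w := by
    intro w; rw [smul_smul, Complex.I_mul_I, neg_one_smul]
  simp only [along, h.fderiv, hF, hα, hβ, smul_add, neg_smul, smul_neg, e]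
  module

theorem along_congr {F G : C4 → W} {x : C4} (h : F =ᶠ[𝓝 x] G) (Z : C4 × C4) :
    along Z F x = along Z G x := by
  simp only [along, h.fderiv_eq]

theorem contDiffAt_along {F : C4 → W} {a b : C4 → C4} {p : C4} (hF : ContDiffAt ℝ ∞ F p)
    (ha : ContDiffAt ℝ ∞ a p) (hb : ContDiffAt ℝ ∞ b p) :
    ContDiffAt ℝ ∞ (fun x => along (a x, b x) F x) p := by
  have hF' : ContDiffAt ℝ ∞ (fderiv ℝ F) p := hF.fderiv_right (by simp)
  have key : ∀ v : C4 → C4, ContDiffAt ℝ ∞ v p → ContDiffAt ℝ ∞ (fun x => fderiv ℝ F x (v x)) p :=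
    fun v hv => hF'.clm_apply hv
  have h1 := key _ ha
  have h2 := key _ (ha.const_smul Complex.I)
  have h3 := key _ hb
  have h4 := key _ (hb.const_smul Complex.I)
  exact ((h1.sub (h2.const_smul Complex.I)).const_smul (1 / 2 : ℂ)).add
    ((h3.add (h4.const_smul Complex.I)).const_smul (1 / 2 : ℂ))

end Along

/-! ### Brackets -/

theorem bracket_hol_antihol_fst (A B : C4 → C4) (x : C4) :
    (bracket (hol A) (antihol B) x).1 = - along (0, B x) A x := by
  simp [bracket, hol, antihol, along_const]

theorem bracket_hol_antihol_snd (A B : C4 → C4) (x : C4) :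
    (bracket (hol A) (antihol B) x).2 = along (0, A x) B x := by
  simp [bracket, hol, antihol, along_const]

theorem bracket_hol_hol_fst (A B : C4 → C4) (x : C4) :
    (bracket (hol A) (hol B) x).1 = along (A x, 0) B x - along (B x, 0) A x := by
  simp [bracket, hol]

theorem bracket_hol_hol_snd (A B : C4 → C4) (x : C4) :
    (bracket (hol A) (hol B) x).2 = 0 := by
  simp [bracket, hol, along_const]

/-! ### Functions that vanish on a hypersurface -/

/-- Composed with a real functional, F is constant on the hypersurface, so x is a constrained local
extremum and Lagrange multipliers apply. The relations of an adapted frame are known on the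
hypersurface only; this is what allows differentiating them in tangent directions. -/
theorem fderiv_apply_eq_zero_of_eventually_eq_zero {W : Type*} [NormedAddCommGroup W]
    [NormedSpace ℝ W] {ρ : C4 → ℝ} {F : C4 → W} {x v : C4}
    (hρ : ContDiffAt ℝ 1 ρ x) (hρ' : fderiv ℝ ρ x ≠ 0) (hx : ρ x = 0)
    (hF : ContDiffAt ℝ 1 F x) (h : ∀ᶠ y in 𝓝 x, ρ y = 0 → F y = 0)
    (hv : fderiv ℝ ρ x v = 0) : fderiv ℝ F x v = 0 := by
  refine SeparatingDual.eq_zero_of_forall_dual_eq_zero (R := ℝ) fun l => ?_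
  have sρ : HasStrictFDerivAt ρ (fderiv ℝ ρ x) x := hρ.hasStrictFDerivAt (by simp)
  have sF : HasStrictFDerivAt F (fderiv ℝ F x) x := hF.hasStrictFDerivAt (by simp)
  have sl : HasStrictFDerivAt (fun y => l (F y)) (l.comp (fderiv ℝ F x)) x :=
    l.hasStrictFDerivAt.comp x sF
  have ext : IsLocalExtrOn (fun y => l (F y)) {y | ρ y = ρ x} x := by
    left
    have h0 := h.self_of_nhds hx
    filter_upwards [mem_nhdsWithin_of_mem_nhds h, self_mem_nhdsWithin] with y hy hy'
    have hy2 : ρ y = 0 := by rw [← hx]; exact hy'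
    rw [h0, hy hy2]
  obtain ⟨a, b, hab, hl⟩ := ext.exists_multipliers_of_hasStrictFDerivAt_1d sρ sl
  -- With b = 0 the multiplier relation would read a dρ = 0 with a ≠ 0, against dρ ≠ 0.
  have hb : b ≠ 0 := by
    rintro rfl
    have ha : a ≠ 0 := by rintro rfl; exact hab rfl
    simp only [zero_smul, add_zero] at hl
    exact hρ' ((smul_eq_zero.1 hl).resolve_left ha)
  have := congrArg (fun m : C4 →L[ℝ] ℝ => m v) hl
  simp only [add_apply, smul_apply, hv, mul_zero, zero_add, ContinuousLinearMap.comp_apply,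
    zero_apply, smul_eq_mul, mul_eq_zero] at this
  exact this.resolve_left hb

/-- The germ at `p` of `{ρ = 0}` is a smooth hypersurface through `p`. -/
structure IsHypersurface (ρ : C4 → ℝ) (p : C4) : Prop where
  smooth : ContDiffAt ℝ ∞ ρ p
  zero : ρ p = 0
  fderiv_ne : fderiv ℝ ρ p ≠ 0

theorem eventually_contDiffAt {W : Type*} [NormedAddCommGroup W] [NormedSpace ℝ W]
    {F : C4 → W} {p : C4} (hF : ContDiffAt ℝ ∞ F p) (n : ℕ) :
    ∀ᶠ x in 𝓝 p, ContDiffAt ℝ n F x :=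
  (hF.of_le (by exact_mod_cast le_top)).eventually (by simp)

theorem eventually_differentiableAt {W : Type*} [NormedAddCommGroup W] [NormedSpace ℝ W]
    {F : C4 → W} {p : C4} (hF : ContDiffAt ℝ ∞ F p) :
    ∀ᶠ x in 𝓝 p, DifferentiableAt ℝ F x :=
  (eventually_contDiffAt hF 1).mono fun _ h => h.differentiableAt (by simp)

theorem IsHypersurface.eventually {ρ : C4 → ℝ} {p : C4} (h : IsHypersurface ρ p) :
    ∀ᶠ x in 𝓝 p, ContDiffAt ℝ 2 ρ x ∧ fderiv ℝ ρ x ≠ 0 := by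
  have h1 := eventually_contDiffAt h.smooth 2
  have h2 : ContinuousAt (fderiv ℝ ρ) p :=
    (h.smooth.fderiv_right (m := ∞) (by simp)).continuousAt
  filter_upwards [h1, h2.eventually_ne h.fderiv_ne] with x h1 h2 using ⟨h1, h2⟩

theorem IsHypersurface.fderiv_vanish {W : Type*} [NormedAddCommGroup W]
    [NormedSpace ℝ W] {ρ : C4 → ℝ} {p : C4} (h : IsHypersurface ρ p) {F : C4 → W}
    (hF : ContDiffAt ℝ ∞ F p) (h0 : ∀ᶠ x in 𝓝 p, ρ x = 0 → F x = 0) :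
    ∀ᶠ x in 𝓝 p, ρ x = 0 → ∀ v, fderiv ℝ ρ x v = 0 → fderiv ℝ F x v = 0 := by
  filter_upwards [h.eventually, eventually_contDiffAt hF 1, h0.eventually_nhds]
    with x h1 h2 h3 hx v hv
  exact fderiv_apply_eq_zero_of_eventually_eq_zero (h1.1.of_le (by norm_num)) h1.2 hx h2 h3 hv

theorem IsHypersurface.along_vanish {W : Type*} [NormedAddCommGroup W]
    [NormedSpace ℂ W] {ρ : C4 → ℝ} {p : C4} (h : IsHypersurface ρ p) {F : C4 → W}
    (hF : ContDiffAt ℝ ∞ F p) (h0 : ∀ᶠ x in 𝓝 p, ρ x = 0 → F x = 0) :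
    ∀ᶠ x in 𝓝 p, ρ x = 0 → ∀ a ∈ holTangent ρ x, ∀ b ∈ holTangent ρ x,
      along (a, b) F x = 0 := by
  filter_upwards [h.fderiv_vanish hF h0] with x h1 hx a ha b hb
  simp [along, h1 hx _ ha.1, h1 hx _ ha.2, h1 hx _ hb.1, h1 hx _ hb.2]

theorem IsHypersurface.along_congr {W : Type*} [NormedAddCommGroup W]
    [NormedSpace ℂ W] {ρ : C4 → ℝ} {p : C4} (h : IsHypersurface ρ p) {F G : C4 → W}
    (hF : ContDiffAt ℝ ∞ F p) (hG : ContDiffAt ℝ ∞ G p)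
    (h0 : ∀ᶠ x in 𝓝 p, ρ x = 0 → F x = G x) :
    ∀ᶠ x in 𝓝 p, ρ x = 0 → ∀ a ∈ holTangent ρ x, ∀ b ∈ holTangent ρ x,
      along (a, b) F x = along (a, b) G x := by
  filter_upwards [h.along_vanish (hF.sub hG) (h0.mono fun x h1 hx => sub_eq_zero.2 (h1 hx)),
    eventually_differentiableAt hF, eventually_differentiableAt hG] with x h1 dF dG hx a ha b hb
  exact sub_eq_zero.1 ((along_sub dF dG (a, b)).symm.trans (h1 hx a ha b hb))

theorem IsHypersurface.fderiv_congr {W : Type*} [NormedAddCommGroup W]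
    [NormedSpace ℝ W] {ρ : C4 → ℝ} {p : C4} (h : IsHypersurface ρ p) {F G : C4 → W}
    (hF : ContDiffAt ℝ ∞ F p) (hG : ContDiffAt ℝ ∞ G p)
    (h0 : ∀ᶠ x in 𝓝 p, ρ x = 0 → F x = G x) :
    ∀ᶠ x in 𝓝 p, ρ x = 0 → ∀ v, fderiv ℝ ρ x v = 0 → fderiv ℝ F x v = fderiv ℝ G x v := by
  filter_upwards [h.fderiv_vanish (hF.sub hG) (h0.mono fun x h1 hx => sub_eq_zero.2 (h1 hx)),
    eventually_differentiableAt hF, eventually_differentiableAt hG] with x h1 dF dG hx v hv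
  have := h1 hx v hv
  rw [fderiv_fun_sub dF dG] at this
  exact sub_eq_zero.1 this

end CR4

end

noncomputable section

namespace CR4

/-! ### The Lie derivative along a holomorphic vector field -/

/-- The Lie derivative of the vector field `A` along the holomorphic vector field `X`. -/
def lieX (X A : C4 → C4) (x : C4) : C4 := fderiv ℝ A x (X x) - fderiv ℂ X x (A x)

/-- Only the linear part of X survives at its zero, so identities between Lie derivatives become
equations for the linear isotropy there. -/
theorem lieX_of_eq_zero {X : C4 → C4} {p : C4} (hX : X p = 0) (A : C4 → C4) :
    lieX X A p = - fderiv ℂ X p (A p) := by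
  simp [lieX, hX]

theorem lieX_smul {φ : C4 → ℂ} {X A : C4 → C4} {x : C4} (hφ : DifferentiableAt ℝ φ x)
    (hA : DifferentiableAt ℝ A x) :
    lieX X (fun y => φ y • A y) x = φ x • lieX X A x + (fderiv ℝ φ x (X x)) • A x := by
  have h : fderiv ℝ (fun y => φ y • A y) x (X x)
      = φ x • fderiv ℝ A x (X x) + (fderiv ℝ φ x (X x)) • A x := by
    simp only [← along_diag]
    exact along_smul hφ hA _
  rw [lieX, h, map_smul, lieX, smul_sub]
  abel

theorem lieX_add {X A B : C4 → C4} {x : C4} (hA : DifferentiableAt ℝ A x)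
    (hB : DifferentiableAt ℝ B x) :
    lieX X (fun y => A y + B y) x = lieX X A x + lieX X B x := by
  rw [lieX, fderiv_fun_add hA hB, add_apply, map_add, lieX, lieX]
  abel

theorem lieX_sum {ι : Type*} (s : Finset ι) {X : C4 → C4} {A : ι → C4 → C4} {x : C4}
    (hA : ∀ i ∈ s, DifferentiableAt ℝ (A i) x) :
    lieX X (fun y => ∑ i ∈ s, A i y) x = ∑ i ∈ s, lieX X (A i) x := by
  rw [lieX, fderiv_fun_sum hA, sum_apply, map_sum, ← Finset.sum_sub_distrib]
  rfl

theorem lieX_const_smul (c : ℂ) {X A : C4 → C4} {x : C4} (hA : DifferentiableAt ℝ A x) :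
    lieX X (fun y => c • A y) x = c • lieX X A x := by
  have := lieX_smul (X := X) (differentiableAt_const c) hA
  simpa using this

/-! ### Second derivatives in variable directions. -/

section SecondOrder

variable {W : Type*} [NormedAddCommGroup W] [NormedSpace ℝ W]

theorem fderiv_fderiv_apply {A : C4 → W} {w : C4 → C4} {x : C4} (hA : ContDiffAt ℝ 2 A x)
    (hw : DifferentiableAt ℝ w x) (v : C4) :
    fderiv ℝ (fun y => fderiv ℝ A y (w y)) x v =
      fderiv ℝ (fderiv ℝ A) x v (w x) + fderiv ℝ A x (fderiv ℝ w x v) := by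
  have h : DifferentiableAt ℝ (fderiv ℝ A) x :=
    (hA.fderiv_right (m := 1) (by norm_num)).differentiableAt (by simp)
  rw [(h.hasFDerivAt.clm_apply hw.hasFDerivAt).fderiv]
  simp [add_comm]

theorem differentiableAt_fderiv_apply {A : C4 → W} {w : C4 → C4} {x : C4}
    (hA : ContDiffAt ℝ 2 A x) (hw : DifferentiableAt ℝ w x) :
    DifferentiableAt ℝ (fun y => fderiv ℝ A y (w y)) x := by
  have h : DifferentiableAt ℝ (fderiv ℝ A) x :=
    (hA.fderiv_right (m := 1) (by norm_num)).differentiableAt (by simp)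
  exact h.clm_apply hw

theorem fderiv_fderiv_comm {A : C4 → W} {x : C4} (hA : ContDiffAt ℝ 2 A x) (v w : C4) :
    fderiv ℝ (fderiv ℝ A) x v w = fderiv ℝ (fderiv ℝ A) x w v :=
  (hA.isSymmSndFDerivAt (by simp)).eq v w

end SecondOrder

/-! ### Lie derivatives along holomorphic fields act as derivations on brackets. -/

section Holomorphic

variable {X : C4 → C4} {x : C4}

theorem hasFDerivAt_fderiv_apply (hX : AnalyticAt ℂ X x) {A : C4 → C4}
    (hA : DifferentiableAt ℝ A x) :
    HasFDerivAt (fun y => fderiv ℂ X y (A y))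
      (((fderiv ℂ X x).restrictScalars ℝ).comp (fderiv ℝ A x) +
        (((fderiv ℂ (fderiv ℂ X) x).flip (A x)).restrictScalars ℝ)) x := by
  have h : HasFDerivAt (fderiv ℂ X) ((fderiv ℂ (fderiv ℂ X) x).restrictScalars ℝ) x :=
    hX.fderiv.differentiableAt.hasFDerivAt.restrictScalars ℝ
  have h2 : HasFDerivAt (fun y => (fderiv ℂ X y).restrictScalars ℝ)
      ((ContinuousLinearMap.restrictScalarsL ℂ C4 C4 ℝ ℝ).comp
        ((fderiv ℂ (fderiv ℂ X) x).restrictScalars ℝ)) x :=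
    (ContinuousLinearMap.restrictScalarsL ℂ C4 C4 ℝ ℝ).hasFDerivAt.comp x h
  exact h2.clm_apply hA.hasFDerivAt

theorem fderiv_fderiv_apply_hol (hX : AnalyticAt ℂ X x) {A : C4 → C4}
    (hA : DifferentiableAt ℝ A x) (v : C4) :
    fderiv ℝ (fun y => fderiv ℂ X y (A y)) x v =
      fderiv ℂ (fderiv ℂ X) x v (A x) + fderiv ℂ X x (fderiv ℝ A x v) := by
  rw [(hasFDerivAt_fderiv_apply hX hA).fderiv]
  simp [add_comm]

theorem fderiv_real_eq (hX : AnalyticAt ℂ X x) (v : C4) : fderiv ℝ X x v = fderiv ℂ X x v := by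
  rw [(hX.differentiableAt.hasFDerivAt.restrictScalars ℝ).fderiv]; rfl

theorem fderiv_lieX (hX : AnalyticAt ℂ X x) {A : C4 → C4} (hA : ContDiffAt ℝ 2 A x) (v : C4) :
    fderiv ℝ (lieX X A) x v =
      fderiv ℝ (fderiv ℝ A) x v (X x) + fderiv ℝ A x (fderiv ℂ X x v)
        - (fderiv ℂ (fderiv ℂ X) x v (A x) + fderiv ℂ X x (fderiv ℝ A x v)) := by
  have dX : DifferentiableAt ℝ X x := hX.differentiableAt.restrictScalars ℝ
  have dA : DifferentiableAt ℝ A x := hA.differentiableAt (by simp)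
  have := fderiv_fun_sub (differentiableAt_fderiv_apply hA dX)
    (hasFDerivAt_fderiv_apply hX dA).differentiableAt
  change fderiv ℝ (fun y => fderiv ℝ A y (X y) - fderiv ℂ X y (A y)) x v = _
  rw [this, sub_apply, fderiv_fderiv_apply hA dX, fderiv_fderiv_apply_hol hX dA,
    fderiv_real_eq hX]

theorem fderiv_along (Z : C4 → C4 × C4) {A : C4 → C4} (hA : ContDiffAt ℝ 2 A x)
    (hZ : DifferentiableAt ℝ Z x) (v : C4) :
    fderiv ℝ (fun y => along (Z y) A y) x v =
      (1 / 2 : ℂ) • (fderiv ℝ (fderiv ℝ A) x v (Z x).1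
        - Complex.I • fderiv ℝ (fderiv ℝ A) x v (Complex.I • (Z x).1)) +
      (1 / 2 : ℂ) • (fderiv ℝ (fderiv ℝ A) x v (Z x).2
        + Complex.I • fderiv ℝ (fderiv ℝ A) x v (Complex.I • (Z x).2)) +
      along (fderiv ℝ Z x v) A x := by
  have d1 : DifferentiableAt ℝ (fun y => (Z y).1) x := hZ.fst
  have d2 : DifferentiableAt ℝ (fun y => (Z y).2) x := hZ.snd
  have d1' : DifferentiableAt ℝ (fun y => Complex.I • (Z y).1) x := d1.const_smul Complex.I
  have d2' : DifferentiableAt ℝ (fun y => Complex.I • (Z y).2) x := d2.const_smul Complex.I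
  have h1 := (differentiableAt_fderiv_apply hA d1).hasFDerivAt
  have h2 := (differentiableAt_fderiv_apply hA d2).hasFDerivAt
  have h1' := (differentiableAt_fderiv_apply hA d1').hasFDerivAt
  have h2' := (differentiableAt_fderiv_apply hA d2').hasFDerivAt
  have H := ((h1.sub (h1'.const_smul Complex.I)).const_smul (1 / 2 : ℂ)).add
    ((h2.add (h2'.const_smul Complex.I)).const_smul (1 / 2 : ℂ))
  have H' : fderiv ℝ (fun y => along (Z y) A y) x = _ := H.fderiv
  rw [H']
  simp only [add_apply, smul_apply, sub_apply, fderiv_fderiv_apply hA d1, fderiv_fderiv_apply hA d2,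
    fderiv_fderiv_apply hA d1', fderiv_fderiv_apply hA d2', fderiv_fun_const_smul d1,
    fderiv_fun_const_smul d2, fderiv.fst hZ, fderiv.snd hZ, along,
    ContinuousLinearMap.comp_apply, ContinuousLinearMap.coe_fst', ContinuousLinearMap.coe_snd']
  module

/-- The second derivative of X is complex linear, so it is felt only by the (1,0) entry a. The
symmetry of the second derivative of A brings its terms to the form in which `fderiv_along` produces
them. -/
theorem along_lieX (hX : AnalyticAt ℂ X x) {A : C4 → C4} (hA : ContDiffAt ℝ 2 A x)
    (a b : C4) :
    along (a, b) (lieX X A) x =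
      (1 / 2 : ℂ) • (fderiv ℝ (fderiv ℝ A) x (X x) a
        - Complex.I • fderiv ℝ (fderiv ℝ A) x (X x) (Complex.I • a)) +
      (1 / 2 : ℂ) • (fderiv ℝ (fderiv ℝ A) x (X x) b
        + Complex.I • fderiv ℝ (fderiv ℝ A) x (X x) (Complex.I • b)) +
      along (fderiv ℂ X x a, fderiv ℂ X x b) A x -
      fderiv ℂ (fderiv ℂ X) x a (A x) - fderiv ℂ X x (along (a, b) A x) := by
  have e : ∀ w : C4, Complex.I • Complex.I • w = - w := by
    intro w; rw [smul_smul, Complex.I_mul_I, neg_one_smul]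
  simp only [along, fderiv_lieX hX hA, fderiv_fderiv_comm hA (X x), map_smul, map_add, map_sub,
    smul_apply, smul_add, smul_sub, e]
  module

/-- The Lie derivative along `X` is a derivation of the bracket `[A, conj B]`. -/
theorem lieX_along_antihol (hX : AnalyticAt ℂ X x) {A B : C4 → C4} (hA : ContDiffAt ℝ 2 A x)
    (hB : DifferentiableAt ℝ B x) :
    lieX X (fun y => along (0, B y) A y) x =
      along (0, B x) (lieX X A) x + along (0, lieX X B x) A x := by
  have hZ : DifferentiableAt ℝ (fun y => ((0 : C4), B y)) x :=
    (differentiableAt_const _).prodMk hB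
  have e : fderiv ℝ (fun y => ((0 : C4), B y)) x (X x)
      = (0, lieX X B x) + (0, fderiv ℂ X x (B x)) := by
    rw [((hasFDerivAt_const (0 : C4) x).prodMk hB.hasFDerivAt).fderiv]
    simp [lieX]
  rw [lieX, fderiv_along _ hA hZ, along_lieX hX hA, e, along_add_left]
  simp only [map_zero, smul_zero, zero_apply]
  module

/-- The Lie derivative along `X` is a derivation of the bracket `[A, B]`. -/
theorem lieX_bracket_hol (hX : AnalyticAt ℂ X x) {A B : C4 → C4} (hA : ContDiffAt ℝ 2 A x)
    (hB : ContDiffAt ℝ 2 B x) :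
    lieX X (fun y => along (A y, 0) B y - along (B y, 0) A y) x =
      (along (lieX X A x, 0) B x - along (B x, 0) (lieX X A) x) +
      (along (A x, 0) (lieX X B) x - along (lieX X B x, 0) A x) := by
  have dA : DifferentiableAt ℝ A x := hA.differentiableAt (by simp)
  have dB : DifferentiableAt ℝ B x := hB.differentiableAt (by simp)
  -- Each half of the bracket alone fails to be differentiated as a product, by a second derivative
  -- of X. The two defects agree by symmetry and cancel in the difference.
  have key : ∀ {A B : C4 → C4}, ContDiffAt ℝ 2 A x → DifferentiableAt ℝ B x →
      DifferentiableAt ℝ (fun y => along (B y, 0) A y) x ∧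
      lieX X (fun y => along (B y, 0) A y) x =
      along (B x, 0) (lieX X A) x + along (lieX X B x, 0) A x
        + fderiv ℂ (fderiv ℂ X) x (B x) (A x) := by
    intro A B hA hB
    have hZ : DifferentiableAt ℝ (fun y => (B y, (0 : C4))) x :=
      hB.prodMk (differentiableAt_const _)
    have e : fderiv ℝ (fun y => (B y, (0 : C4))) x (X x)
        = (lieX X B x, 0) + (fderiv ℂ X x (B x), 0) := by
      rw [(hB.hasFDerivAt.prodMk (hasFDerivAt_const (0 : C4) x)).fderiv]
      simp [lieX]
    refine ⟨?_, ?_⟩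
    · simp only [along]
      have h1 := differentiableAt_fderiv_apply hA hB
      have h2 := differentiableAt_fderiv_apply hA (hB.const_smul Complex.I)
      simp only [map_zero, smul_zero, add_zero]
      exact (h1.sub (h2.const_smul Complex.I)).const_smul (1 / 2 : ℂ)
    · rw [lieX, fderiv_along _ hA hZ, along_lieX hX hA, e, along_add_left]
      simp only [map_zero, smul_zero]
      module
  obtain ⟨d1, k1⟩ := key hB dA
  obtain ⟨d2, k2⟩ := key hA dB
  have s : fderiv ℂ (fderiv ℂ X) x (A x) (B x) = fderiv ℂ (fderiv ℂ X) x (B x) (A x) :=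
    (hX.contDiffAt (n := ω)).isSymmSndFDerivAt (by simp) |>.eq _ _
  have : lieX X (fun y => along (A y, 0) B y - along (B y, 0) A y) x =
      lieX X (fun y => along (A y, 0) B y) x - lieX X (fun y => along (B y, 0) A y) x := by
    simp only [lieX, fderiv_fun_sub d1 d2, sub_apply, map_sub]
    abel
  rw [this, k1, k2, s]
  abel

end Holomorphic

theorem contDiffAt_real {X : C4 → C4} {p : C4} (hX : AnalyticAt ℂ X p) : ContDiffAt ℝ ∞ X p :=
  (hX.contDiffAt (n := ∞)).restrict_scalars ℝ

theorem contDiffAt_lieX {X A : C4 → C4} {p : C4} (hX : AnalyticAt ℂ X p)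
    (hA : ContDiffAt ℝ ∞ A p) : ContDiffAt ℝ ∞ (lieX X A) p := by
  have h1 : ContDiffAt ℝ ∞ (fun x => fderiv ℝ A x (X x)) p :=
    (hA.fderiv_right (by simp)).clm_apply (contDiffAt_real hX)
  have h2 : ContDiffAt ℝ ∞ (fun x => fderiv ℝ X x (A x)) p :=
    ((contDiffAt_real hX).fderiv_right (by simp)).clm_apply hA
  refine (h1.sub h2).congr_of_eventuallyEq ?_
  filter_upwards [hX.eventually_analyticAt] with x hx
  rw [lieX, fderiv_real_eq hx]

/-! ### Infinitesimal symmetries -/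

/-- Differentiate dρ(V) = 0 along X and dρ(X) = 0 along V, both tangent to the hypersurface where
these equations hold. The symmetric second derivative of ρ cancels in the difference. -/
theorem IsInfSymmetry.lieX_tangent {ρ : C4 → ℝ} {p : C4} (h : IsHypersurface ρ p)
    {X V : C4 → C4} (hX : IsInfSymmetry ρ p X) (hV : ContDiffAt ℝ ∞ V p)
    (hT : ∀ᶠ x in 𝓝 p, ρ x = 0 → fderiv ℝ ρ x (V x) = 0) :
    ∀ᶠ x in 𝓝 p, ρ x = 0 → fderiv ℝ ρ x (lieX X V x) = 0 := by
  have hρ' : ContDiffAt ℝ ∞ (fderiv ℝ ρ) p := h.smooth.fderiv_right (by simp)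
  have c1 := h.fderiv_vanish (hρ'.clm_apply hV) hT
  have c2 := h.fderiv_vanish (hρ'.clm_apply (contDiffAt_real hX.1)) hX.2
  filter_upwards [c1, c2, hX.2, hT, h.eventually, hX.1.eventually_analyticAt,
    eventually_differentiableAt hV] with x c1 c2 t1 t2 hx aX dV h0
  have e1 := c1 h0 _ (t1 h0)
  have e2 := c2 h0 _ (t2 h0)
  rw [fderiv_fderiv_apply hx.1 dV] at e1
  rw [fderiv_fderiv_apply hx.1 (aX.differentiableAt.restrictScalars ℝ), fderiv_real_eq aX,
    fderiv_fderiv_comm hx.1] at e2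
  rw [lieX, map_sub]
  linarith

/-- Lying in ℋ means that V and iV are both tangent, and the Lie derivative along a holomorphic
field commutes with multiplication by i. -/
theorem IsInfSymmetry.lieX_section {ρ : C4 → ℝ} {p : C4} (h : IsHypersurface ρ p)
    {X V : C4 → C4} (hX : IsInfSymmetry ρ p X) (hV : IsSection ρ p V) :
    IsSection ρ p (lieX X V) := by
  refine ⟨contDiffAt_lieX hX.1 hV.1, ?_⟩
  have h1 := hX.lieX_tangent h hV.1 (hV.2.mono fun x hx h0 => (hx h0).1)
  have h2 := hX.lieX_tangent h (hV.1.const_smul Complex.I) (hV.2.mono fun x hx h0 => (hx h0).2)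
  filter_upwards [h1, h2, eventually_differentiableAt hV.1] with x h1 h2 dV h0
  refine ⟨h1 h0, ?_⟩
  rw [← lieX_const_smul Complex.I dV]
  exact h2 h0

theorem IsInfSymmetry.lieX_congr {ρ : C4 → ℝ} {p : C4} (h : IsHypersurface ρ p)
    {X V V' : C4 → C4} (hX : IsInfSymmetry ρ p X) (hV : ContDiffAt ℝ ∞ V p)
    (hV' : ContDiffAt ℝ ∞ V' p) (h0 : ∀ᶠ x in 𝓝 p, ρ x = 0 → V x = V' x) :
    ∀ᶠ x in 𝓝 p, ρ x = 0 → lieX X V x = lieX X V' x := by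
  filter_upwards [h.fderiv_congr hV hV' h0, hX.2, h0] with x h1 h2 h3 hx
  rw [lieX, lieX, h1 hx _ (h2 hx), h3 hx]

end CR4

end

noncomputable section

namespace CR4

namespace AdaptedFrame

variable {ρ : C4 → ℝ} {p : C4}

/-! ### The coframe dual to an adapted frame -/

/-- The linear map that sends the coordinates `(s, t, r)` to `s g + ∑ tₗ fₗ + r e`. -/
def frameMap (φ : AdaptedFrame ρ p) (x : C4) : C4 →L[ℂ] C4 :=
  (ContinuousLinearMap.fst ℂ ℂ ((Fin 2 → ℂ) × ℂ)).smulRight (φ.g x) +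
  (∑ l, ((ContinuousLinearMap.proj (R := ℂ) (φ := fun _ : Fin 2 => ℂ) l).comp
    ((ContinuousLinearMap.fst ℂ (Fin 2 → ℂ) ℂ).comp
      (ContinuousLinearMap.snd ℂ ℂ ((Fin 2 → ℂ) × ℂ)))).smulRight (φ.f l x)) +
  ((ContinuousLinearMap.snd ℂ (Fin 2 → ℂ) ℂ).comp
      (ContinuousLinearMap.snd ℂ ℂ ((Fin 2 → ℂ) × ℂ))).smulRight (φ.e x)

/-- The inverse of `frameMap`. -/
def coframe (φ : AdaptedFrame ρ p) (x : C4) : C4 →L[ℂ] C4 := Ring.inverse (φ.frameMap x)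

theorem frameMap_apply (φ : AdaptedFrame ρ p) (x v : C4) :
    φ.frameMap x v = v.1 • φ.g x + ∑ l, v.2.1 l • φ.f l x + v.2.2 • φ.e x := by
  simp [frameMap]

theorem contDiffAt_frameMap (φ : AdaptedFrame ρ p) : ContDiffAt ℝ ∞ φ.frameMap p := by
  have key : ∀ (l : C4 →L[ℂ] ℂ) (V : C4 → C4), ContDiffAt ℝ ∞ V p →
      ContDiffAt ℝ ∞ (fun x => l.smulRight (V x)) p := by
    intro l V hV
    exact (((ContinuousLinearMap.smulRightL ℂ C4 C4 l).restrictScalars ℝ).contDiff.contDiffAt).comp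
      p hV
  refine ((key _ _ φ.smooth_g).add ?_).add (key _ _ φ.smooth_e)
  exact ContDiffAt.sum fun l _ => key _ _ (φ.smooth_f l)

/-- ℋ is a complex subspace that contains f₁, f₂, e and misses g, so a complex linear relation has
no g-term. Thus the real field g completes the frame of ℋ to a complex basis of ℂ⁴. -/
theorem isUnit_frameMap (φ : AdaptedFrame ρ p) (h : IsHypersurface ρ p) :
    IsUnit (φ.frameMap p) := by
  have inj : Function.Injective (φ.frameMap p) := by
    rw [injective_iff_map_eq_zero]
    intro v hv
    rw [frameMap_apply] at hv
    obtain ⟨hg, hli⟩ := φ.isFrame.self_of_nhds h.zero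
    have hH : ∑ l, v.2.1 l • φ.f l p + v.2.2 • φ.e p ∈ holTangent ρ p :=
      add_mem (Submodule.sum_mem _ fun l _ => Submodule.smul_mem _ _
        ((φ.tangent_f l).self_of_nhds h.zero))
        (Submodule.smul_mem _ _ (φ.tangent_e.self_of_nhds h.zero))
    have h1 : v.1 = 0 := by
      by_contra h1
      apply hg
      have : φ.g p = v.1⁻¹ • (v.1 • φ.g p) := by rw [smul_smul, inv_mul_cancel₀ h1, one_smul]
      rw [this]
      refine Submodule.smul_mem _ _ ?_
      rw [eq_neg_of_add_eq_zero_left ((add_assoc _ _ _).symm.trans hv)]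
      exact neg_mem hH
    rw [h1, zero_smul, zero_add, Fin.sum_univ_two] at hv
    have := Fintype.linearIndependent_iff.1 hli ![v.2.1 0, v.2.1 1, v.2.2]
      (by simpa [Fin.sum_univ_three] using hv)
    have e0 := this 0
    have e1 := this 1
    have e2 := this 2
    simp at e0 e1 e2
    refine Prod.ext h1 (Prod.ext (funext fun i => ?_) e2)
    fin_cases i <;> assumption
  have bij : Function.Bijective (φ.frameMap p).toLinearMap :=
    ⟨inj, LinearMap.surjective_of_injective inj⟩
  let E := (LinearEquiv.ofBijective _ bij).toContinuousLinearEquiv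
  exact ⟨(ContinuousLinearEquiv.unitsEquiv ℂ C4).symm E, by ext v <;> rfl⟩

theorem contDiffAt_coframe (φ : AdaptedFrame ρ p) (h : IsHypersurface ρ p) :
    ContDiffAt ℝ ∞ φ.coframe p := by
  obtain ⟨u, hu⟩ := φ.isUnit_frameMap h
  have h1 : ContDiffAt ℂ ∞ Ring.inverse (u : C4 →L[ℂ] C4) := contDiffAt_ringInverse ℂ u
  rw [hu] at h1
  exact (h1.restrict_scalars ℝ).comp p φ.contDiffAt_frameMap

theorem eventually_isUnit_frameMap (φ : AdaptedFrame ρ p) (h : IsHypersurface ρ p) :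
    ∀ᶠ x in 𝓝 p, IsUnit (φ.frameMap x) :=
  φ.contDiffAt_frameMap.continuousAt.eventually (Units.isOpen.mem_nhds (φ.isUnit_frameMap h))

theorem frameMap_coframe {φ : AdaptedFrame ρ p} {x : C4} (hx : IsUnit (φ.frameMap x)) (v : C4) :
    φ.frameMap x (φ.coframe x v) = v := by
  have := Ring.mul_inverse_cancel _ hx
  exact congrArg (fun m : C4 →L[ℂ] C4 => m v) this

theorem coframe_frameMap {φ : AdaptedFrame ρ p} {x : C4} (hx : IsUnit (φ.frameMap x)) (v : C4) :
    φ.coframe x (φ.frameMap x v) = v := by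
  have := Ring.inverse_mul_cancel _ hx
  exact congrArg (fun m : C4 →L[ℂ] C4 => m v) this

theorem coframe_expand {φ : AdaptedFrame ρ p} {x : C4} (hx : IsUnit (φ.frameMap x)) (v : C4) :
    v = (φ.coframe x v).1 • φ.g x + ∑ l, (φ.coframe x v).2.1 l • φ.f l x
      + (φ.coframe x v).2.2 • φ.e x := by
  rw [← frameMap_apply, frameMap_coframe hx]

theorem coframe_g {φ : AdaptedFrame ρ p} {x : C4} (hx : IsUnit (φ.frameMap x)) :
    φ.coframe x (φ.g x) = (1, 0, 0) := by
  rw [← coframe_frameMap hx (1, 0, 0), frameMap_apply]; simp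

theorem coframe_f {φ : AdaptedFrame ρ p} {x : C4} (hx : IsUnit (φ.frameMap x)) (k : Fin 2) :
    φ.coframe x (φ.f k x) = (0, Pi.single k 1, 0) := by
  rw [← coframe_frameMap hx (0, Pi.single k 1, 0), frameMap_apply]
  simp [Pi.single_apply]

theorem coframe_e {φ : AdaptedFrame ρ p} {x : C4} (hx : IsUnit (φ.frameMap x)) :
    φ.coframe x (φ.e x) = (0, 0, 1) := by
  rw [← coframe_frameMap hx (0, 0, 1), frameMap_apply]; simp

/-- The coframe detects `ℋ` at the point `x` of the hypersurface. -/
structure IsGood (φ : AdaptedFrame ρ p) (x : C4) : Prop where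
  unit : IsUnit (φ.frameMap x)
  tangent_f : ∀ k, φ.f k x ∈ holTangent ρ x
  tangent_e : φ.e x ∈ holTangent ρ x
  transversal : φ.g x ∉ holTangent ρ x
  tangent_g : fderiv ℝ ρ x (φ.g x) = 0
  levi_ff : ∀ a b, along (0, φ.f b x) (φ.f a) x + (2 * Complex.I * φ.levi x a b) • φ.g x
    ∈ holTangent ρ x
  levi_ef : ∀ b, along (0, φ.f b x) φ.e x ∈ holTangent ρ x
  levi_fe : ∀ b, along (0, φ.e x) (φ.f b) x ∈ holTangent ρ x
  levi_ee : along (0, φ.e x) φ.e x ∈ holTangent ρ x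
  levi_nondeg : IsUnit (φ.levi x).det
  xi_spec : ∀ k, along (0, φ.f k x) φ.e x + ∑ l, φ.xi x l k • φ.f l x ∈ Submodule.span ℂ {φ.e x}
  om_spec : ∀ k, along (φ.e x, 0) (φ.f k) x - along (φ.f k x, 0) φ.e x
    - ∑ l, φ.om x l k • φ.f l x ∈ Submodule.span ℂ {φ.e x}

theorem eventually_isGood (φ : AdaptedFrame ρ p) (h : IsHypersurface ρ p) :
    ∀ᶠ x in 𝓝 p, ρ x = 0 → φ.IsGood x := by
  filter_upwards [φ.eventually_isUnit_frameMap h, Filter.eventually_all.2 φ.tangent_f, φ.tangent_e,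
    φ.isFrame, φ.tangent_g, φ.levi_ff, φ.levi_ef, φ.levi_ee, φ.levi_nondeg, φ.xi_spec, φ.om_spec]
    with x h1 h2 h3 h4 h5 h6 h7 h8 h9 h10 h11 h0
  refine ⟨h1, fun k => h2 k h0, h3 h0, (h4 h0).1, h5 h0, fun a b => ?_, fun b => ?_, fun b => ?_,
    ?_, h9 h0, fun k => ?_, fun k => ?_⟩
  · have := neg_mem (h6 h0 a b).1
    rwa [bracket_hol_antihol_fst, neg_sub, sub_neg_eq_add, add_comm] at this
  · have := neg_mem (h7 h0 b).1
    rwa [bracket_hol_antihol_fst, neg_neg] at this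
  · have := (h7 h0 b).2
    rwa [bracket_hol_antihol_snd] at this
  · have := (h8 h0).2
    rwa [bracket_hol_antihol_snd] at this
  · have := neg_mem (h10 h0 k).1
    rwa [bracket_hol_antihol_fst, neg_sub, sub_neg_eq_add, add_comm] at this
  · have := (h11 h0 k).1
    rwa [bracket_hol_hol_fst] at this

theorem isSection_f (φ : AdaptedFrame ρ p) (k : Fin 2) : IsSection ρ p (φ.f k) :=
  ⟨φ.smooth_f k, φ.tangent_f k⟩

theorem isSection_e (φ : AdaptedFrame ρ p) : IsSection ρ p φ.e := ⟨φ.smooth_e, φ.tangent_e⟩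

theorem IsGood.comb_mem {φ : AdaptedFrame ρ p} {x : C4} (hx : φ.IsGood x) (t : Fin 2 → ℂ)
    (r : ℂ) : ∑ l, t l • φ.f l x + r • φ.e x ∈ holTangent ρ x :=
  add_mem (Submodule.sum_mem _ fun l _ => Submodule.smul_mem _ _ (hx.tangent_f l))
    (Submodule.smul_mem _ _ hx.tangent_e)

theorem IsGood.mem_iff {φ : AdaptedFrame ρ p} {x : C4} (hx : φ.IsGood x) (v : C4) :
    v ∈ holTangent ρ x ↔ (φ.coframe x v).1 = 0 := by
  have e := coframe_expand hx.unit v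
  rw [add_assoc] at e
  constructor
  · intro hv
    by_contra h1
    apply hx.transversal
    have e2 : φ.g x = (φ.coframe x v).1⁻¹ • ((φ.coframe x v).1 • φ.g x) := by
      rw [smul_smul, inv_mul_cancel₀ h1, one_smul]
    rw [e2]
    refine Submodule.smul_mem _ _ ?_
    rw [eq_sub_of_add_eq e.symm]
    exact sub_mem hv (hx.comb_mem _ _)
  · intro h1
    rw [e, h1, zero_smul, zero_add]
    exact hx.comb_mem _ _

theorem IsGood.expand {φ : AdaptedFrame ρ p} {x : C4} (hx : φ.IsGood x) {v : C4}
    (hv : v ∈ holTangent ρ x) :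
    v = ∑ l, (φ.coframe x v).2.1 l • φ.f l x + (φ.coframe x v).2.2 • φ.e x := by
  have e := coframe_expand hx.unit v
  rwa [(hx.mem_iff v).1 hv, zero_smul, zero_add] at e

theorem mem_span_iff {φ : AdaptedFrame ρ p} {x : C4} (hx : φ.IsGood x) (v : C4) :
    v ∈ Submodule.span ℂ {φ.e x} ↔ (φ.coframe x v).1 = 0 ∧ (φ.coframe x v).2.1 = 0 := by
  rw [Submodule.mem_span_singleton]
  constructor
  · rintro ⟨r, rfl⟩
    simp [coframe_e hx.unit]
  · rintro ⟨h1, h2⟩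
    refine ⟨(φ.coframe x v).2.2, ?_⟩
    conv_rhs => rw [coframe_expand hx.unit v, h1, h2]
    simp

theorem IsGood.coframe_levi {φ : AdaptedFrame ρ p} {x : C4} (hx : φ.IsGood x) (a b : Fin 2) :
    (φ.coframe x (along (0, φ.f b x) (φ.f a) x)).1 = -(2 * Complex.I * φ.levi x a b) := by
  have := (hx.mem_iff _).1 (hx.levi_ff a b)
  rw [map_add, map_smul, coframe_g hx.unit] at this
  simp only [Prod.fst_add, Prod.smul_fst, smul_eq_mul, mul_one] at this
  exact eq_neg_of_add_eq_zero_left this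

theorem IsGood.coframe_xi {φ : AdaptedFrame ρ p} {x : C4} (hx : φ.IsGood x) (l k : Fin 2) :
    (φ.coframe x (along (0, φ.f k x) φ.e x)).2.1 l = - φ.xi x l k := by
  have := congrFun ((mem_span_iff hx _).1 (hx.xi_spec k)).2 l
  simp only [map_add, map_sum, map_smul, coframe_f hx.unit, Prod.snd_add, Prod.fst_add,
    Pi.add_apply, Prod.snd_sum, Prod.fst_sum, Finset.sum_apply, Prod.smul_snd, Prod.smul_fst,
    Pi.smul_apply, Pi.single_apply, smul_eq_mul, mul_ite, mul_one, mul_zero, Finset.sum_ite_eq,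
    Finset.mem_univ, if_true, Pi.zero_apply] at this
  exact eq_neg_of_add_eq_zero_left this

theorem IsGood.coframe_om {φ : AdaptedFrame ρ p} {x : C4} (hx : φ.IsGood x) (l k : Fin 2) :
    (φ.coframe x (along (φ.e x, 0) (φ.f k) x - along (φ.f k x, 0) φ.e x)).2.1 l
      = φ.om x l k := by
  have := congrFun ((mem_span_iff hx _).1 (hx.om_spec k)).2 l
  rw [map_sub (φ.coframe x)] at this
  simp only [map_sum, map_smul, coframe_f hx.unit, Prod.snd_sub, Prod.fst_sub,
    Pi.sub_apply, Prod.snd_sum, Prod.fst_sum, Finset.sum_apply, Prod.smul_snd, Prod.smul_fst,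
    Pi.smul_apply, Pi.single_apply, smul_eq_mul, mul_ite, mul_one, mul_zero, Finset.sum_ite_eq,
    Finset.mem_univ, if_true, Pi.zero_apply] at this
  exact sub_eq_zero.1 this

theorem along_antihol_comb (φ : AdaptedFrame ρ p) (x : C4) (t : Fin 2 → ℂ) (r : ℂ)
    (F : C4 → C4) :
    along (0, ∑ l, t l • φ.f l x + r • φ.e x) F x =
      ∑ l, (starRingEnd ℂ) (t l) • along (0, φ.f l x) F x
        + (starRingEnd ℂ) r • along (0, φ.e x) F x := by
  simp only [Fin.sum_univ_two, along_antihol_add, along_antihol_smul]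

theorem along_hol_comb (φ : AdaptedFrame ρ p) (x : C4) (t : Fin 2 → ℂ) (r : ℂ)
    (F : C4 → C4) :
    along (∑ l, t l • φ.f l x + r • φ.e x, 0) F x =
      ∑ l, t l • along (φ.f l x, 0) F x + r • along (φ.e x, 0) F x := by
  simp only [Fin.sum_univ_two, along_hol_add, along_hol_smul]

theorem IsGood.along_antihol_e_mem {φ : AdaptedFrame ρ p} {x : C4} (hx : φ.IsGood x) {b : C4}
    (hb : b ∈ holTangent ρ x) : along (0, b) φ.e x ∈ holTangent ρ x := by
  rw [hx.expand hb, along_antihol_comb]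
  exact add_mem (Submodule.sum_mem _ fun l _ => Submodule.smul_mem _ _ (hx.levi_ef l))
    (Submodule.smul_mem _ _ hx.levi_ee)

/-! ### Coefficients of sections -/

theorem contDiffAt_coframe_apply (φ : AdaptedFrame ρ p) (h : IsHypersurface ρ p) {V : C4 → C4}
    (hV : ContDiffAt ℝ ∞ V p) : ContDiffAt ℝ ∞ (fun x => φ.coframe x (V x)) p := by
  have h1 : ContDiffAt ℝ ∞ (fun x => (φ.coframe x).restrictScalars ℝ) p :=
    (ContinuousLinearMap.restrictScalarsL ℂ C4 C4 ℝ ℝ).contDiff.contDiffAt.comp p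
      (φ.contDiffAt_coframe h)
  exact h1.clm_apply hV

theorem contDiffAt_coframe_f (φ : AdaptedFrame ρ p) (h : IsHypersurface ρ p) {V : C4 → C4}
    (hV : ContDiffAt ℝ ∞ V p) (l : Fin 2) :
    ContDiffAt ℝ ∞ (fun x => (φ.coframe x (V x)).2.1 l) p :=
  contDiffAt_pi.1 ((φ.contDiffAt_coframe_apply h hV).snd.fst) l

theorem contDiffAt_coframe_e (φ : AdaptedFrame ρ p) (h : IsHypersurface ρ p) {V : C4 → C4}
    (hV : ContDiffAt ℝ ∞ V p) :
    ContDiffAt ℝ ∞ (fun x => (φ.coframe x (V x)).2.2) p :=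
  (φ.contDiffAt_coframe_apply h hV).snd.snd

theorem contDiffAt_coframe_g (φ : AdaptedFrame ρ p) (h : IsHypersurface ρ p) {V : C4 → C4}
    (hV : ContDiffAt ℝ ∞ V p) :
    ContDiffAt ℝ ∞ (fun x => (φ.coframe x (V x)).1) p :=
  (φ.contDiffAt_coframe_apply h hV).fst

/-- Leibniz rule for combinations of the frame. -/
theorem along_comb_fun (φ : AdaptedFrame ρ p) {t : Fin 2 → C4 → ℂ} {r : C4 → ℂ} {x : C4}
    (ht : ∀ l, DifferentiableAt ℝ (t l) x) (hr : DifferentiableAt ℝ r x)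
    (hf : ∀ l, DifferentiableAt ℝ (φ.f l) x) (he : DifferentiableAt ℝ φ.e x) (Z : C4 × C4) :
    along Z (fun y => ∑ l, t l y • φ.f l y + r y • φ.e y) x =
      ∑ l, (t l x • along Z (φ.f l) x + along Z (t l) x • φ.f l x)
        + (r x • along Z φ.e x + along Z r x • φ.e x) := by
  have d : ∀ l, DifferentiableAt ℝ (fun y => t l y • φ.f l y) x := fun l => (ht l).smul (hf l)
  have d' : DifferentiableAt ℝ (fun y => r y • φ.e y) x := hr.smul he
  rw [along_add (DifferentiableAt.fun_sum fun l _ => d l) d', along_smul hr he,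
    along_sum _ fun l _ => d l]
  simp only [fun l => along_smul (ht l) (hf l)]

theorem along_section (φ : AdaptedFrame ρ p) (h : IsHypersurface ρ p) {V : C4 → C4}
    (hV : IsSection ρ p V) :
    ∀ᶠ x in 𝓝 p, ρ x = 0 → ∀ a ∈ holTangent ρ x, ∀ b ∈ holTangent ρ x,
      along (a, b) V x =
        ∑ l, ((φ.coframe x (V x)).2.1 l • along (a, b) (φ.f l) x
          + along (a, b) (fun y => (φ.coframe y (V y)).2.1 l) x • φ.f l x)
        + ((φ.coframe x (V x)).2.2 • along (a, b) φ.e x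
          + along (a, b) (fun y => (φ.coframe y (V y)).2.2) x • φ.e x) := by
  have ct := φ.contDiffAt_coframe_f h hV.1
  have cr := φ.contDiffAt_coframe_e h hV.1
  have key := h.along_congr hV.1
    (G := fun y => ∑ l, (φ.coframe y (V y)).2.1 l • φ.f l y + (φ.coframe y (V y)).2.2 • φ.e y)
    ((ContDiffAt.sum fun l _ => (ct l).smul (φ.smooth_f l)).add (cr.smul φ.smooth_e))
    (by
      filter_upwards [φ.eventually_isGood h, hV.2] with x h1 h2 h0
      exact (h1 h0).expand (h2 h0))
  filter_upwards [key, Filter.eventually_all.2 fun l => eventually_differentiableAt (ct l),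
    eventually_differentiableAt cr,
    Filter.eventually_all.2 fun l => eventually_differentiableAt (φ.smooth_f l),
    eventually_differentiableAt φ.smooth_e] with x k1 k2 k3 k4 k5 h0 a ha b hb
  rw [k1 h0 a ha b hb]
  exact φ.along_comb_fun k2 k3 k4 k5 _

/-- The derivatives of the coefficients of V multiply frame vectors of ℋ, so modulo ℋ the expression
is tensorial in V: it is the Levi form. -/
theorem along_section_levi (φ : AdaptedFrame ρ p) (h : IsHypersurface ρ p) {V : C4 → C4}
    (hV : IsSection ρ p V) :
    ∀ᶠ x in 𝓝 p, ρ x = 0 → ∀ b : Fin 2, (φ.coframe x (along (0, φ.f b x) V x)).1 =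
      - ∑ l, (φ.coframe x (V x)).2.1 l * (2 * Complex.I * φ.levi x l b) := by
  filter_upwards [φ.along_section h hV, φ.eventually_isGood h] with x h1 h2 h0 b
  have hx := h2 h0
  rw [h1 h0 0 (zero_mem _) _ (hx.tangent_f b)]
  simp only [map_add, map_sum, map_smul, Prod.fst_add, Prod.fst_sum, Prod.smul_fst,
    hx.coframe_levi, (hx.mem_iff _).1 (hx.levi_ef b), (hx.mem_iff _).1 (hx.tangent_f _),
    (hx.mem_iff _).1 hx.tangent_e, smul_eq_mul, mul_zero, add_zero, mul_neg, Finset.sum_neg_distrib]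

theorem IsGood.eq_zero_of_levi {φ : AdaptedFrame ρ p} {x : C4} (hx : φ.IsGood x) {t : Fin 2 → ℂ}
    (ht : ∀ b, ∑ l, t l * (2 * Complex.I * φ.levi x l b) = 0) : t = 0 := by
  have h1 : t ᵥ* φ.levi x = 0 := by
    funext b
    have h2 := ht b
    have e : ∑ l, t l * (2 * Complex.I * φ.levi x l b)
        = (2 * Complex.I) * ∑ l, t l * φ.levi x l b := by
      rw [Finset.mul_sum]; exact Finset.sum_congr rfl fun l _ => by ring
    rw [e] at h2
    exact (mul_eq_zero.1 h2).resolve_left (by simp)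
  exact Matrix.eq_zero_of_vecMul_eq_zero hx.levi_nondeg.ne_zero h1

/-- Pairing with f₁, f₂ sees the f-coefficients of a section through the invertible matrix `levi`,
so they vanish on the kernel. Conversely, the frame relations for e extend to all sections by the
Leibniz rule. -/
theorem leviKernel_eq (φ : AdaptedFrame ρ p) (h : IsHypersurface ρ p) :
    leviKernel ρ p = Submodule.span ℂ {φ.e p} := by
  have hp := (φ.eventually_isGood h).self_of_nhds h.zero
  apply le_antisymm
  · rintro _ ⟨A, hA, rfl, hA'⟩
    have hAp := hA.2.self_of_nhds h.zero
    rw [mem_span_iff hp]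
    refine ⟨(hp.mem_iff _).1 hAp, hp.eq_zero_of_levi fun b => ?_⟩
    have h1 := (hA' _ (φ.isSection_f b)).1
    rw [bracket_hol_antihol_fst] at h1
    have h2 := (hp.mem_iff _).1 (neg_mem h1)
    rwa [neg_neg, (φ.along_section_levi h hA).self_of_nhds h.zero b, neg_eq_zero] at h2
  · rw [Submodule.span_singleton_le_iff_mem]
    refine ⟨φ.e, φ.isSection_e, rfl, fun B hB => ⟨?_, ?_⟩⟩
    · rw [bracket_hol_antihol_fst]
      exact neg_mem (hp.along_antihol_e_mem (hB.2.self_of_nhds h.zero))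
    · rw [bracket_hol_antihol_snd, (φ.along_section h hB).self_of_nhds h.zero 0 (zero_mem _) _
        hp.tangent_e]
      refine add_mem (Submodule.sum_mem _ fun l _ => add_mem ?_ ?_) (add_mem ?_ ?_)
      · exact Submodule.smul_mem _ _ (hp.levi_fe l)
      · exact Submodule.smul_mem _ _ (hp.tangent_f l)
      · exact Submodule.smul_mem _ _ hp.levi_ee
      · exact Submodule.smul_mem _ _ hp.tangent_e

end AdaptedFrame

end CR4

end

/-! ### Involutivity of the Levi kernel and invariance of the frame relations. -/

noncomputable section

namespace CR4

/-- The commutator of two antiholomorphic derivations. -/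
theorem along_antihol_comm {A B F : C4 → C4} {x : C4} (hF : ContDiffAt ℝ 2 F x)
    (hA : DifferentiableAt ℝ A x) (hB : DifferentiableAt ℝ B x) :
    along (0, B x) (fun y => along (0, A y) F y) x - along (0, A x) (fun y => along (0, B y) F y) x =
      along (0, along (B x, 0) A x - along (A x, 0) B x) F x := by
  have key : ∀ {A B : C4 → C4}, DifferentiableAt ℝ A x →
      along (0, B x) (fun y => along (0, A y) F y) x =
      along (0, along (B x, 0) A x) F x + (1 / 4 : ℂ) •
        ((fderiv ℝ (fderiv ℝ F) x (B x) (A x)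
          - fderiv ℝ (fderiv ℝ F) x (Complex.I • B x) (Complex.I • A x)) +
        Complex.I • (fderiv ℝ (fderiv ℝ F) x (Complex.I • B x) (A x)
          + fderiv ℝ (fderiv ℝ F) x (B x) (Complex.I • A x))) := by
    intro A B hA
    have hZ : DifferentiableAt ℝ (fun y => ((0 : C4), A y)) x :=
      (differentiableAt_const _).prodMk hA
    have e : ∀ v, fderiv ℝ (fun y => ((0 : C4), A y)) x v = (0, fderiv ℝ A x v) := by
      intro v
      rw [((hasFDerivAt_const (0 : C4) x).prodMk hA.hasFDerivAt).fderiv]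
      simp
    have e2 : along (B x, 0) A x =
        (1 / 2 : ℂ) • fderiv ℝ A x (B x) + (-(Complex.I / 2)) • fderiv ℝ A x (Complex.I • B x) := by
      simp only [along, map_zero, smul_zero, add_zero]
      module
    -- Derivatives are conjugate linear in the (0,1) entry, so the coefficients in `e2` come out
    -- conjugated.
    have e4 : (starRingEnd ℂ) (1 / 2) = 1 / 2 := by
      apply Complex.ext <;> simp
    have e5 : (starRingEnd ℂ) (-(Complex.I / 2)) = Complex.I / 2 := by
      rw [map_neg, map_div₀, Complex.conj_I, Complex.conj_ofNat]; ring
    rw [e2, along_antihol_add, along_antihol_smul, along_antihol_smul, e4, e5]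
    conv_lhs =>
      rw [along]
      simp only [map_zero, smul_zero, sub_zero, zero_add]
    simp only [fderiv_along _ hF hZ, e]
    simp only [map_zero, smul_zero, sub_zero, zero_add, smul_add]
    match_scalars <;> ring_nf
    rw [Complex.I_sq]
    norm_num
  rw [key hA, key hB, fderiv_fderiv_comm hF (A x) (B x),
    fderiv_fderiv_comm hF (Complex.I • A x) (Complex.I • B x),
    fderiv_fderiv_comm hF (Complex.I • A x) (B x), fderiv_fderiv_comm hF (A x) (Complex.I • B x),
    sub_eq_add_neg (along (B x, 0) A x), along_antihol_add,
    ← neg_one_smul ℂ (along (A x, 0) B x), along_antihol_smul]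
  simp only [map_neg, map_one]
  module

namespace AdaptedFrame

variable {ρ : C4 → ℝ} {p : C4}

theorem along_antihol_e_section (φ : AdaptedFrame ρ p) (h : IsHypersurface ρ p) {V : C4 → C4}
    (hV : IsSection ρ p V) :
    ∀ᶠ x in 𝓝 p, ρ x = 0 → along (0, φ.e x) V x ∈ holTangent ρ x := by
  filter_upwards [φ.along_section h hV, φ.eventually_isGood h] with x h1 h2 h0
  have hx := h2 h0
  rw [h1 h0 0 (zero_mem _) _ hx.tangent_e]
  refine add_mem (Submodule.sum_mem _ fun l _ => add_mem ?_ ?_) (add_mem ?_ ?_)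
  · exact Submodule.smul_mem _ _ (hx.levi_fe l)
  · exact Submodule.smul_mem _ _ (hx.tangent_f l)
  · exact Submodule.smul_mem _ _ hx.levi_ee
  · exact Submodule.smul_mem _ _ hx.tangent_e

theorem isSection_ef (φ : AdaptedFrame ρ p) (h : IsHypersurface ρ p) (b : Fin 2) :
    IsSection ρ p (fun y => along (0, φ.f b y) φ.e y) :=
  ⟨contDiffAt_along φ.smooth_e contDiffAt_const (φ.smooth_f b),
    (φ.eventually_isGood h).mono fun _ hx h0 => (hx h0).levi_ef b⟩

theorem isSection_ee (φ : AdaptedFrame ρ p) (h : IsHypersurface ρ p) :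
    IsSection ρ p (fun y => along (0, φ.e y) φ.e y) :=
  ⟨contDiffAt_along φ.smooth_e contDiffAt_const φ.smooth_e,
    (φ.eventually_isGood h).mono fun _ hx h0 => (hx h0).levi_ee⟩

/-- The Levi kernel is involutive. -/
theorem coframe_ee (φ : AdaptedFrame ρ p) (h : IsHypersurface ρ p) :
    ∀ᶠ x in 𝓝 p, ρ x = 0 → (φ.coframe x (along (0, φ.e x) φ.e x)).2.1 = 0 := by
  filter_upwards [φ.along_section_levi h (φ.isSection_ee h), φ.eventually_isGood h,
    Filter.eventually_all.2 fun b => φ.along_antihol_e_section h (φ.isSection_ef h b),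
    eventually_contDiffAt φ.smooth_e 2,
    Filter.eventually_all.2 fun b => eventually_differentiableAt (φ.smooth_f b)]
    with x h1 h2 h3 h4 h5 h0
  have hx := h2 h0
  refine hx.eq_zero_of_levi fun b => ?_
  have e1 := h1 h0 b
  have hb : along (φ.f b x, 0) φ.e x - along (φ.e x, 0) (φ.f b) x ∈ holTangent ρ x := by
    have h6 := hx.om_spec b
    have h7 : along (φ.e x, 0) (φ.f b) x - along (φ.f b x, 0) φ.e x ∈ holTangent ρ x := by
      have := add_mem ((Submodule.span_singleton_le_iff_mem _ _).2 hx.tangent_e h6)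
        (Submodule.sum_mem _ fun l (_ : l ∈ Finset.univ) =>
          Submodule.smul_mem _ (φ.om x l b) (hx.tangent_f l))
      rwa [sub_add_cancel] at this
    rw [← neg_sub]
    exact neg_mem h7
  have e2 := along_antihol_comm h4 (h4.differentiableAt (by simp)) (h5 b)
  -- Jacobi identity: exchanging the two conjugate derivatives of e costs a derivative of e along
  -- the conjugate of [f_b, e]. Both resulting terms lie in ℋ, so the conjugate derivative of e
  -- along itself is Levi-orthogonal to f_b.
  have e3 : along (0, φ.f b x) (fun y => along (0, φ.e y) φ.e y) x ∈ holTangent ρ x := by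
    rw [eq_add_of_sub_eq e2]
    exact add_mem (hx.along_antihol_e_mem hb) (h3 b h0)
  rw [(hx.mem_iff _).1 e3] at e1
  exact neg_eq_zero.1 e1.symm

/-! ### The action of an infinitesimal symmetry on the frame -/

/-- The matrix of the action of `X` on `f₁, f₂` modulo `e`. -/
def symB (φ : AdaptedFrame ρ p) (X : C4 → C4) (x : C4) : M2 :=
  Matrix.of fun l k => -(φ.coframe x (lieX X (φ.f k) x)).2.1 l

/-- The coefficient of the action of `X` on `e`. -/
def symC (φ : AdaptedFrame ρ p) (X : C4 → C4) (x : C4) : ℂ :=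
  -(φ.coframe x (lieX X φ.e x)).2.2

/-- The coefficient of the action of `X` on `g` modulo `ℋ`. -/
def symA (φ : AdaptedFrame ρ p) (X : C4 → C4) (x : C4) : ℂ :=
  -(φ.coframe x (lieX X φ.g x)).1

variable {X : C4 → C4}

theorem contDiffAt_symB (φ : AdaptedFrame ρ p) (h : IsHypersurface ρ p)
    (hX : IsInfSymmetry ρ p X) (l k : Fin 2) :
    ContDiffAt ℝ ∞ (fun x => φ.symB X x l k) p :=
  (φ.contDiffAt_coframe_f h (contDiffAt_lieX hX.1 (φ.smooth_f k)) l).neg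

theorem contDiffAt_symC (φ : AdaptedFrame ρ p) (h : IsHypersurface ρ p)
    (hX : IsInfSymmetry ρ p X) : ContDiffAt ℝ ∞ (φ.symC X) p :=
  (φ.contDiffAt_coframe_e h (contDiffAt_lieX hX.1 φ.smooth_e)).neg

theorem contDiffAt_symA (φ : AdaptedFrame ρ p) (h : IsHypersurface ρ p)
    (hX : IsInfSymmetry ρ p X) : ContDiffAt ℝ ∞ (φ.symA X) p :=
  (φ.contDiffAt_coframe_g h (contDiffAt_lieX hX.1 φ.smooth_g)).neg

theorem lieX_f_eq (φ : AdaptedFrame ρ p) (h : IsHypersurface ρ p) (hX : IsInfSymmetry ρ p X)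
    (k : Fin 2) :
    ∀ᶠ x in 𝓝 p, ρ x = 0 → lieX X (φ.f k) x =
      ∑ l, (-φ.symB X x l k) • φ.f l x + (φ.coframe x (lieX X (φ.f k) x)).2.2 • φ.e x := by
  filter_upwards [φ.eventually_isGood h, (hX.lieX_section h (φ.isSection_f k)).2] with x h1 h2 h0
  have := (h1 h0).expand (h2 h0)
  simpa [symB] using this

/-- The derivative of e along conj(f_b) is a section of ℋ, hence so is its Lie derivative. The
derivation property then shows that the Lie derivative of e is Levi-orthogonal to f₁ and f₂, and
nondegeneracy removes its f-components. -/
theorem lieX_e_eq (φ : AdaptedFrame ρ p) (h : IsHypersurface ρ p) (hX : IsInfSymmetry ρ p X) :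
    ∀ᶠ x in 𝓝 p, ρ x = 0 → lieX X φ.e x = (-φ.symC X x) • φ.e x := by
  have hs := hX.lieX_section h φ.isSection_e
  filter_upwards [φ.eventually_isGood h, hs.2, φ.along_section_levi h hs,
    Filter.eventually_all.2 fun b => (hX.lieX_section h (φ.isSection_ef h b)).2,
    Filter.eventually_all.2 fun b => (hX.lieX_section h (φ.isSection_f b)).2,
    hX.1.eventually_analyticAt, eventually_contDiffAt φ.smooth_e 2,
    Filter.eventually_all.2 fun b => eventually_differentiableAt (φ.smooth_f b)]
    with x h1 h2 h3 h4 h5 h6 h7 h8 h0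
  have hx := h1 h0
  have t0 : (φ.coframe x (lieX X φ.e x)).2.1 = 0 := by
    refine hx.eq_zero_of_levi fun b => ?_
    have e1 := h4 b h0
    rw [lieX_along_antihol h6 h7 (h8 b)] at e1
    have e2 := sub_mem e1 (hx.along_antihol_e_mem (h5 b h0))
    rw [add_sub_cancel_right] at e2
    have e3 := h3 h0 b
    rw [(hx.mem_iff _).1 e2] at e3
    exact neg_eq_zero.1 e3.symm
  have := hx.expand (h2 h0)
  rw [t0] at this
  simpa [symC] using this

/-- The relation defining `levi` exhibits a section of ℋ. Its Lie derivative is again one, and the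
vanishing of the g-coefficient is the identity. The conjugate matrix appears because X also moves
conj(f_b). -/
theorem levi_lie (φ : AdaptedFrame ρ p) (h : IsHypersurface ρ p) (hX : IsInfSymmetry ρ p X) :
    ∀ᶠ x in 𝓝 p, ρ x = 0 → ∀ a b, fderiv ℝ (fun y => φ.levi y a b) x (X x) =
      φ.symA X x * φ.levi x a b - ∑ l, φ.symB X x l a * φ.levi x l b
        - ∑ l, φ.levi x a l * (starRingEnd ℂ) (φ.symB X x l b) := by
  have hsec : ∀ a b, IsSection ρ p
      (fun y => along (0, φ.f b y) (φ.f a) y + (2 * Complex.I * φ.levi y a b) • φ.g y) :=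
    fun a b => ⟨(contDiffAt_along (φ.smooth_f a) contDiffAt_const (φ.smooth_f b)).add
      ((contDiffAt_const.mul (φ.smooth_levi a b)).smul φ.smooth_g),
      (φ.eventually_isGood h).mono fun _ hx h0 => (hx h0).levi_ff a b⟩
  filter_upwards [φ.eventually_isGood h,
    Filter.eventually_all.2 fun a => Filter.eventually_all.2 fun b =>
      (hX.lieX_section h (hsec a b)).2,
    Filter.eventually_all.2 fun a => φ.along_section_levi h (hX.lieX_section h (φ.isSection_f a)),
    Filter.eventually_all.2 fun b => φ.lieX_f_eq h hX b,
    hX.1.eventually_analyticAt,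
    Filter.eventually_all.2 fun b => eventually_contDiffAt (φ.smooth_f b) 2,
    Filter.eventually_all.2 fun a => Filter.eventually_all.2 fun b =>
      eventually_differentiableAt (φ.smooth_levi a b),
    eventually_differentiableAt φ.smooth_g,
    Filter.eventually_all.2 fun a => Filter.eventually_all.2 fun b =>
      eventually_differentiableAt
        (contDiffAt_along (φ.smooth_f a) contDiffAt_const (φ.smooth_f b) (a := fun _ => 0))]
    with x h1 h2 h3 h4 h5 h6 h7 h8 h9 h0 a b
  have hx := h1 h0
  have dl : DifferentiableAt ℝ (fun y => 2 * Complex.I * φ.levi y a b) x :=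
    (differentiableAt_const _).mul (h7 a b)
  have dlg : DifferentiableAt ℝ (fun y => (2 * Complex.I * φ.levi y a b) • φ.g y) x := dl.smul h8
  have e1 := (hx.mem_iff _).1 (h2 a b h0)
  have e2 : fderiv ℝ (fun y => 2 * Complex.I * φ.levi y a b) x (X x)
      = 2 * Complex.I * fderiv ℝ (fun y => φ.levi y a b) x (X x) := by
    rw [fderiv_const_mul (h7 a b)]; simp
  rw [lieX_add (h9 a b) dlg, lieX_along_antihol h5 (h6 a) ((h6 b).differentiableAt (by simp)),
    lieX_smul dl h8, h4 b h0, along_antihol_comb, e2] at e1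
  simp only [map_add, map_sum, map_smul, Prod.fst_add, Prod.fst_sum, Prod.smul_fst, h3 a h0 b,
    hx.coframe_levi, (hx.mem_iff _).1 (hx.levi_fe a), coframe_g hx.unit, smul_eq_mul, mul_zero,
    add_zero, mul_one] at e1
  have eA : (φ.coframe x (lieX X φ.g x)).1 = - φ.symA X x := by simp [symA]
  have eB : ∀ l, (φ.coframe x (lieX X (φ.f a) x)).2.1 l = - φ.symB X x l a := by simp [symB]
  simp only [eA, eB, map_neg, Fin.sum_univ_two] at e1 ⊢
  have h2I : (2 * Complex.I) ≠ 0 := by simp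
  apply mul_left_cancel₀ h2I
  linear_combination e1

/-- Apply X to the expansion of the derivative of e along conj(f_k) and compare f-coefficients. The
e-component of the Lie derivative of f_k would contribute the derivative of e along conj(e), which
has no f-component by `coframe_ee`. -/
theorem xi_lie (φ : AdaptedFrame ρ p) (h : IsHypersurface ρ p) (hX : IsInfSymmetry ρ p X) :
    ∀ᶠ x in 𝓝 p, ρ x = 0 → ∀ m k, fderiv ℝ (fun y => φ.xi y m k) x (X x) =
      ∑ l, φ.symB X x m l * φ.xi x l k - φ.symC X x * φ.xi x m k
        - ∑ l, φ.xi x m l * (starRingEnd ℂ) (φ.symB X x l k) := by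
  have cμ : ∀ k, ContDiffAt ℝ ∞ (fun y => (φ.coframe y (along (0, φ.f k y) φ.e y)).2.2) p :=
    fun k => φ.contDiffAt_coframe_e h (φ.isSection_ef h k).1
  have L1 : ∀ k, ∀ᶠ x in 𝓝 p, ρ x = 0 → lieX X (fun y => along (0, φ.f k y) φ.e y) x =
      lieX X (fun y => ∑ l, (-φ.xi y l k) • φ.f l y +
        (φ.coframe y (along (0, φ.f k y) φ.e y)).2.2 • φ.e y) x := by
    intro k
    refine hX.lieX_congr h (φ.isSection_ef h k).1 ((ContDiffAt.sum fun l _ =>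
      (φ.smooth_xi l k).neg.smul (φ.smooth_f l)).add ((cμ k).smul φ.smooth_e)) ?_
    filter_upwards [φ.eventually_isGood h] with x h1 h0
    have := (h1 h0).expand ((h1 h0).levi_ef k)
    simpa only [(h1 h0).coframe_xi] using this
  have cC : ContDiffAt ℝ ∞ (fun y => -φ.symC X y) p := (φ.contDiffAt_symC h hX).neg
  have L2 := h.along_congr (G := fun y => (-φ.symC X y) • φ.e y)
    (contDiffAt_lieX hX.1 φ.smooth_e) (cC.smul φ.smooth_e) (φ.lieX_e_eq h hX)
  filter_upwards [φ.eventually_isGood h, Filter.eventually_all.2 L1, L2, φ.lieX_e_eq h hX,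
    φ.coframe_ee h,
    Filter.eventually_all.2 fun b => φ.lieX_f_eq h hX b,
    hX.1.eventually_analyticAt, eventually_contDiffAt φ.smooth_e 2,
    Filter.eventually_all.2 fun b => eventually_differentiableAt (φ.smooth_f b),
    Filter.eventually_all.2 fun a => Filter.eventually_all.2 fun b =>
      eventually_differentiableAt (φ.smooth_xi a b),
    Filter.eventually_all.2 fun b => eventually_differentiableAt (cμ b),
    eventually_differentiableAt cC]
    with x h1 h2 h3 h4 h5 h6 h7 h8 h9 h10 h11 h12 h0 m k
  have hx := h1 h0
  have de : DifferentiableAt ℝ φ.e x := h8.differentiableAt (by simp)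
  have e1 := h2 k h0
  have d1 : ∀ l, DifferentiableAt ℝ (fun y => (-φ.xi y l k) • φ.f l y) x :=
    fun l => (h10 l k).neg.smul (h9 l)
  have d2 : DifferentiableAt ℝ
      (fun y => (φ.coframe y (along (0, φ.f k y) φ.e y)).2.2 • φ.e y) x := (h11 k).smul de
  have eL : ∀ l, lieX X (fun y => (-φ.xi y l k) • φ.f l y) x =
      (-φ.xi x l k) • lieX X (φ.f l) x - fderiv ℝ (fun y => φ.xi y l k) x (X x) • φ.f l x := by
    intro l
    have dn : DifferentiableAt ℝ (fun y => -φ.xi y l k) x := (h10 l k).neg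
    rw [lieX_smul dn (h9 l), fderiv_fun_neg, neg_apply, neg_smul _ (φ.f l x)]
    abel
  rw [lieX_along_antihol h7 h8 (h9 k), h3 h0 0 (zero_mem _) _ (hx.tangent_f k), along_smul h12 de,
    h6 k h0, along_antihol_comb, lieX_add (DifferentiableAt.fun_sum fun l _ => d1 l) d2,
    lieX_sum _ fun l _ => d1 l, lieX_smul (h11 k) de, h4 h0] at e1
  simp only [eL] at e1
  have e2 := congrArg (fun v => (φ.coframe x v).2.1 m) e1
  have eB : ∀ l, (φ.coframe x (lieX X (φ.f l) x)).2.1 m = - φ.symB X x m l := by simp [symB]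
  simp only [map_add, map_sub, map_smul, Prod.fst_add, Prod.snd_add, Prod.fst_sub,
    Prod.snd_sub, Prod.smul_fst, Prod.smul_snd, Pi.add_apply, Pi.sub_apply, Pi.smul_apply,
    coframe_e hx.unit, hx.coframe_xi, h5 h0, Pi.zero_apply, eB,
    coframe_f hx.unit, smul_eq_mul, mul_zero, add_zero, map_neg, Fin.sum_univ_two] at e2
  fin_cases m <;> simp [Fin.sum_univ_two] at e2 ⊢ <;> linear_combination e2

end AdaptedFrame

end CR4

end

noncomputable section

namespace CR4

/-! ### Derivatives of matrix-valued functions -/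

/-- The entrywise derivative of a matrix-valued function in a complex direction. -/
def alongM (Z : C4 × C4) (F : C4 → M2) (x : C4) : M2 :=
  Matrix.of fun i j => along Z (fun y => F y i j) x

theorem alongM_mul {F G : C4 → M2} {x : C4} (hF : ∀ i j, DifferentiableAt ℝ (fun y => F y i j) x)
    (hG : ∀ i j, DifferentiableAt ℝ (fun y => G y i j) x) (Z : C4 × C4) :
    alongM Z (fun y => F y * G y) x = alongM Z F x * G x + F x * alongM Z G x := by
  ext i j
  simp only [alongM, Matrix.mul_apply, Matrix.of_apply, Matrix.add_apply]
  rw [along_sum _ fun k _ => (hF i k).fun_mul (hG k j), ← Finset.sum_add_distrib]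
  exact Finset.sum_congr rfl fun k _ => along_mul (hF i k) (hG k j) Z

theorem alongM_congr {F G : C4 → M2} {x : C4} (h : F =ᶠ[𝓝 x] G) (Z : C4 × C4) :
    alongM Z F x = alongM Z G x := by
  ext i j
  exact along_congr (h.mono fun y hy => by rw [hy]) Z

theorem contDiffAt_mul_entries {F G : C4 → M2} {x : C4} {n : WithTop ℕ∞}
    (hF : ∀ i j, ContDiffAt ℝ n (fun y => F y i j) x)
    (hG : ∀ i j, ContDiffAt ℝ n (fun y => G y i j) x) (i j : Fin 2) :
    ContDiffAt ℝ n (fun y => (F y * G y) i j) x := by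
  simp only [Matrix.mul_apply]
  exact ContDiffAt.sum fun k _ => (hF i k).mul (hG k j)

theorem contDiffAt_det_entries {F : C4 → M2} {x : C4} {n : WithTop ℕ∞}
    (hF : ∀ i j, ContDiffAt ℝ n (fun y => F y i j) x) :
    ContDiffAt ℝ n (fun y => (F y).det) x := by
  simp only [Matrix.det_fin_two]
  exact ((hF 0 0).mul (hF 1 1)).sub ((hF 0 1).mul (hF 1 0))

theorem contDiffAt_inv_entries {F : C4 → M2} {x : C4} {n : WithTop ℕ∞}
    (hF : ∀ i j, ContDiffAt ℝ n (fun y => F y i j) x) (h : (F x).det ≠ 0) (i j : Fin 2) :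
    ContDiffAt ℝ n (fun y => (F y)⁻¹ i j) x := by
  have hd := (contDiffAt_det_entries hF).inv h
  simp only [Matrix.inv_def, Ring.inverse_eq_inv', Matrix.adjugate_fin_two, Matrix.smul_apply,
    smul_eq_mul]
  fin_cases i <;> fin_cases j
  · exact hd.mul (hF 1 1)
  · exact hd.mul (hF 0 1).neg
  · exact hd.mul (hF 1 0).neg
  · exact hd.mul (hF 0 0)

theorem contDiffAt_conj {F : C4 → ℂ} {x : C4} {n : WithTop ℕ∞} (hF : ContDiffAt ℝ n F x) :
    ContDiffAt ℝ n (fun y => (starRingEnd ℂ) (F y)) x :=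
  (Complex.conjCLE.contDiff.contDiffAt).comp x hF

/-- The second derivatives of F are paired with X(p) = 0, so only the derivative of X itself
remains. -/
theorem along_fderiv_apply_of_eq_zero {X : C4 → C4} {p : C4} (hX : AnalyticAt ℂ X p)
    (h0 : X p = 0) {F : C4 → ℂ} (hF : ContDiffAt ℝ 2 F p) (a b : C4) :
    along (a, b) (fun x => fderiv ℝ F x (X x)) p
      = along (fderiv ℂ X p a, fderiv ℂ X p b) F p := by
  have key : ∀ v, fderiv ℝ (fun x => fderiv ℝ F x (X x)) p v = fderiv ℝ F p (fderiv ℂ X p v) := by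
    intro v
    rw [fderiv_fderiv_apply hF (hX.differentiableAt.restrictScalars ℝ), h0, map_zero, zero_add,
      fderiv_real_eq hX]
  simp only [along, key, map_smul]

namespace AdaptedFrame

variable {ρ : C4 → ℝ} {p : C4} {X : C4 → C4}

theorem contDiffAt_s02 (φ : AdaptedFrame ρ p) (h : IsHypersurface ρ p) (i j : Fin 2) :
    ContDiffAt ℝ ∞ (fun x => φ.s02 x i j) p :=
  contDiffAt_mul_entries φ.smooth_xi (fun i j => contDiffAt_inv_entries φ.smooth_levi
    ((φ.eventually_isGood h).self_of_nhds h.zero).levi_nondeg.ne_zero i j) i j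

theorem eventually_s02_mul (φ : AdaptedFrame ρ p) (h : IsHypersurface ρ p) :
    ∀ᶠ x in 𝓝 p, φ.s02 x * φ.levi x = φ.xi x := by
  have h1 : ContinuousAt (fun x => (φ.levi x).det) p :=
    (contDiffAt_det_entries φ.smooth_levi).continuousAt
  filter_upwards [h1.eventually_ne
    ((φ.eventually_isGood h).self_of_nhds h.zero).levi_nondeg.ne_zero] with x hx
  rw [s02, mul_assoc, Matrix.nonsing_inv_mul _ (isUnit_iff_ne_zero.2 hx), mul_one]

/-- Differentiate S^{0,2} · `levi` = `xi` along X. The terms with the conjugate of B on the right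
cancel between `levi_lie` and `xi_lie`, and `levi` can then be divided off. -/
theorem s02_lie (φ : AdaptedFrame ρ p) (h : IsHypersurface ρ p) (hX : IsInfSymmetry ρ p X) :
    ∀ᶠ x in 𝓝 p, ρ x = 0 → alongM (X x, X x) φ.s02 x =
      φ.symB X x * φ.s02 x + φ.s02 x * (φ.symB X x)ᵀ
        - (φ.symA X x + φ.symC X x) • φ.s02 x := by
  filter_upwards [φ.levi_lie h hX, φ.xi_lie h hX, φ.eventually_isGood h,
    (φ.eventually_s02_mul h).eventually_nhds,
    Filter.eventually_all.2 fun i => Filter.eventually_all.2 fun j =>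
      eventually_differentiableAt (φ.contDiffAt_s02 h i j),
    Filter.eventually_all.2 fun i => Filter.eventually_all.2 fun j =>
      eventually_differentiableAt (φ.smooth_levi i j)] with x h1 h2 h3 h4 h5 h6 h0
  have hu := (h3 h0).levi_nondeg
  have e1 : alongM (X x, X x) φ.levi x = φ.symA X x • φ.levi x - (φ.symB X x)ᵀ * φ.levi x
      - φ.levi x * conjM (φ.symB X x) := by
    ext i j
    simp only [alongM, Matrix.of_apply, along_diag, h1 h0 i j, Matrix.sub_apply, Matrix.smul_apply,
      Matrix.mul_apply, Matrix.transpose_apply, conjM, Matrix.map_apply, smul_eq_mul]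
  have e2 : alongM (X x, X x) φ.xi x = φ.symB X x * φ.xi x - φ.symC X x • φ.xi x
      - φ.xi x * conjM (φ.symB X x) := by
    ext i j
    simp only [alongM, Matrix.of_apply, along_diag, h2 h0 i j, Matrix.sub_apply, Matrix.smul_apply,
      Matrix.mul_apply, conjM, Matrix.map_apply, smul_eq_mul]
  have e3 := alongM_congr h4 (X x, X x)
  rw [alongM_mul h5 h6, e1, e2, ← h4.self_of_nhds] at e3
  have e4 : alongM (X x, X x) φ.s02 x * φ.levi x = (φ.symB X x * φ.s02 x
      + φ.s02 x * (φ.symB X x)ᵀ - (φ.symA X x + φ.symC X x) • φ.s02 x) * φ.levi x := by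
    rw [← sub_eq_zero] at e3 ⊢
    rw [← e3]
    simp only [mul_sub, sub_mul, add_mul, add_smul, Matrix.mul_smul, Matrix.smul_mul, mul_assoc]
    abel
  have e5 := congrArg (· * (φ.levi x)⁻¹) e4
  simpa only [mul_assoc, Matrix.mul_nonsing_inv _ hu, mul_one] using e5

/-! ### The constraints on the linear isotropy -/

section Isotropy

variable (φ : AdaptedFrame ρ p)

/-- The minus signs in `symB`, `symC` and `symA` are there so that at a zero of X these are
coefficients of its linear part, not of the negative of it. -/
theorem symB_apply (h0 : X p = 0) (l k : Fin 2) :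
    φ.symB X p l k = (φ.coframe p (fderiv ℂ X p (φ.f k p))).2.1 l := by
  simp [symB, lieX_of_eq_zero h0]

theorem isotropy_e (h : IsHypersurface ρ p) (hX : IsInfSymmetry ρ p X) (h0 : X p = 0) :
    fderiv ℂ X p (φ.e p) = φ.symC X p • φ.e p := by
  have := (φ.lieX_e_eq h hX).self_of_nhds h.zero
  rw [lieX_of_eq_zero h0, neg_smul] at this
  exact neg_injective this

theorem isotropy_f (h : IsHypersurface ρ p) (hX : IsInfSymmetry ρ p X) (h0 : X p = 0)
    (k : Fin 2) : ∃ r : ℂ,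
    fderiv ℂ X p (φ.f k p) = ∑ l, φ.symB X p l k • φ.f l p + r • φ.e p := by
  have := (φ.lieX_f_eq h hX k).self_of_nhds h.zero
  rw [lieX_of_eq_zero h0] at this
  refine ⟨-(φ.coframe p (-(fderiv ℂ X p) (φ.f k p))).2.2, ?_⟩
  apply neg_injective
  rw [neg_add, neg_smul, neg_neg, ← Finset.sum_neg_distrib]
  simpa only [neg_smul] using this

/-- The linear part of X maps g to a tangent vector. If a had a nonzero imaginary part, ig would be
tangent as well, and g would lie in ℋ. -/
theorem isotropy_g (h : IsHypersurface ρ p) (hX : IsInfSymmetry ρ p X) (h0 : X p = 0) :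
    (φ.symA X p).im = 0 ∧
      fderiv ℂ X p (φ.g p) - φ.symA X p • φ.g p ∈ holTangent ρ p := by
  have hp := (φ.eventually_isGood h).self_of_nhds h.zero
  have h1 := (hX.lieX_tangent h φ.smooth_g φ.tangent_g).self_of_nhds h.zero
  have h2 : fderiv ℂ X p (φ.g p) - φ.symA X p • φ.g p ∈ holTangent ρ p := by
    rw [hp.mem_iff, map_sub, map_smul, coframe_g hp.unit]
    simp [symA, lieX_of_eq_zero h0]
  refine ⟨?_, h2⟩
  have h3 := h2.1
  rw [lieX_of_eq_zero h0, map_neg, neg_eq_zero] at h1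
  rw [map_sub, h1, zero_sub, neg_eq_zero, real_smul_decomp, map_add, map_smul, map_smul,
    hp.tangent_g, smul_zero, zero_add, smul_eq_mul, mul_eq_zero] at h3
  refine h3.resolve_right fun h4 => hp.transversal ⟨hp.tangent_g, h4⟩

theorem isotropy_levi (h : IsHypersurface ρ p) (hX : IsInfSymmetry ρ p X) (h0 : X p = 0) :
    (φ.symB X p)ᵀ * φ.levi p + φ.levi p * conjM (φ.symB X p) = φ.symA X p • φ.levi p := by
  ext i j
  have := (φ.levi_lie h hX).self_of_nhds h.zero i j
  rw [h0, map_zero] at this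
  simp only [Matrix.add_apply, Matrix.mul_apply, Matrix.transpose_apply, conjM, Matrix.map_apply,
    Matrix.smul_apply, smul_eq_mul]
  linear_combination this

theorem isotropy_s02 (h : IsHypersurface ρ p) (hX : IsInfSymmetry ρ p X) (h0 : X p = 0) :
    φ.symB X p * φ.s02 p + φ.s02 p * (φ.symB X p)ᵀ
      = (φ.symA X p + φ.symC X p) • φ.s02 p := by
  have := (φ.s02_lie h hX).self_of_nhds h.zero
  rw [h0] at this
  have e : alongM ((0 : C4), (0 : C4)) φ.s02 p = 0 := by
    ext i j; simp [alongM, along_zero_left]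
  rw [e] at this
  exact sub_eq_zero.1 this.symm

/-- Apply X to the bracket [e, f_k] and compare f-coefficients at p. The Lie derivative of f_k has
the coefficients −B, and the bracket differentiates them along e; this is where e(B) comes from. -/
theorem isotropy_om (h : IsHypersurface ρ p) (hX : IsInfSymmetry ρ p X) (h0 : X p = 0) :
    alongM (φ.e p, 0) (φ.symB X) p =
      φ.symB X p * φ.om p - φ.om p * φ.symB X p - φ.symC X p • φ.om p := by
  have hp := (φ.eventually_isGood h).self_of_nhds h.zero
  ext m k
  have cC : ContDiffAt ℝ ∞ (fun y => -φ.symC X y) p := (φ.contDiffAt_symC h hX).neg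
  have L2 := (h.along_congr (G := fun y => (-φ.symC X y) • φ.e y)
    (contDiffAt_lieX hX.1 φ.smooth_e) (cC.smul φ.smooth_e) (φ.lieX_e_eq h hX)).self_of_nhds h.zero
  have cr := φ.contDiffAt_coframe_e h (contDiffAt_lieX hX.1 (φ.smooth_f k))
  have cB : ∀ l, ContDiffAt ℝ ∞ (fun y => - φ.symB X y l k) p :=
    fun l => (φ.contDiffAt_symB h hX l k).neg
  have L3 := (h.along_congr (G := fun y => ∑ l, (-φ.symB X y l k) • φ.f l y +
      (φ.coframe y (lieX X (φ.f k) y)).2.2 • φ.e y)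
    (contDiffAt_lieX hX.1 (φ.smooth_f k))
    ((ContDiffAt.sum fun l _ => (cB l).smul (φ.smooth_f l)).add (cr.smul φ.smooth_e))
    (φ.lieX_f_eq h hX k)).self_of_nhds h.zero
  have de := (eventually_differentiableAt φ.smooth_e).self_of_nhds
  have df := fun l => (eventually_differentiableAt (φ.smooth_f l)).self_of_nhds
  have e1 := lieX_bracket_hol hX.1 ((eventually_contDiffAt φ.smooth_e 2).self_of_nhds)
    ((eventually_contDiffAt (φ.smooth_f k) 2).self_of_nhds)
  rw [lieX_of_eq_zero h0, (φ.lieX_e_eq h hX).self_of_nhds h.zero, along_hol_smul,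
    L2 _ (hp.tangent_f k) 0 (zero_mem _), L3 _ hp.tangent_e 0 (zero_mem _),
    (φ.lieX_f_eq h hX k).self_of_nhds h.zero, along_hol_comb,
    along_smul ((eventually_differentiableAt cC).self_of_nhds) de,
    φ.along_comb_fun (fun l => (eventually_differentiableAt (cB l)).self_of_nhds)
      (eventually_differentiableAt cr).self_of_nhds df de] at e1
  have e2 := congrArg (fun v => (φ.coframe p v).2.1 m) e1
  have ev : ∀ v : C4, along (φ.e p, 0) (φ.f k) p - along (φ.f k p, 0) φ.e p = v →
      v = ∑ l, φ.om p l k • φ.f l p + (φ.coframe p v).2.2 • φ.e p := by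
    rintro v rfl
    have hH : (φ.coframe p (along (φ.e p, 0) (φ.f k) p - along (φ.f k p, 0) φ.e p)).1 = 0 := by
      have := ((mem_span_iff hp _).1 (hp.om_spec k)).1
      rw [map_sub, Prod.fst_sub, map_sum] at this
      simpa [coframe_f hp.unit, Prod.fst_sum] using this
    have := hp.expand ((hp.mem_iff _).2 hH)
    simp only [hp.coframe_om] at this
    exact this
  rw [ev _ rfl] at e2
  have eL : ∀ l, (φ.coframe p (fderiv ℂ X p (φ.f l p))).2.1 m = φ.symB X p m l :=
    fun l => (φ.symB_apply h0 m l).symm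
  -- Only the difference of the two halves of a bracket is controlled by `om`. The halves that
  -- differentiate e along f_l stay symbolic and cancel at the end.
  have eO : ∀ l, (φ.coframe p (along (φ.e p, 0) (φ.f l) p)).2.1 m
      = φ.om p m l + (φ.coframe p (along (φ.f l p, 0) φ.e p)).2.1 m := by
    intro l
    rw [← hp.coframe_om m l, map_sub, Prod.snd_sub, Prod.fst_sub, Pi.sub_apply, sub_add_cancel]
  simp only [map_add, map_sub, map_neg, map_smul, φ.isotropy_e h hX h0, Prod.fst_add, Prod.snd_add,
    Prod.fst_sub, Prod.snd_sub, Prod.fst_neg, Prod.snd_neg, Prod.smul_fst, Prod.smul_snd,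
    Pi.add_apply, Pi.sub_apply, Pi.neg_apply, Pi.smul_apply, coframe_e hp.unit, Pi.zero_apply, eL,
    eO, coframe_f hp.unit, smul_eq_mul, mul_zero, add_zero, Fin.sum_univ_two, along_neg] at e2
  simp only [alongM, Matrix.of_apply, Matrix.sub_apply, Matrix.mul_apply, Matrix.smul_apply,
    smul_eq_mul, Fin.sum_univ_two]
  fin_cases m <;> simp at e2 ⊢ <;> linear_combination e2

/-- Differentiate `s02_lie` along the tangent direction e. As X vanishes at p, the left side becomes
c times the e-derivative of S^{0,2}. The scalar κ is the e-derivative of a + c. -/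
theorem isotropy_derivE (h : IsHypersurface ρ p) (hX : IsInfSymmetry ρ p X) (h0 : X p = 0) :
    ∃ κ : ℂ, alongM (φ.e p, 0) (φ.symB X) p * φ.s02 p + φ.s02 p * (alongM (φ.e p, 0) (φ.symB X) p)ᵀ
      = κ • φ.s02 p + (φ.symA X p + 2 * φ.symC X p) • φ.derivE φ.s02
        - (φ.symB X p * φ.derivE φ.s02 + φ.derivE φ.s02 * (φ.symB X p)ᵀ) := by
  have hp := (φ.eventually_isGood h).self_of_nhds h.zero
  have cS := φ.contDiffAt_s02 h
  have cB := φ.contDiffAt_symB h hX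
  have cAC := (φ.contDiffAt_symA h hX).add (φ.contDiffAt_symC h hX)
  have dS := fun i j => (eventually_differentiableAt (cS i j)).self_of_nhds
  have dB := fun i j => (eventually_differentiableAt (cB i j)).self_of_nhds
  have dAC : DifferentiableAt ℝ (fun x => φ.symA X x + φ.symC X x) p :=
    (eventually_differentiableAt cAC).self_of_nhds
  refine ⟨along (φ.e p, 0) (fun x => φ.symA X x + φ.symC X x) p, ?_⟩
  have key : ∀ i j, along (φ.e p, 0) (fun x => fderiv ℝ (fun y => φ.s02 y i j) x (X x)) p =
      along (φ.e p, 0) (fun x => (φ.symB X x * φ.s02 x) i j + (φ.s02 x * (φ.symB X x)ᵀ) i j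
        - (φ.symA X x + φ.symC X x) * φ.s02 x i j) p := by
    intro i j
    refine (h.along_congr ?_ ?_ ?_).self_of_nhds h.zero _ hp.tangent_e 0 (zero_mem _)
    · exact ((cS i j).fderiv_right (by simp)).clm_apply (contDiffAt_real hX.1)
    · exact ((contDiffAt_mul_entries cB cS i j).add
        (contDiffAt_mul_entries cS (fun i j => cB j i) i j)).sub (cAC.mul (cS i j))
    · filter_upwards [φ.s02_lie h hX] with x h1 h2
      have := congrFun (congrFun (h1 h2) i) j
      simpa [alongM, along_diag] using this
  have e1 := alongM_mul dB dS (φ.e p, 0)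
  have e2 := alongM_mul dS (G := fun y => (φ.symB X y)ᵀ) (fun i j => dB j i) (φ.e p, 0)
  ext i j
  have k := key i j
  have d1 : DifferentiableAt ℝ (fun x => (φ.symB X x * φ.s02 x) i j) p :=
    (contDiffAt_mul_entries cB cS i j).differentiableAt (by simp)
  have d2 : DifferentiableAt ℝ (fun x => (φ.s02 x * (φ.symB X x)ᵀ) i j) p :=
    (contDiffAt_mul_entries cS (fun i j => cB j i) i j).differentiableAt (by simp)
  rw [along_fderiv_apply_of_eq_zero hX.1 h0 ((eventually_contDiffAt (cS i j) 2).self_of_nhds),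
    φ.isotropy_e h hX h0, map_zero, along_hol_smul, along_sub (d1.fun_add d2) (dAC.fun_mul (dS i j)),
    along_add d1 d2, along_mul dAC (dS i j)] at k
  have e1' := congrFun (congrFun e1 i) j
  have e2' := congrFun (congrFun e2 i) j
  have e3 : (alongM (φ.e p, 0) (fun y => (φ.symB X y)ᵀ) p) = (alongM (φ.e p, 0) (φ.symB X) p)ᵀ := by
    ext i j; rfl
  have e4 : alongM (φ.e p, 0) φ.s02 p = φ.derivE φ.s02 := rfl
  rw [e3, e4] at e2'
  rw [e4] at e1'
  have e5 : along (φ.e p, 0) (fun x => φ.s02 x i j) p = φ.derivE φ.s02 i j := rfl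
  simp only [alongM, Matrix.of_apply] at e1' e2'
  rw [e1', e2', e5] at k
  simp only [Matrix.add_apply, Matrix.sub_apply, Matrix.smul_apply, smul_eq_mul] at k ⊢
  simp only [alongM]
  linear_combination -k

end Isotropy

end AdaptedFrame

end CR4

end

/-! ### The algebra preserving the symbol, and the upper bound. -/

noncomputable section

namespace CR4

theorem conjM_add (A B : M2) : conjM (A + B) = conjM A + conjM B := by
  ext i j; simp [conjM]

theorem conjM_mul (A B : M2) : conjM (A * B) = conjM A * conjM B := by
  simp [conjM, Matrix.map_mul]

theorem conjM_conjM (A : M2) : conjM (conjM A) = A := by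
  ext i j; simp [conjM]

theorem conjM_transpose (A : M2) : conjM Aᵀ = (conjM A)ᵀ := rfl

theorem conjM_real_smul (r : ℝ) (A : M2) : conjM (r • A) = r • conjM A := by
  ext i j; simp [conjM]

/-- The weighted degree zero linear maps `(w, z, ζ) ↦ (a w, B z, c ζ)` that preserve the data
`H`, `S`, `Ω`. -/
def symbolAlgebra (H S Ω : M2) : Submodule ℝ M2 where
  carrier := {B | ∃ (a : ℝ) (c : ℂ), Bᵀ * H + H * conjM B = (a : ℂ) • H ∧
    B * S + S * Bᵀ = ((a : ℂ) + c) • S ∧ B * Ω - Ω * B = c • Ω}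
  add_mem' := by
    rintro B B' ⟨a, c, h1, h2, h3⟩ ⟨a', c', k1, k2, k3⟩
    refine ⟨a + a', c + c', ?_, ?_, ?_⟩
    · rw [Complex.ofReal_add, add_smul, ← h1, ← k1, conjM_add, Matrix.transpose_add]
      noncomm_ring
    · rw [Complex.ofReal_add, add_add_add_comm, add_smul, ← h2, ← k2, Matrix.transpose_add]
      noncomm_ring
    · rw [add_smul, ← h3, ← k3]
      noncomm_ring
  zero_mem' := ⟨0, 0, by ext i j; simp [conjM], by simp, by simp⟩
  smul_mem' := by
    rintro r B ⟨a, c, h1, h2, h3⟩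
    refine ⟨r * a, r * c, ?_, ?_, ?_⟩
    · rw [Complex.ofReal_mul, mul_smul, ← h1, conjM_real_smul, Matrix.transpose_smul,
        Matrix.smul_mul, Matrix.mul_smul, Complex.coe_smul, smul_add]
    · rw [Complex.ofReal_mul, ← mul_add, mul_smul, ← h2, Matrix.transpose_smul,
        Matrix.smul_mul, Matrix.mul_smul, Complex.coe_smul, smul_add]
    · rw [mul_smul, ← h3, Matrix.smul_mul, Matrix.mul_smul, Complex.coe_smul, smul_sub]

/-- In each row of the table the normalization condition forces a symmetry to preserve `Ω`
itself, and not only modulo `𝔤'₀₀`. -/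
theorem IsTableSymbol.commutator_eq {H S Ω : M2} {N : Submodule ℂ M2}
    (hs : IsTableSymbol H S Ω N) {B n : M2} {a : ℝ} {c κ : ℂ} (hn : n ∈ N)
    (h1 : Bᵀ * H + H * conjM B = (a : ℂ) • H) (h2 : B * S + S * Bᵀ = ((a : ℂ) + c) • S)
    (h3 : (B * Ω - Ω * B - c • Ω) * S + S * (B * Ω - Ω * B - c • Ω)ᵀ
      = κ • S + ((a : ℂ) + 2 * c) • n - (B * n + n * Bᵀ)) :
    B * Ω - Ω * B = c • Ω := by
  have entry : ∀ {P Q : M2}, P = Q → ∀ i j, P i j = Q i j := fun h i j => by rw [h]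
  cases hs with
  | row1 ε hε l τ hl hτ =>
    obtain ⟨ν, rfl⟩ := Submodule.mem_span_singleton.1 hn
    have a1 := entry h1 0 1
    have b0 := entry h2 0 0
    have b1 := entry h2 1 1
    have b2 := entry h2 0 1
    have c1 := entry h3 0 1
    simp only [Matrix.add_apply, Matrix.sub_apply, Matrix.smul_apply, Matrix.mul_apply,
      Matrix.transpose_apply, conjM, Matrix.map_apply, Fin.sum_univ_two] at a1 b0 b1 b2 c1
    simp at a1 b0 b1 b2 c1
    have hl0 : (l : ℂ) ≠ 0 := by
      rw [Ne, Complex.ofReal_eq_zero]; linarith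
    have e10 : B 1 0 = - (l * B 0 1) := by linear_combination b2
    -- The Levi form makes the two off-diagonal entries equal in modulus, while S makes one −λ times
    -- the other. As λ > 1, both vanish.
    have n1 : ‖B 1 0‖ = ‖B 0 1‖ := by
      have : B 1 0 * ε = - (starRingEnd ℂ) (B 0 1) := by linear_combination a1
      have h := congrArg norm this
      rw [norm_mul, norm_neg, RCLike.norm_conj] at h
      rcases hε with rfl | rfl <;> simpa using h
    have z01 : B 0 1 = 0 := by
      rw [e10, norm_neg, norm_mul, Complex.norm_real, Real.norm_of_nonneg (by linarith)] at n1
      have : (l - 1) * ‖B 0 1‖ = 0 := by linarith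
      exact norm_eq_zero.1 ((mul_eq_zero.1 this).resolve_left (by linarith))
    have z10 : B 1 0 = 0 := by rw [e10, z01]; simp
    have e11 : B 1 1 = B 0 0 := by
      apply mul_left_cancel₀ hl0
      linear_combination b1 / 2 - l * b0 / 2
    -- B is now scalar, so it commutes with Ω. The (0, 1) entry of `h3` receives nothing from S or
    -- from N and reads cτ(1 − λ²) = 0 up to sign.
    have hc : c * τ = 0 := by
      rw [z01, e11] at c1
      have h5 : (1 - (l : ℂ) ^ 2) ≠ 0 := by
        norm_cast
        nlinarith
      apply mul_left_cancel₀ h5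
      linear_combination -c1
    ext i j
    fin_cases i <;> fin_cases j <;>
      simp only [Matrix.sub_apply, Matrix.smul_apply, Matrix.mul_apply, Fin.sum_univ_two] <;>
      simp [z01, z10, e11]
    · linear_combination l * hc
    · linear_combination -hc
  | row2 θ τ hθ hθ' hτ =>
    obtain ⟨ν, rfl⟩ := Submodule.mem_span_singleton.1 hn
    have hsin : Real.sin θ ≠ 0 := (Real.sin_pos_of_pos_of_lt_pi hθ hθ').ne'
    have him : (Complex.exp (Complex.I * θ)).im = Real.sin θ := by
      rw [mul_comm, Complex.exp_ofReal_mul_I_im]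
    have hq0 : Complex.exp (Complex.I * θ) ≠ 0 := Complex.exp_ne_zero _
    generalize Complex.exp (Complex.I * θ) = q at *
    have hq : q.im ≠ 0 := by rwa [him]
    have a0 := entry h1 0 0
    have a1 := entry h1 1 1
    have b0 := entry h2 0 0
    have b1 := entry h2 1 1
    have b2 := entry h2 0 1
    have c1 := entry h3 0 1
    simp only [Matrix.add_apply, Matrix.sub_apply, Matrix.smul_apply, Matrix.mul_apply,
      Matrix.transpose_apply, conjM, Matrix.map_apply, Fin.sum_univ_two] at a0 a1 b0 b1 b2 c1
    simp at a0 a1 b0 b1 b2 c1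
    have r0 : (B 1 0).re = 0 := by
      have := congrArg Complex.re a0; simp at this; linarith
    have r1 : (B 0 1).re = 0 := by
      have := congrArg Complex.re a1; simp at this; linarith
    -- Both off-diagonal entries are purely imaginary by the Levi form. Their relation q B₀₁ + B₁₀ =
    -- 0 has a nonreal coefficient q, so its real part kills B₀₁.
    have z01 : B 0 1 = 0 := by
      have := congrArg Complex.re b2
      simp [r0, r1, hq] at this
      exact Complex.ext r1 this
    have z10 : B 1 0 = 0 := by rw [z01] at b2; simpa using b2
    have e11 : B 1 1 = B 0 0 := by
      apply mul_left_cancel₀ hq0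
      linear_combination b1 / 2 - q * b0 / 2
    have hc : c * τ = 0 := by
      rw [z01, e11] at c1
      have h5 : (1 - q ^ 2) ≠ 0 := by
        intro h5
        have : (q - 1) * (q + 1) = 0 := by linear_combination -h5
        rcases mul_eq_zero.1 this with h | h
        · apply hq; rw [sub_eq_zero.1 h]; simp
        · apply hq; rw [eq_neg_of_add_eq_zero_left h]; simp
      apply mul_left_cancel₀ h5
      linear_combination -c1
    ext i j
    fin_cases i <;> fin_cases j <;>
      simp only [Matrix.sub_apply, Matrix.smul_apply, Matrix.mul_apply, Fin.sum_univ_two] <;>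
      simp [z01, z10, e11]
    · linear_combination q * hc
    · linear_combination -hc
  | row3 ε hε => simp
  | row4 ε hε τ hτ =>
    obtain ⟨ν, rfl⟩ := Submodule.mem_span_singleton.1 hn
    have a1 := entry h1 0 1
    have b2 := entry h2 0 1
    have c1 := entry h3 0 1
    simp only [Matrix.add_apply, Matrix.sub_apply, Matrix.smul_apply, Matrix.mul_apply,
      Matrix.transpose_apply, conjM, Matrix.map_apply, Fin.sum_univ_two] at a1 b2 c1
    simp at a1 b2 c1
    rw [b2] at a1
    have z01 : B 0 1 = 0 := by simpa using a1
    ext i j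
    fin_cases i <;> fin_cases j <;>
      simp only [Matrix.sub_apply, Matrix.smul_apply, Matrix.mul_apply, Fin.sum_univ_two] <;>
      simp [z01, b2]
    -- B is diagonal but need not be scalar, so c may be nonzero even when τ is not. The (0, 1)
    -- entry of `h3` is free of S and N, and it is exactly the only possibly nonzero entry of the
    -- defect.
    rw [z01] at c1
    linear_combination c1
  | row5 => simp
  | row6 τ hτ =>
    obtain ⟨ν, rfl⟩ := Submodule.mem_span_singleton.1 hn
    have a0 := entry h1 0 1
    have a1 := entry h1 1 1
    have b0 := entry h2 0 0
    have b1 := entry h2 1 1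
    have b2 := entry h2 0 1
    have c0 := entry h3 0 0
    have c1 := entry h3 0 1
    simp only [Matrix.add_apply, Matrix.sub_apply, Matrix.smul_apply, Matrix.mul_apply,
      Matrix.transpose_apply, conjM, Matrix.map_apply, Fin.sum_univ_two] at a0 a1 b0 b1 b2 c0 c1
    simp at a0 a1 b0 b1 b2 c0 c1
    have z10 : B 1 0 = 0 := b1
    have e11 : B 1 1 = B 0 0 + 2 * B 0 1 := by linear_combination b2 - b0 - z10
    -- By the equation for S, the diagonal entries differ by 2 B₀₁. The Levi form makes this
    -- difference real and B₀₁ purely imaginary.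
    have z01 : B 0 1 = 0 := by
      have r := congrArg Complex.re a1
      have i := congrArg Complex.im a0
      simp [e11] at r i
      exact Complex.ext (by simp; linarith) (by simp; linarith)
    rw [z01, mul_zero, add_zero] at e11
    -- S has equal entries at (0, 0) and (0, 1), so subtracting these two entries of `h3` eliminates
    -- κ.
    have hc : c * τ = 0 := by
      simp only [z01, z10, e11] at c0 c1
      linear_combination (c1 - c0) / 4
    ext i j
    fin_cases i <;> fin_cases j <;>
      simp only [Matrix.sub_apply, Matrix.smul_apply, Matrix.mul_apply, Fin.sum_univ_two] <;>
      simp [z01, z10, e11]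
    · linear_combination -2 * hc
    · linear_combination -hc
  | row7 => simp

theorem IsTableSymbol.ne_zero {H S Ω : M2} {N : Submodule ℂ M2}
    (hs : IsTableSymbol H S Ω N) : S ≠ 0 := by
  intro h
  have h00 := congrFun (congrFun h 0) 0
  have h01 := congrFun (congrFun h 0) 1
  cases hs <;> simp at h00 h01

/-- The kernel of f on I lies in P, so the image of I modulo P is a quotient of I / ker f, which
embeds in A. -/
theorem finrank_map_mkQ_le {V W : Type*} [AddCommGroup V] [Module ℝ V] [AddCommGroup W]
    [Module ℝ W] [FiniteDimensional ℝ W] (I P : Submodule ℝ V) (A : Submodule ℝ W)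
    (f : V →ₗ[ℝ] W) (h1 : ∀ v ∈ I, f v ∈ A) (h2 : ∀ v ∈ I, f v = 0 → v ∈ P) :
    Module.finrank ℝ (I.map P.mkQ) ≤ Module.finrank ℝ A := by
  let F : I →ₗ[ℝ] W := f.domRestrict I
  let G : I →ₗ[ℝ] V ⧸ P := P.mkQ.domRestrict I
  have hle : LinearMap.ker F ≤ LinearMap.ker G := by
    intro v hv
    rw [LinearMap.mem_ker] at hv ⊢
    exact (Submodule.Quotient.mk_eq_zero P).2 (h2 v v.2 hv)
  have eG : I.map P.mkQ = LinearMap.range ((LinearMap.ker F).liftQ G hle) := by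
    rw [Submodule.range_liftQ]
    ext y
    simp [G, Submodule.mem_map]
  have e := F.quotKerEquivRange
  have : FiniteDimensional ℝ (I ⧸ LinearMap.ker F) := Module.Finite.equiv e.symm
  rw [eG]
  calc _ ≤ Module.finrank ℝ (I ⧸ LinearMap.ker F) := LinearMap.finrank_range_le _
    _ = Module.finrank ℝ (LinearMap.range F) := e.finrank_eq
    _ ≤ Module.finrank ℝ A := Submodule.finrank_mono (by
        rintro _ ⟨v, rfl⟩
        exact h1 v v.2)

theorem IsTwoNondegenerate.isHypersurface {ρ : C4 → ℝ} {p : C4} (h : IsTwoNondegenerate ρ p) :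
    IsHypersurface ρ p :=
  ⟨h.1.contDiffAt, h.2.1, h.2.2.1⟩

/-- The matrix of a linear map in the basis `f₁, f₂` of `ℋ / 𝒦`. -/
def AdaptedFrame.isotropyMatrix {ρ : C4 → ℝ} {p : C4} (φ : AdaptedFrame ρ p) :
    (C4 →L[ℂ] C4) →ₗ[ℝ] M2 where
  toFun L := Matrix.of fun l k => (φ.coframe p (L (φ.f k p))).2.1 l
  map_add' L L' := by ext l k; simp
  map_smul' r L := by
    ext l k
    simp only [RingHom.id_apply, Matrix.of_apply, Matrix.smul_apply, ← Complex.coe_smul,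
      smul_apply, map_smul, Prod.smul_snd, Prod.smul_fst, Pi.smul_apply]

theorem AdaptedFrame.isotropyMatrix_eq {ρ : C4 → ℝ} {p : C4} (φ : AdaptedFrame ρ p)
    {X : C4 → C4} (h0 : X p = 0) : φ.isotropyMatrix (fderiv ℂ X p) = φ.symB X p := by
  ext l k
  rw [φ.symB_apply h0]
  rfl

/-- `isotropy_om` and `isotropy_derivE` together give the hypothesis of
`IsTableSymbol.commutator_eq`, but for `om` at p instead of Ω and with e(S^{0,2}) instead of its
N-part. Both corrections contribute only multiples of S. -/
theorem mem_symbolAlgebra_of_isotropy {ρ : C4 → ℝ} {p : C4} {H S Ω : M2} {N : Submodule ℂ M2}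
    (hs : IsTableSymbol H S Ω N) (h : IsHypersurface ρ p) (φ : AdaptedFrame ρ p)
    (hH : φ.levi p = H) (hS : φ.s02 p = S)
    (hO : φ.derivE φ.s02 ∈ N ⊔ Submodule.span ℂ {φ.s02 p}) (hΩ : φ.om p - Ω ∈ g00 H S)
    {X : C4 → C4} (hX : IsInfSymmetry ρ p X) (h0 : X p = 0) :
    φ.symB X p ∈ symbolAlgebra H S Ω := by
  have a_im := (φ.isotropy_g h hX h0).1
  have ha : φ.symA X p = ((φ.symA X p).re : ℂ) := by
    apply Complex.ext <;> simp [a_im]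
  have e1 := φ.isotropy_levi h hX h0
  have e2 := φ.isotropy_s02 h hX h0
  obtain ⟨κ, e3⟩ := φ.isotropy_derivE h hX h0
  rw [φ.isotropy_om h hX h0] at e3
  rw [hS] at e2 e3 hO
  rw [hH] at e1
  rw [ha] at e1 e2 e3
  generalize φ.symB X p = B at *
  generalize φ.symC X p = c at *
  generalize (φ.symA X p).re = a at *
  obtain ⟨n, hn, m, hm, hnm⟩ := Submodule.mem_sup.1 hO
  obtain ⟨σ, rfl⟩ := Submodule.mem_span_singleton.1 hm
  obtain ⟨γ, hγ⟩ := Submodule.mem_span_singleton.1 hΩ.1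
  -- Here cγ comes from the part of `om` in `g00`, which acts on S by γ. The terms with σ come from
  -- the S-part of e(S^{0,2}), on which B acts by a + c.
  refine ⟨a, c, e1, e2, hs.commutator_eq (κ := κ + c * γ + (a + 2 * c) * σ - σ * (a + c)) hn e1 e2
    ?_⟩
  obtain ⟨G, hG⟩ : ∃ G, G = φ.om p - Ω := ⟨_, rfl⟩
  have hG' : φ.om p = Ω + G := by rw [hG]; abel
  rw [← hG] at hγ
  rw [hG', ← hnm] at e3
  -- Both B and G act on S by scalars, so their commutator annihilates S.
  have e4 : (B * G - G * B) * S + S * (B * G - G * B)ᵀ = 0 := by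
    have : (B * G - G * B) * S + S * (B * G - G * B)ᵀ =
        B * (G * S + S * Gᵀ) + (G * S + S * Gᵀ) * Bᵀ - (G * (B * S + S * Bᵀ)
          + (B * S + S * Bᵀ) * Gᵀ) := by
      rw [Matrix.transpose_sub, Matrix.transpose_mul, Matrix.transpose_mul]
      noncomm_ring
    rw [this, ← hγ, e2, Matrix.mul_smul, Matrix.smul_mul, Matrix.mul_smul, Matrix.smul_mul,
      ← smul_add, ← smul_add, e2, ← hγ, smul_comm, sub_self]
  have e5 : (B * Ω - Ω * B - c • Ω) * S + S * (B * Ω - Ω * B - c • Ω)ᵀ =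
      ((B * (Ω + G) - (Ω + G) * B - c • (Ω + G)) * S
        + S * (B * (Ω + G) - (Ω + G) * B - c • (Ω + G))ᵀ)
      - ((B * G - G * B) * S + S * (B * G - G * B)ᵀ) + c • (G * S + S * Gᵀ) := by
    simp only [Matrix.transpose_sub, Matrix.transpose_mul, Matrix.transpose_smul,
      Matrix.transpose_add, mul_add, add_mul, mul_sub, sub_mul, smul_add, Matrix.smul_mul,
      Matrix.mul_smul, mul_assoc]
    abel
  have e6 : B * (n + σ • S) + (n + σ • S) * Bᵀ = B * n + n * Bᵀ + σ • ((a + c : ℂ) • S) := by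
    rw [← e2, mul_add, add_mul, Matrix.mul_smul, Matrix.smul_mul, smul_add]
    abel
  rw [e5, e4, e3, e6, ← hγ]
  module

theorem degreeZeroIsotropyDim_le {ρ : C4 → ℝ} {p : C4} {H S Ω : M2} {N : Submodule ℂ M2}
    (hs : IsTableSymbol H S Ω N) (h : IsHypersurface ρ p) (hsym : HasModifiedSymbol ρ p H S Ω N) :
    degreeZeroIsotropyDim ρ p ≤ Module.finrank ℝ (symbolAlgebra H S Ω) := by
  obtain ⟨φ, hH, hS, -, hO, hΩ⟩ := hsym
  have hp := (φ.eventually_isGood h).self_of_nhds h.zero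
  refine finrank_map_mkQ_le _ _ _ φ.isotropyMatrix ?_ ?_
  · rintro _ ⟨X, hX, h0, rfl⟩
    rw [φ.isotropyMatrix_eq h0]
    exact mem_symbolAlgebra_of_isotropy hs h φ hH hS hO hΩ hX h0
  · rintro _ ⟨X, hX, h0, rfl⟩ hB
    rw [φ.isotropyMatrix_eq h0] at hB
    -- With B = 0, invariance of the invertible Levi matrix gives a = 0, and then invariance of S ≠
    -- 0 gives c = 0.
    have ha : φ.symA X p = 0 := by
      have e1 := φ.isotropy_levi h hX h0
      have hc : conjM (0 : M2) = 0 := by ext i j; simp [conjM]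
      rw [hB, hc, Matrix.transpose_zero, zero_mul, mul_zero, add_zero] at e1
      refine (smul_eq_zero.1 e1.symm).resolve_right fun h' => hp.levi_nondeg.ne_zero ?_
      rw [h']; simp
    have hc : φ.symC X p = 0 := by
      have e2 := φ.isotropy_s02 h hX h0
      rw [hB, Matrix.transpose_zero, zero_mul, mul_zero, add_zero, ha, zero_add] at e2
      refine (smul_eq_zero.1 e2.symm).resolve_right ?_
      rw [hS]; exact hs.ne_zero
    have he : fderiv ℂ X p (φ.e p) = 0 := by rw [φ.isotropy_e h hX h0, hc, zero_smul]
    have hf : ∀ k, fderiv ℂ X p (φ.f k p) ∈ Submodule.span ℂ {φ.e p} := by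
      intro k
      obtain ⟨r, hr⟩ := φ.isotropy_f h hX h0 k
      rw [hr, hB]
      simpa using Submodule.smul_mem _ r (Submodule.mem_span_singleton_self _)
    have hg : fderiv ℂ X p (φ.g p) ∈ holTangent ρ p := by
      have := (φ.isotropy_g h hX h0).2
      rwa [ha, zero_smul, sub_zero] at this
    have hle : Submodule.span ℂ {φ.e p} ≤ holTangent ρ p :=
      (Submodule.span_singleton_le_iff_mem _ _).2 hp.tangent_e
    refine ⟨fun v => ?_, fun v hv => ?_, fun v hv => ?_⟩
    · rw [AdaptedFrame.coframe_expand hp.unit v]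
      simp only [map_add, map_sum, map_smul, he, smul_zero, add_zero]
      exact add_mem (Submodule.smul_mem _ _ hg)
        (Submodule.sum_mem _ fun l _ => Submodule.smul_mem _ _ (hle (hf l)))
    · rw [φ.leviKernel_eq h, hp.expand hv]
      simp only [map_add, map_sum, map_smul, he, smul_zero, add_zero]
      exact Submodule.sum_mem _ fun l _ => Submodule.smul_mem _ _ (hf l)
    · rw [φ.leviKernel_eq h, Submodule.mem_span_singleton] at hv
      obtain ⟨r, rfl⟩ := hv
      rw [map_smul, he, smul_zero]

end CR4

end

/-! ### Matrix exponentials and the derivative of 𝐒(ζ). -/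

noncomputable section

namespace CR4

section MatrixExp

variable {m n : Type*} [Fintype m] [DecidableEq m] [Fintype n] [DecidableEq n]

theorem fromBlocks_pow_exists (P : Matrix m m ℂ) (Q : Matrix m n ℂ) (R : Matrix n n ℂ) (k : ℕ) :
    ∃ Q', (Matrix.fromBlocks P Q 0 R) ^ k = Matrix.fromBlocks (P ^ k) Q' 0 (R ^ k) := by
  induction k with
  | zero => exact ⟨0, by simp [Matrix.fromBlocks_one]⟩
  | succ k ih =>
    obtain ⟨Q', h⟩ := ih
    refine ⟨P ^ k * Q + Q' * R, ?_⟩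
    rw [pow_succ, h, Matrix.fromBlocks_multiply]
    simp [pow_succ]

theorem hasSum_exp_entry (A : Matrix m m ℂ) (i j : m) :
    HasSum (fun k : ℕ => ((k.factorial : ℂ))⁻¹ * (A ^ k) i j) (NormedSpace.exp A i j) := by
  open scoped Matrix.Norms.Operator in
  exact (NormedSpace.exp_series_hasSum_exp' (𝕂 := ℂ) A).mapL
    (LinearMap.toContinuousLinearMap (Matrix.entryLinearMap ℂ ℂ i j))

/-- Powers of a block triangular matrix have the powers of the blocks on the diagonal, and the
exponential series is summed entry by entry. -/
theorem exp_fromBlocks_zero (P : Matrix m m ℂ) (Q : Matrix m n ℂ) (R : Matrix n n ℂ) :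
    ∃ Q', NormedSpace.exp (Matrix.fromBlocks P Q 0 R)
      = Matrix.fromBlocks (NormedSpace.exp P) Q' 0 (NormedSpace.exp R) := by
  refine ⟨(NormedSpace.exp (Matrix.fromBlocks P Q 0 R)).toBlocks₁₂, ?_⟩
  choose Q' hQ using fromBlocks_pow_exists P Q R
  ext (i | i) (j | j)
  · refine (hasSum_exp_entry _ _ _).unique ?_
    simpa [hQ] using hasSum_exp_entry P i j
  · rfl
  · refine (hasSum_exp_entry _ _ _).unique ?_
    simp [hQ]
  · refine (hasSum_exp_entry _ _ _).unique ?_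
    simpa [hQ] using hasSum_exp_entry R i j

theorem exp_smul_mul_exp_smul_neg (A : Matrix m m ℂ) (t : ℂ) :
    NormedSpace.exp (t • A) * NormedSpace.exp (t • -A) = 1 := by
  rw [← Matrix.exp_add_of_commute _ _ ((Commute.refl A).neg_right.smul_left t |>.smul_right t),
    smul_neg, add_neg_cancel, NormedSpace.exp_zero]

theorem hasDerivAt_exp_entry (A : Matrix m m ℂ) (t : ℂ) (i j : m) :
    HasDerivAt (fun s : ℂ => NormedSpace.exp (s • A) i j)
      ((NormedSpace.exp (t • A) * A) i j) t := by
  open scoped Matrix.Norms.Operator in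
  exact (LinearMap.toContinuousLinearMap
    (Matrix.entryLinearMap ℂ ℂ i j)).hasFDerivAt.comp_hasDerivAt t (hasDerivAt_exp_smul_const A t)

theorem exp_smul_mul_comm (A : Matrix m m ℂ) (t : ℂ) :
    NormedSpace.exp (t • A) * A = A * NormedSpace.exp (t • A) := by
  open scoped Matrix.Norms.Operator in
  exact (((Commute.refl A).smul_left t).exp_left).eq

/-- The series stops after its linear term, so no convergence question arises for the logarithm. -/
theorem matLog_of_sq_eq_zero {A : Matrix (Fin 2 ⊕ Fin 2) (Fin 2 ⊕ Fin 2) ℂ}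
    (h : (A - 1) ^ 2 = 0) : matLog A = A - 1 := by
  rw [matLog, tsum_eq_single 0]
  · simp
  · intro k hk
    obtain ⟨k, rfl⟩ := Nat.exists_eq_succ_of_ne_zero hk
    rw [show k.succ + 1 = 2 + k by omega, pow_add, h, zero_mul, smul_zero]

theorem csp_smul (S Ω : M2) (t : ℂ) : csp (t • S) (t • Ω) = t • csp S Ω := by
  simp [csp, Matrix.fromBlocks_smul, Matrix.transpose_smul]

theorem exp_csp (S Ω : M2) : ∃ Q, NormedSpace.exp (csp S Ω) =
    Matrix.fromBlocks (NormedSpace.exp Ω) Q 0 (NormedSpace.exp (-Ω))ᵀ := by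
  obtain ⟨Q, h⟩ := exp_fromBlocks_zero Ω S (-Ωᵀ)
  refine ⟨Q, ?_⟩
  rw [csp, h, ← Matrix.transpose_neg, Matrix.exp_transpose]

/-- The diagonal blocks of the two exponentials are inverse to each other, so the product is
unipotent with an increment of square zero, and its logarithm is that increment. Thus `bigS` is a
corner of a product of exponentials and can be differentiated. -/
theorem csp_product_eq (S Ω : M2) (ζ : ℂ) :
    NormedSpace.exp (csp (ζ • S) (ζ • Ω)) * NormedSpace.exp (csp 0 (-(ζ • Ω)))
      = Matrix.fromBlocks 1 (bigS S Ω ζ) 0 1 := by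
  obtain ⟨Q₁, h₁⟩ := exp_csp (ζ • S) (ζ • Ω)
  obtain ⟨Q₂, h₂⟩ := exp_csp 0 (-(ζ • Ω))
  have u1 : NormedSpace.exp (ζ • Ω) * NormedSpace.exp (-(ζ • Ω)) = 1 := by
    rw [← smul_neg]; exact exp_smul_mul_exp_smul_neg Ω ζ
  have prod : NormedSpace.exp (csp (ζ • S) (ζ • Ω)) * NormedSpace.exp (csp 0 (-(ζ • Ω))) =
      Matrix.fromBlocks 1 (NormedSpace.exp (ζ • Ω) * Q₂ + Q₁ * (NormedSpace.exp (ζ • Ω))ᵀ) 0 1 := by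
    rw [h₁, h₂, Matrix.fromBlocks_multiply, neg_neg, ← Matrix.transpose_mul, u1]
    simp
  have sub : ∀ Q : M2, Matrix.fromBlocks 1 Q 0 1 - (1 : Matrix (Fin 2 ⊕ Fin 2) (Fin 2 ⊕ Fin 2) ℂ)
      = Matrix.fromBlocks 0 Q 0 0 := by
    intro Q
    rw [sub_eq_iff_eq_add, ← Matrix.fromBlocks_one, Matrix.fromBlocks_add]
    simp
  have hb : bigS S Ω ζ = NormedSpace.exp (ζ • Ω) * Q₂ + Q₁ * (NormedSpace.exp (ζ • Ω))ᵀ := by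
    rw [bigS, prod, matLog_of_sq_eq_zero, sub, Matrix.toBlocks_fromBlocks₁₂]
    rw [sub, sq, Matrix.fromBlocks_multiply]
    simp
  rw [hb, prod]

/-- For generators X and Y of the two factors, the product has derivative exp(ζX)(X + Y)exp(ζY). In
X + Y the contributions of Ω cancel and only the corner S is left. -/
theorem hasDerivAt_bigS (S Ω : M2) (ζ : ℂ) (i j : Fin 2) :
    HasDerivAt (fun s => bigS S Ω s i j)
      ((NormedSpace.exp (ζ • Ω) * S * (NormedSpace.exp (ζ • Ω))ᵀ) i j) ζ := by
  have eY : ∀ s : ℂ, csp 0 (-(s • Ω)) = s • csp 0 (-Ω) := by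
    intro s; rw [← csp_smul, smul_zero, smul_neg]
  have hfun : (fun s => bigS S Ω s i j) = fun s => ∑ k, NormedSpace.exp (s • csp S Ω) (Sum.inl i) k *
      NormedSpace.exp (s • csp 0 (-Ω)) k (Sum.inr j) := by
    funext s
    rw [← Matrix.mul_apply, ← csp_smul, ← eY, csp_product_eq, Matrix.fromBlocks_apply₁₂]
  rw [hfun]
  refine (HasDerivAt.fun_sum fun k _ => (hasDerivAt_exp_entry (csp S Ω) ζ _ k).mul
    (hasDerivAt_exp_entry (csp 0 (-Ω)) ζ k _)).congr_deriv ?_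
  rw [Finset.sum_add_distrib, ← Matrix.mul_apply, ← Matrix.mul_apply, exp_smul_mul_comm (csp 0 (-Ω)),
    ← Matrix.add_apply, mul_assoc, ← mul_add, ← add_mul]
  have e : csp S Ω + csp 0 (-Ω) = Matrix.fromBlocks 0 S 0 0 := by
    simp [csp, Matrix.fromBlocks_add]
  obtain ⟨Q₁, h₁⟩ := exp_csp (ζ • S) (ζ • Ω)
  obtain ⟨Q₂, h₂⟩ := exp_csp 0 (-(ζ • Ω))
  rw [e, ← csp_smul, ← eY, h₁, h₂, neg_neg, Matrix.fromBlocks_multiply, Matrix.fromBlocks_multiply,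
    Matrix.fromBlocks_apply₁₂]
  simp [mul_assoc]

theorem bigS_zero (S Ω : M2) : bigS S Ω 0 = 0 := by
  have h := csp_product_eq S Ω 0
  have e : csp 0 0 = 0 := by
    simp [csp]
  rw [zero_smul, zero_smul, neg_zero, e, NormedSpace.exp_zero, mul_one,
    ← Matrix.fromBlocks_one] at h
  exact ((Matrix.fromBlocks_inj.1 h).2.1).symm

end MatrixExp

end CR4

end

/-! ### The one-parameter group of Ω and the equivariance of 𝐒(ζ). -/

noncomputable section

namespace CR4

/-- The one-parameter group generated by `Ω`. -/
def expU (Ω : M2) (ζ : ℂ) : M2 := NormedSpace.exp (ζ • Ω)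

/-- The derivative of `bigS`. -/
def bigS' (S Ω : M2) (ζ : ℂ) : M2 := expU Ω ζ * S * (expU Ω ζ)ᵀ

theorem expU_zero (Ω : M2) : expU Ω 0 = 1 := by
  rw [expU, zero_smul, NormedSpace.exp_zero]

theorem expU_mul_neg (Ω : M2) (ζ : ℂ) : expU Ω ζ * expU (-Ω) ζ = 1 :=
  exp_smul_mul_exp_smul_neg Ω ζ

theorem expU_neg_mul (Ω : M2) (ζ : ℂ) : expU (-Ω) ζ * expU Ω ζ = 1 := by
  have := expU_mul_neg (-Ω) ζ
  rwa [neg_neg] at this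

theorem expU_mul_comm (Ω : M2) (ζ : ℂ) : expU Ω ζ * Ω = Ω * expU Ω ζ := exp_smul_mul_comm Ω ζ

theorem det_expU_ne (Ω : M2) (ζ : ℂ) : (expU Ω ζ).det ≠ 0 := by
  intro h
  have := congrArg Matrix.det (expU_mul_neg Ω ζ)
  rw [Matrix.det_mul, h, zero_mul, Matrix.det_one] at this
  exact zero_ne_one this

/-- A matrix-valued function of one complex variable has the given derivative, entrywise. -/
def HasDerivM (F : ℂ → M2) (F' : M2) (ζ : ℂ) : Prop :=
  ∀ i j, HasDerivAt (fun s => F s i j) (F' i j) ζ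

theorem HasDerivM.mul {F G : ℂ → M2} {F' G' : M2} {ζ : ℂ} (hF : HasDerivM F F' ζ)
    (hG : HasDerivM G G' ζ) : HasDerivM (fun s => F s * G s) (F' * G ζ + F ζ * G') ζ := by
  intro i j
  simp only [Matrix.mul_apply, Matrix.add_apply, ← Finset.sum_add_distrib]
  exact HasDerivAt.fun_sum fun k _ => (hF i k).mul (hG k j)

theorem HasDerivM.add {F G : ℂ → M2} {F' G' : M2} {ζ : ℂ} (hF : HasDerivM F F' ζ)
    (hG : HasDerivM G G' ζ) : HasDerivM (fun s => F s + G s) (F' + G') ζ :=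
  fun i j => (hF i j).add (hG i j)

theorem HasDerivM.sub {F G : ℂ → M2} {F' G' : M2} {ζ : ℂ} (hF : HasDerivM F F' ζ)
    (hG : HasDerivM G G' ζ) : HasDerivM (fun s => F s - G s) (F' - G') ζ :=
  fun i j => (hF i j).sub (hG i j)

theorem HasDerivM.transpose {F : ℂ → M2} {F' : M2} {ζ : ℂ} (hF : HasDerivM F F' ζ) :
    HasDerivM (fun s => (F s)ᵀ) F'ᵀ ζ :=
  fun i j => hF j i

theorem hasDerivM_const (A : M2) (ζ : ℂ) : HasDerivM (fun _ => A) 0 ζ :=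
  fun _ _ => hasDerivAt_const _ _

theorem HasDerivM.smul {φ : ℂ → ℂ} {φ' : ℂ} {F : ℂ → M2} {F' : M2} {ζ : ℂ}
    (hφ : HasDerivAt φ φ' ζ) (hF : HasDerivM F F' ζ) :
    HasDerivM (fun s => φ s • F s) (φ' • F ζ + φ ζ • F') ζ :=
  fun i j => hφ.mul (hF i j)

theorem HasDerivM.congr_deriv {F : ℂ → M2} {F' G' : M2} {ζ : ℂ} (hF : HasDerivM F F' ζ)
    (h : F' = G') : HasDerivM F G' ζ := h ▸ hF

/-- Identities in ζ are proved through this: differentiate the difference of the two sides and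
compare at 0. -/
theorem eq_of_hasDerivM_zero {F : ℂ → M2} (h : ∀ ζ, HasDerivM F 0 ζ) (ζ : ℂ) : F ζ = F 0 := by
  ext i j
  exact is_const_of_deriv_eq_zero (f := fun s => F s i j) (fun s => (h s i j).differentiableAt)
    (fun s => (h s i j).deriv) ζ 0

theorem hasDerivM_expU (Ω : M2) (ζ : ℂ) : HasDerivM (expU Ω) (expU Ω ζ * Ω) ζ :=
  fun i j => hasDerivAt_exp_entry Ω ζ i j

theorem hasDerivM_bigS (S Ω : M2) (ζ : ℂ) : HasDerivM (bigS S Ω) (bigS' S Ω ζ) ζ :=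
  fun i j => hasDerivAt_bigS S Ω ζ i j

theorem hasDerivM_bigS' (S Ω : M2) (ζ : ℂ) :
    HasDerivM (bigS' S Ω) (expU Ω ζ * (Ω * S + S * Ωᵀ) * (expU Ω ζ)ᵀ) ζ := by
  refine (((hasDerivM_expU Ω ζ).mul (hasDerivM_const S ζ)).mul
    (hasDerivM_expU Ω ζ).transpose).congr_deriv ?_
  rw [Matrix.transpose_mul]
  noncomm_ring

theorem bigS'_transpose {S : M2} (hS : Sᵀ = S) (Ω : M2) (ζ : ℂ) :
    (bigS' S Ω ζ)ᵀ = bigS' S Ω ζ := by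
  rw [bigS', Matrix.transpose_mul, Matrix.transpose_mul, Matrix.transpose_transpose, hS, mul_assoc]

theorem bigS_transpose {S : M2} (hS : Sᵀ = S) (Ω : M2) (ζ : ℂ) :
    (bigS S Ω ζ)ᵀ = bigS S Ω ζ := by
  have h : ∀ ζ, HasDerivM (fun s => (bigS S Ω s)ᵀ - bigS S Ω s) 0 ζ := fun ζ =>
    ((hasDerivM_bigS S Ω ζ).transpose.sub (hasDerivM_bigS S Ω ζ)).congr_deriv
      (by rw [bigS'_transpose hS, sub_self])
  have := eq_of_hasDerivM_zero h ζ
  simp only [bigS_zero, Matrix.transpose_zero, sub_self] at this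
  exact sub_eq_zero.1 this

/-- The derivative of exp(−ζΩ) B exp(ζΩ) is the conjugate of cΩ, which is cΩ itself, so this
function is affine in ζ. -/
theorem mul_expU_of_commutator {B Ω : M2} {c : ℂ} (h : B * Ω - Ω * B = c • Ω) (ζ : ℂ) :
    B * expU Ω ζ = expU Ω ζ * (B + (c * ζ) • Ω) := by
  have key : ∀ ζ, HasDerivM (fun s => expU (-Ω) s * B * expU Ω s - (c * s) • Ω) 0 ζ := by
    intro ζ
    have d1 := ((hasDerivM_expU (-Ω) ζ).mul (hasDerivM_const B ζ)).mul (hasDerivM_expU Ω ζ)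
    have d2 := HasDerivM.smul ((hasDerivAt_id ζ).const_mul c) (hasDerivM_const Ω ζ)
    refine (d1.sub d2).congr_deriv ?_
    have e : (expU (-Ω) ζ * -Ω * B + expU (-Ω) ζ * 0) * expU Ω ζ
        + expU (-Ω) ζ * B * (expU Ω ζ * Ω) = expU (-Ω) ζ * (B * Ω - Ω * B) * expU Ω ζ := by
      rw [expU_mul_comm Ω ζ]
      generalize expU (-Ω) ζ = V
      generalize expU Ω ζ = U
      noncomm_ring
    rw [e, h, Matrix.mul_smul, Matrix.smul_mul, mul_assoc, ← expU_mul_comm, ← mul_assoc,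
      expU_neg_mul, one_mul]
    simp
  have e := eq_of_hasDerivM_zero key ζ
  simp only [expU_zero, mul_zero, zero_smul, sub_zero, one_mul, mul_one] at e
  rw [sub_eq_iff_eq_add] at e
  rw [← e, mul_assoc, ← mul_assoc, expU_mul_neg, one_mul]

/-- The equivariance of `bigS` under the symmetries of the data. -/
theorem bigS_equivariant {B S Ω : M2} {a c : ℂ} (h1 : B * S + S * Bᵀ = (a + c) • S)
    (h2 : B * Ω - Ω * B = c • Ω) (ζ : ℂ) :
    (c * ζ) • bigS' S Ω ζ = B * bigS S Ω ζ + bigS S Ω ζ * Bᵀ - a • bigS S Ω ζ := by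
  -- Both sides vanish at 0. For the derivatives, B is moved through exp(ζΩ) on the left and Bᵀ
  -- through its transpose on the right; the linear terms so produced match the second derivative of
  -- 𝐒.
  have key : ∀ ζ, HasDerivM (fun s => (c * s) • bigS' S Ω s
      - (B * bigS S Ω s + bigS S Ω s * Bᵀ - a • bigS S Ω s)) 0 ζ := by
    intro ζ
    have d0 := hasDerivM_bigS S Ω ζ
    have d1 := HasDerivM.smul ((hasDerivAt_id ζ).const_mul c) (hasDerivM_bigS' S Ω ζ)
    have d2 := (hasDerivM_const B ζ).mul d0
    have d3 := d0.mul (hasDerivM_const Bᵀ ζ)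
    have d4 := HasDerivM.smul (hasDerivAt_const ζ a) d0
    refine (d1.sub ((d2.add d3).sub d4)).congr_deriv ?_
    have hB := mul_expU_of_commutator h2 ζ
    have hBt := congrArg Matrix.transpose hB
    simp only [Matrix.transpose_mul, Matrix.transpose_add, Matrix.transpose_smul] at hBt
    have e : B * bigS' S Ω ζ + bigS' S Ω ζ * Bᵀ = (a + c) • bigS' S Ω ζ
        + (c * ζ) • (expU Ω ζ * (Ω * S + S * Ωᵀ) * (expU Ω ζ)ᵀ) := by
      have e1 : B * bigS' S Ω ζ = expU Ω ζ * (B * S + (c * ζ) • (Ω * S)) * (expU Ω ζ)ᵀ := by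
        rw [bigS', ← mul_assoc, ← mul_assoc, hB, mul_assoc (expU Ω ζ), add_mul, Matrix.smul_mul]
      have e2 : bigS' S Ω ζ * Bᵀ = expU Ω ζ * (S * Bᵀ + (c * ζ) • (S * Ωᵀ)) * (expU Ω ζ)ᵀ := by
        rw [bigS', mul_assoc, hBt, mul_assoc, mul_assoc, ← mul_assoc S, mul_add, Matrix.mul_smul]
      rw [e1, e2, ← add_mul, ← mul_add, add_add_add_comm, h1, ← smul_add, mul_add, add_mul,
        Matrix.mul_smul, Matrix.smul_mul, Matrix.mul_smul, Matrix.smul_mul]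
      rfl
    simp only [zero_mul, mul_zero, zero_add, add_zero, zero_smul, mul_one, id]
    rw [e]
    module
  have e := eq_of_hasDerivM_zero key ζ
  simp only [bigS_zero, mul_zero, zero_smul, zero_mul, smul_zero, sub_zero, add_zero] at e
  exact sub_eq_zero.1 e

/-! ### Some matrix algebra -/

/-- No invertibility is needed: the two determinants agree, and a singular matrix has inverse zero
by convention. -/
theorem mul_inv_one_sub (X Y : M2) : X * (1 - Y * X)⁻¹ = (1 - X * Y)⁻¹ * X := by
  by_cases h : IsUnit (1 - X * Y).det
  · have h' : IsUnit (1 - Y * X).det := by rwa [Matrix.det_one_sub_mul_comm]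
    have e : (1 - X * Y) * X = X * (1 - Y * X) := by noncomm_ring
    calc X * (1 - Y * X)⁻¹ = (1 - X * Y)⁻¹ * ((1 - X * Y) * X) * (1 - Y * X)⁻¹ := by
          rw [← mul_assoc, Matrix.nonsing_inv_mul _ h, one_mul]
      _ = (1 - X * Y)⁻¹ * X := by
          rw [e, mul_assoc, mul_assoc, Matrix.mul_nonsing_inv _ h', mul_one]
  · have h' : ¬ IsUnit (1 - Y * X).det := by rwa [Matrix.det_one_sub_mul_comm]
    rw [Matrix.nonsing_inv_apply_not_isUnit _ h, Matrix.nonsing_inv_apply_not_isUnit _ h',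
      mul_zero, zero_mul]

theorem conjM_sub (A B : M2) : conjM (A - B) = conjM A - conjM B := by
  ext i j; simp [conjM]

theorem conjM_one : conjM (1 : M2) = 1 := by
  ext i j; fin_cases i <;> fin_cases j <;> simp [conjM]

theorem conjM_zero : conjM (0 : M2) = 0 := by
  ext i j; simp [conjM]

theorem conjM_det (A : M2) : (conjM A).det = (starRingEnd ℂ) A.det := by
  simp [Matrix.det_fin_two, conjM]

theorem conjM_inv (A : M2) : conjM A⁻¹ = (conjM A)⁻¹ := by
  rw [Matrix.inv_def, Matrix.inv_def, conjM_det, Ring.inverse_eq_inv',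
    ← map_inv₀, Matrix.adjugate_fin_two, Matrix.adjugate_fin_two]
  ext i j
  fin_cases i <;> fin_cases j <;> simp [conjM]

theorem star_mulVec_eq (A : M2) (v : Fin 2 → ℂ) : star (A *ᵥ v) = conjM A *ᵥ star v := by
  ext i
  simp only [Pi.star_apply, Matrix.mulVec, dotProduct, Fin.sum_univ_two, conjM, Matrix.map_apply,
    star_add, star_mul', starRingEnd_apply]

theorem star_dotProduct_eq (v w : Fin 2 → ℂ) : star (v ⬝ᵥ w) = star v ⬝ᵥ star w := by
  simp [dotProduct]

theorem dotProduct_mulVec_symm {A : M2} (hA : Aᵀ = A) (v w : Fin 2 → ℂ) :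
    v ⬝ᵥ (A *ᵥ w) = (A *ᵥ v) ⬝ᵥ w := by
  rw [Matrix.dotProduct_mulVec, ← Matrix.mulVec_transpose, hA]

/-- The solution of a pair of conjugate linear equations. -/
theorem eq_of_conj_equation {A : M2} (h : (1 - A * conjM A).det ≠ 0) {q q' v v' : Fin 2 → ℂ}
    (hv : v = q + A *ᵥ star v') (hv' : v' = q' + A *ᵥ star v) :
    v = (1 - A * conjM A)⁻¹ *ᵥ (q + A *ᵥ star q') := by
  have e : (1 - A * conjM A) *ᵥ v = q + A *ᵥ star q' := by
    have e1 : A *ᵥ star v' = A *ᵥ star q' + (A * conjM A) *ᵥ v := by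
      rw [hv', star_add, star_mulVec_eq, star_star, Matrix.mulVec_add, Matrix.mulVec_mulVec]
    rw [Matrix.sub_mulVec, Matrix.one_mulVec, sub_eq_iff_eq_add, add_assoc, ← e1]
    exact hv
  rw [← e, Matrix.mulVec_mulVec, Matrix.nonsing_inv_mul _ (isUnit_iff_ne_zero.2 h),
    Matrix.one_mulVec]

/-- Existence, where `eq_of_conj_equation` gives uniqueness. The push-through identity
`mul_inv_one_sub` brings the conjugated inverse back to the original one. -/
theorem conj_equation {A : M2} (h : (1 - A * conjM A).det ≠ 0) (q : Fin 2 → ℂ) :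
    (1 - A * conjM A)⁻¹ *ᵥ (q + A *ᵥ star q) =
      q + A *ᵥ star ((1 - A * conjM A)⁻¹ *ᵥ (q + A *ᵥ star q)) := by
  have hu : IsUnit (1 - A * conjM A).det := isUnit_iff_ne_zero.2 h
  rw [star_mulVec_eq, conjM_inv, conjM_sub, conjM_one, conjM_mul, conjM_conjM, star_add,
    star_mulVec_eq, star_star, Matrix.mulVec_mulVec, mul_inv_one_sub]
  have e : (1 - A * conjM A)⁻¹ *ᵥ (q - (A * conjM A) *ᵥ q) = q := by
    have : q - (A * conjM A) *ᵥ q = (1 - A * conjM A) *ᵥ q := by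
      rw [Matrix.sub_mulVec, Matrix.one_mulVec]
    rw [this, Matrix.mulVec_mulVec, Matrix.nonsing_inv_mul _ hu, Matrix.one_mulVec]
  calc _ = (1 - A * conjM A)⁻¹ *ᵥ ((q - (A * conjM A) *ᵥ q) + A *ᵥ (star q + conjM A *ᵥ q)) := by
        rw [Matrix.mulVec_add A, Matrix.mulVec_mulVec]
        congr 1
        abel
    _ = _ := by rw [Matrix.mulVec_add, e, Matrix.mulVec_mulVec]

end CR4

end

noncomputable section

namespace CR4

/-! ### Directional derivatives of vectors and matrices -/

/-- The entrywise derivative of a vector-valued function. -/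
def alongV (Z : C4 × C4) (F : C4 → Fin 2 → ℂ) (x : C4) : Fin 2 → ℂ :=
  fun i => along Z (fun y => F y i) x

theorem alongV_add {F G : C4 → Fin 2 → ℂ} {x : C4}
    (hF : ∀ i, DifferentiableAt ℝ (fun y => F y i) x)
    (hG : ∀ i, DifferentiableAt ℝ (fun y => G y i) x) (Z : C4 × C4) :
    alongV Z (fun y => F y + G y) x = alongV Z F x + alongV Z G x :=
  funext fun i => along_add (hF i) (hG i) Z

theorem alongV_const (Z : C4 × C4) (v : Fin 2 → ℂ) (x : C4) : alongV Z (fun _ => v) x = 0 :=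
  funext fun i => along_const Z (v i) x

theorem alongV_congr {F G : C4 → Fin 2 → ℂ} {x : C4} (h : F =ᶠ[𝓝 x] G) (Z : C4 × C4) :
    alongV Z F x = alongV Z G x :=
  funext fun i => along_congr (h.mono fun y hy => by rw [hy]) Z

theorem along_dotProduct {F G : C4 → Fin 2 → ℂ} {x : C4}
    (hF : ∀ i, DifferentiableAt ℝ (fun y => F y i) x)
    (hG : ∀ i, DifferentiableAt ℝ (fun y => G y i) x) (Z : C4 × C4) :
    along Z (fun y => F y ⬝ᵥ G y) x = alongV Z F x ⬝ᵥ G x + F x ⬝ᵥ alongV Z G x := by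
  simp only [dotProduct, alongV]
  rw [along_sum _ fun k _ => (hF k).fun_mul (hG k), ← Finset.sum_add_distrib]
  exact Finset.sum_congr rfl fun k _ => along_mul (hF k) (hG k) Z

theorem alongV_mulVec {M : C4 → M2} {G : C4 → Fin 2 → ℂ} {x : C4}
    (hM : ∀ i j, DifferentiableAt ℝ (fun y => M y i j) x)
    (hG : ∀ i, DifferentiableAt ℝ (fun y => G y i) x) (Z : C4 × C4) :
    alongV Z (fun y => M y *ᵥ G y) x = alongM Z M x *ᵥ G x + M x *ᵥ alongV Z G x :=
  funext fun i => along_dotProduct (F := fun y => M y i) (hM i) hG Z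

theorem alongM_const (Z : C4 × C4) (A : M2) (x : C4) : alongM Z (fun _ => A) x = 0 := by
  ext i j
  exact along_const Z (A i j) x

/-- Conjugating a function exchanges the roles of the (1,0) and (0,1) entries of the direction. -/
theorem along_conj {F : C4 → ℂ} {x : C4} (hF : DifferentiableAt ℝ F x) (Z : C4 × C4) :
    along Z (fun y => star (F y)) x = star (along Z.swap F x) := by
  have h : HasFDerivAt (fun y => star (F y))
      ((Complex.conjCLE : ℂ →L[ℝ] ℂ).comp (fderiv ℝ F x)) x :=
    (Complex.conjCLE.hasFDerivAt).comp x hF.hasFDerivAt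
  simp only [along, h.fderiv]
  simp
  ring

theorem alongV_star {F : C4 → Fin 2 → ℂ} {x : C4}
    (hF : ∀ i, DifferentiableAt ℝ (fun y => F y i) x) (Z : C4 × C4) :
    alongV Z (fun y => star (F y)) x = star (alongV Z.swap F x) :=
  funext fun i => along_conj (hF i) Z

theorem alongM_conjM {F : C4 → M2} {x : C4}
    (hF : ∀ i j, DifferentiableAt ℝ (fun y => F y i j) x) (Z : C4 × C4) :
    alongM Z (fun y => conjM (F y)) x = conjM (alongM Z.swap F x) := by
  ext i j
  exact along_conj (hF i j) Z

theorem alongM_transpose (F : C4 → M2) (x : C4) (Z : C4 × C4) :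
    alongM Z (fun y => (F y)ᵀ) x = (alongM Z F x)ᵀ := rfl

theorem along_prodMk {V W : Type*} [NormedAddCommGroup V] [NormedSpace ℂ V]
    [NormedAddCommGroup W] [NormedSpace ℂ W] {F : C4 → V} {G : C4 → W} {x : C4}
    (hF : DifferentiableAt ℝ F x) (hG : DifferentiableAt ℝ G x) (Z : C4 × C4) :
    along Z (fun y => (F y, G y)) x = (along Z F x, along Z G x) := by
  simp only [along, (hF.hasFDerivAt.prodMk hG.hasFDerivAt).fderiv]
  rfl

theorem along_pi {F : C4 → Fin 2 → ℂ} {x : C4}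
    (hF : ∀ i, DifferentiableAt ℝ (fun y => F y i) x) (Z : C4 × C4) :
    along Z F x = alongV Z F x := by
  have h : HasFDerivAt F (ContinuousLinearMap.pi fun i => fderiv ℝ (fun y => F y i) x) x :=
    hasFDerivAt_pi.2 fun i => (hF i).hasFDerivAt
  ext i
  simp [along, alongV, h.fderiv]
  ring

theorem along_comp_zeta {h : ℂ → ℂ} {h' : ℂ} {x : C4} (hh : HasDerivAt h h' x.2.2)
    (Z : C4 × C4) : along Z (fun y => h y.2.2) x = Z.1.2.2 * h' := by
  have h1 : HasFDerivAt (fun y : C4 => h y.2.2) _ x :=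
    hh.hasFDerivAt.comp x (((ContinuousLinearMap.snd ℂ (Fin 2 → ℂ) ℂ).comp
      (ContinuousLinearMap.snd ℂ ℂ ((Fin 2 → ℂ) × ℂ))).hasFDerivAt (x := x))
  rw [along_of_hasFDerivAt (h1.restrictScalars ℝ) (fun v => v.2.2 * h') (fun _ => 0)]
  · simp
  · intro v; simp
  · intro v; simp [mul_assoc]
  · intro v; simp

theorem alongM_comp_zeta {M : ℂ → M2} {M' : M2} {x : C4} (hM : HasDerivM M M' x.2.2)
    (Z : C4 × C4) : alongM Z (fun y => M y.2.2) x = Z.1.2.2 • M' := by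
  ext i j
  exact along_comp_zeta (hM i j) Z

theorem along_coord (l : C4 →L[ℂ] ℂ) (x : C4) (Z : C4 × C4) :
    along Z (fun y => l y) x = l Z.1 := by
  rw [along_of_hasFDerivAt ((l.hasFDerivAt (x := x)).restrictScalars ℝ) (fun v => l v) (fun _ => 0)]
  · simp
  · intro v; simp
  · intro v; simp
  · intro v; simp

theorem along_w (x : C4) (Z : C4 × C4) : along Z (fun y => y.1) x = Z.1.1 :=
  along_coord (ContinuousLinearMap.fst ℂ ℂ ((Fin 2 → ℂ) × ℂ)) x Z

theorem alongV_z (x : C4) (Z : C4 × C4) : alongV Z (fun y => y.2.1) x = Z.1.2.1 :=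
  funext fun i => along_coord ((ContinuousLinearMap.proj (R := ℂ) (φ := fun _ : Fin 2 => ℂ) i).comp
    ((ContinuousLinearMap.fst ℂ (Fin 2 → ℂ) ℂ).comp
      (ContinuousLinearMap.snd ℂ ℂ ((Fin 2 → ℂ) × ℂ)))) x Z

theorem contDiffAt_comp_zeta {M : ℂ → M2} {M' : ℂ → M2} (hM : ∀ ζ, HasDerivM M (M' ζ) ζ)
    (i j : Fin 2) (x : C4) (n : WithTop ℕ∞) : ContDiffAt ℝ n (fun y : C4 => M y.2.2 i j) x := by
  have h1 : Differentiable ℂ fun ζ => M ζ i j := fun ζ => (hM ζ i j).differentiableAt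
  have h2 : ContDiff ℝ n fun ζ => M ζ i j := (h1.contDiff (n := n)).restrict_scalars ℝ
  exact (h2.comp (contDiff_snd.comp contDiff_snd)).contDiffAt

theorem contDiffAt_dotProduct {F G : C4 → Fin 2 → ℂ} {x : C4} {n : WithTop ℕ∞}
    (hF : ∀ i, ContDiffAt ℝ n (fun y => F y i) x) (hG : ∀ i, ContDiffAt ℝ n (fun y => G y i) x) :
    ContDiffAt ℝ n (fun y => F y ⬝ᵥ G y) x := by
  simp only [dotProduct]
  exact ContDiffAt.sum fun k _ => (hF k).mul (hG k)

theorem contDiffAt_mulVec {M : C4 → M2} {G : C4 → Fin 2 → ℂ} {x : C4} {n : WithTop ℕ∞}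
    (hM : ∀ i j, ContDiffAt ℝ n (fun y => M y i j) x)
    (hG : ∀ i, ContDiffAt ℝ n (fun y => G y i) x) (i : Fin 2) :
    ContDiffAt ℝ n (fun y => (M y *ᵥ G y) i) x :=
  contDiffAt_dotProduct (F := fun y => M y i) (hM i) hG

/-! ### The implicit form of the defining function -/

/-- The symmetry and reality properties of the data of a model. -/
structure IsModelData (H S : M2) : Prop where
  transpose_H : Hᵀ = H
  conj_H : conjM H = H
  det_H : H.det ≠ 0
  transpose_S : Sᵀ = S

/-- The matrix `A = 𝐒(ζ) H`. -/
def matA (H S Ω : M2) (ζ : ℂ) : M2 := bigS S Ω ζ * H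

/-- The matrix `(1 - A conj(A))⁻¹`. -/
def matP (H S Ω : M2) (ζ : ℂ) : M2 := (1 - matA H S Ω ζ * conjM (matA H S Ω ζ))⁻¹

/-- The points where the coefficients of the model are defined. -/
def IsRegular (H S Ω : M2) (x : C4) : Prop :=
  (1 - matA H S Ω x.2.2 * conjM (matA H S Ω x.2.2)).det ≠ 0

/-- The solution `u` of `u = z + 𝐒(ζ) H conj(u)`. -/
def solU (H S Ω : M2) (x : C4) : Fin 2 → ℂ :=
  matP H S Ω x.2.2 *ᵥ (x.2.1 + matA H S Ω x.2.2 *ᵥ star x.2.1)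

/-- The vector `y = H conj(u)`. -/
def solY (H S Ω : M2) (x : C4) : Fin 2 → ℂ := H *ᵥ star (solU H S Ω x)

/-- The coefficient of `conj(v)` in the derivative of `y`. -/
def matK (H S Ω : M2) (ζ : ℂ) : M2 := H * conjM (matP H S Ω ζ)

/-- The coefficient of `v` in the derivative of `y`. -/
def matL (H S Ω : M2) (ζ : ℂ) : M2 := matK H S Ω ζ * conjM (matA H S Ω ζ)

section

variable {H S Ω : M2}

theorem matA_zero : matA H S Ω 0 = 0 := by rw [matA, bigS_zero, zero_mul]

theorem matP_zero : matP H S Ω 0 = 1 := by simp [matP, matA_zero]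

theorem isRegular_of_zeta_eq_zero {x : C4} (hx : x.2.2 = 0) : IsRegular H S Ω x := by
  simp [IsRegular, hx, matA_zero]

theorem hasDerivM_matA (ζ : ℂ) : HasDerivM (matA H S Ω) (bigS' S Ω ζ * H) ζ :=
  ((hasDerivM_bigS S Ω ζ).mul (hasDerivM_const H ζ)).congr_deriv (by simp)

theorem contDiffAt_matA (i j : Fin 2) (x : C4) (n : WithTop ℕ∞) :
    ContDiffAt ℝ n (fun y : C4 => matA H S Ω y.2.2 i j) x :=
  contDiffAt_comp_zeta hasDerivM_matA i j x n

theorem contDiffAt_denominator (i j : Fin 2) (x : C4) (n : WithTop ℕ∞) :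
    ContDiffAt ℝ n (fun y : C4 =>
      (1 - matA H S Ω y.2.2 * conjM (matA H S Ω y.2.2)) i j) x := by
  simp only [Matrix.sub_apply]
  exact contDiffAt_const.sub (contDiffAt_mul_entries (fun i j => contDiffAt_matA i j x n)
    (fun i j => contDiffAt_conj (contDiffAt_matA i j x n)) i j)

theorem contDiffAt_matP {x : C4} (hx : IsRegular H S Ω x) (i j : Fin 2) (n : WithTop ℕ∞) :
    ContDiffAt ℝ n (fun y : C4 => matP H S Ω y.2.2 i j) x :=
  contDiffAt_inv_entries (fun i j => contDiffAt_denominator i j x n) hx i j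

theorem IsRegular.eventually {x : C4} (hx : IsRegular H S Ω x) :
    ∀ᶠ y in 𝓝 x, IsRegular H S Ω y :=
  (contDiffAt_det_entries fun i j => contDiffAt_denominator i j x 0).continuousAt.eventually_ne hx

theorem contDiffAt_z (i : Fin 2) (x : C4) (n : WithTop ℕ∞) :
    ContDiffAt ℝ n (fun y : C4 => y.2.1 i) x :=
  (contDiff_pi.1 (contDiff_fst.comp contDiff_snd) i).contDiffAt

theorem contDiffAt_solU {x : C4} (hx : IsRegular H S Ω x) (i : Fin 2) (n : WithTop ℕ∞) :
    ContDiffAt ℝ n (fun y : C4 => solU H S Ω y i) x :=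
  contDiffAt_mulVec (fun i j => contDiffAt_matP hx i j n) (fun i => (contDiffAt_z i x n).add
    (contDiffAt_mulVec (fun i j => contDiffAt_matA i j x n)
      (fun i => contDiffAt_conj (contDiffAt_z i x n)) i)) i

theorem contDiffAt_solY {x : C4} (hx : IsRegular H S Ω x) (i : Fin 2) (n : WithTop ℕ∞) :
    ContDiffAt ℝ n (fun y : C4 => solY H S Ω y i) x :=
  contDiffAt_mulVec (M := fun _ => H) (fun _ _ => contDiffAt_const)
    (fun i => contDiffAt_conj (contDiffAt_solU hx i n)) i

theorem solU_eq {x : C4} (hx : IsRegular H S Ω x) :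
    solU H S Ω x = x.2.1 + matA H S Ω x.2.2 *ᵥ star (solU H S Ω x) :=
  conj_equation hx x.2.1

theorem matA_mulVec_star_solU (x : C4) :
    matA H S Ω x.2.2 *ᵥ star (solU H S Ω x) = bigS S Ω x.2.2 *ᵥ solY H S Ω x := by
  rw [matA, solY, Matrix.mulVec_mulVec]

theorem solY_zero : solY H S Ω 0 = 0 := by simp [solY, solU]

theorem conjM_matP (ζ : ℂ) :
    conjM (matP H S Ω ζ) = (1 - conjM (matA H S Ω ζ) * matA H S Ω ζ)⁻¹ := by
  rw [matP, conjM_inv, conjM_sub, conjM_one, conjM_mul, conjM_conjM]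

theorem star_solU (x : C4) : star (solU H S Ω x) =
    conjM (matP H S Ω x.2.2) *ᵥ (star x.2.1 + conjM (matA H S Ω x.2.2) *ᵥ x.2.1) := by
  rw [solU, star_mulVec_eq, star_add, star_mulVec_eq, star_star]

/-- For real symmetric H the two summands averaged in `coeffH` coincide, by `mul_inv_one_sub`. -/
theorem IsModelData.coeffH_eq (h : IsModelData H S) (ζ : ℂ) :
    coeffH H (bigS S Ω ζ) = matK H S Ω ζ := by
  have e : conjM (matA H S Ω ζ) = conjM (bigS S Ω ζ) * H := by rw [matA, conjM_mul, h.conj_H]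
  have e1 : conjM (bigS S Ω ζ) * H * bigS S Ω ζ * H = conjM (matA H S Ω ζ) * matA H S Ω ζ := by
    rw [e, matA]; noncomm_ring
  have e2 : (1 - H * conjM (bigS S Ω ζ) * H * bigS S Ω ζ)⁻¹ * H
      = H * (1 - conjM (matA H S Ω ζ) * matA H S Ω ζ)⁻¹ := by
    rw [← e1, mul_inv_one_sub]
    simp only [mul_assoc]
  rw [coeffH, h.transpose_H, e1, e2, matK, conjM_matP]
  module

theorem IsModelData.coeffS_eq (h : IsModelData H S) (ζ : ℂ) :
    coeffS H (bigS S Ω ζ) = H * matP H S Ω ζ * matA H S Ω ζ := by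
  have e : conjM (matA H S Ω ζ) = conjM (bigS S Ω ζ) * H := by rw [matA, conjM_mul, h.conj_H]
  rw [coeffS, h.transpose_H, matP, e, matA]
  simp only [mul_assoc]

/-- Under the real part, the quadratic form in conj(z) may be replaced by its conjugate, a form in
z. Together with the mixed term this is z·H conj(u), by the explicit formula for u. -/
theorem IsModelData.model_eq (h : IsModelData H S) (x : C4) :
    model H S Ω x = (x.2.1 ⬝ᵥ solY H S Ω x - x.1).re := by
  have e : (star x.2.1 ⬝ᵥ (coeffS H (bigS S Ω x.2.2) *ᵥ star x.2.1)).re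
      = (x.2.1 ⬝ᵥ (matL H S Ω x.2.2 *ᵥ x.2.1)).re := by
    have : star (star x.2.1 ⬝ᵥ (coeffS H (bigS S Ω x.2.2) *ᵥ star x.2.1))
        = x.2.1 ⬝ᵥ (matL H S Ω x.2.2 *ᵥ x.2.1) := by
      rw [h.coeffS_eq, star_dotProduct_eq, star_mulVec_eq, star_star, conjM_mul, conjM_mul,
        h.conj_H]
      rfl
    rw [← this]
    exact (Complex.conj_re _).symm
  rw [model, e, h.coeffH_eq, solY, star_solU, Complex.sub_re, Matrix.mulVec_add,
    Matrix.mulVec_add, dotProduct_add, Matrix.mulVec_mulVec, Matrix.mulVec_mulVec,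
    Matrix.mulVec_mulVec, Complex.add_re]
  simp only [matL, matK, mul_assoc]

theorem IsModelData.analyticAt_model (h : IsModelData H S) {x : C4} (hx : IsRegular H S Ω x) :
    AnalyticAt ℝ (model H S Ω) x := by
  rw [show model H S Ω = fun x => (x.2.1 ⬝ᵥ solY H S Ω x - x.1).re from funext h.model_eq,
    ← analyticWithinAt_univ, ← contDiffWithinAt_omega_iff_analyticWithinAt, contDiffWithinAt_univ]
  exact Complex.reCLM.contDiff.contDiffAt.comp x ((contDiffAt_dotProduct
    (fun i => contDiffAt_z i x ω) (fun i => contDiffAt_solY hx i ω)).sub contDiffAt_fst)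

/-- The coefficient vector of the derivative of `y`. -/
def solQ (H S Ω : M2) (x v : C4) : Fin 2 → ℂ :=
  v.2.1 + v.2.2 • (bigS' S Ω x.2.2 *ᵥ solY H S Ω x)

/-- Differentiating the implicit equation avoids differentiating the inverse matrix. Conjugation
swaps the direction, so the equations for Z and its swap form a coupled pair, solved by
`eq_of_conj_equation`. -/
theorem alongV_solU_eq {x : C4} (hx : IsRegular H S Ω x) (Z : C4 × C4) :
    alongV Z (solU H S Ω) x = solQ H S Ω x Z.1
      + matA H S Ω x.2.2 *ᵥ star (alongV Z.swap (solU H S Ω) x) := by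
  have dU : ∀ i, DifferentiableAt ℝ (fun y : C4 => solU H S Ω y i) x := fun i =>
    (contDiffAt_solU hx i 1).differentiableAt (by simp)
  have dU' : ∀ i, DifferentiableAt ℝ (fun y : C4 => star (solU H S Ω y) i) x := fun i =>
    (contDiffAt_conj (contDiffAt_solU hx i 1)).differentiableAt (by simp)
  have dA : ∀ i j, DifferentiableAt ℝ (fun y : C4 => matA H S Ω y.2.2 i j) x := fun i j =>
    (contDiffAt_matA i j x 1).differentiableAt (by simp)
  have dAU : ∀ i, DifferentiableAt ℝ
      (fun y : C4 => (matA H S Ω y.2.2 *ᵥ star (solU H S Ω y)) i) x := fun i =>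
    (contDiffAt_mulVec (fun i j => contDiffAt_matA i j x 1)
      (fun i => contDiffAt_conj (contDiffAt_solU hx i 1)) i).differentiableAt (by simp)
  have dz : ∀ i, DifferentiableAt ℝ (fun y : C4 => y.2.1 i) x := fun i =>
    (contDiffAt_z i x 1).differentiableAt (by simp)
  rw [alongV_congr (G := fun y : C4 => y.2.1 + matA H S Ω y.2.2 *ᵥ star (solU H S Ω y))
      (hx.eventually.mono fun y hy => solU_eq hy) Z,
    alongV_add dz dAU, alongV_z, alongV_mulVec dA dU', alongV_star dU,
    alongM_comp_zeta (hasDerivM_matA x.2.2), Matrix.smul_mulVec, ← add_assoc, solQ, solY,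
    Matrix.mulVec_mulVec]

theorem alongV_solU {x : C4} (hx : IsRegular H S Ω x) (Z : C4 × C4) :
    alongV Z (solU H S Ω) x = matP H S Ω x.2.2 *ᵥ (solQ H S Ω x Z.1
      + matA H S Ω x.2.2 *ᵥ star (solQ H S Ω x Z.2)) :=
  eq_of_conj_equation hx (alongV_solU_eq hx Z) (alongV_solU_eq hx Z.swap)

theorem alongV_solY_eq {x : C4} (hx : IsRegular H S Ω x) (Z : C4 × C4) :
    alongV Z (solY H S Ω) x = H *ᵥ star (alongV Z.swap (solU H S Ω) x) := by
  have dU : ∀ i, DifferentiableAt ℝ (fun y : C4 => solU H S Ω y i) x := fun i =>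
    (contDiffAt_solU hx i 1).differentiableAt (by simp)
  have dU' : ∀ i, DifferentiableAt ℝ (fun y : C4 => star (solU H S Ω y) i) x := fun i =>
    (contDiffAt_conj (contDiffAt_solU hx i 1)).differentiableAt (by simp)
  have := alongV_mulVec (M := fun _ => H) (G := fun y => star (solU H S Ω y)) (x := x)
    (fun i j => differentiableAt_const _) dU' Z
  rw [alongM_const, Matrix.zero_mulVec, zero_add, alongV_star dU] at this
  exact this

theorem alongV_solY {x : C4} (hx : IsRegular H S Ω x) (Z : C4 × C4) :
    alongV Z (solY H S Ω) x = matL H S Ω x.2.2 *ᵥ solQ H S Ω x Z.1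
      + matK H S Ω x.2.2 *ᵥ star (solQ H S Ω x Z.2) := by
  rw [alongV_solY_eq hx, alongV_solU hx, star_mulVec_eq, star_add, star_mulVec_eq, star_star,
    Matrix.mulVec_mulVec, Matrix.mulVec_add, Matrix.mulVec_mulVec, add_comm]
  rfl

/-- The complex linear form whose kernel is `ℋ`. -/
def solForm (H S Ω : M2) (x v : C4) : ℂ :=
  2 * (solY H S Ω x ⬝ᵥ v.2.1)
    + v.2.2 * (solY H S Ω x ⬝ᵥ (bigS' S Ω x.2.2 *ᵥ solY H S Ω x)) - v.1

/-- An envelope argument. Substituting z = u − 𝐒y and 𝐒 dy = du − Q into z·dy gives u·H conj(du) −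
y·du + y·Q. The first two terms have equal real parts because H is real symmetric, so du disappears.
-/
theorem IsModelData.fderiv_model (h : IsModelData H S) {x : C4} (hx : IsRegular H S Ω x) (v : C4) :
    fderiv ℝ (model H S Ω) x v = (solForm H S Ω x v).re := by
  have dY : ∀ i, DifferentiableAt ℝ (fun y : C4 => solY H S Ω y i) x := fun i =>
    (contDiffAt_solY hx i 1).differentiableAt (by simp)
  have dz : ∀ i, DifferentiableAt ℝ (fun y : C4 => y.2.1 i) x := fun i =>
    (contDiffAt_z i x 1).differentiableAt (by simp)
  have dzy : DifferentiableAt ℝ (fun y : C4 => y.2.1 ⬝ᵥ solY H S Ω y) x :=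
    (contDiffAt_dotProduct (fun i => contDiffAt_z i x 1)
      (fun i => contDiffAt_solY hx i 1)).differentiableAt (by simp)
  have dF : DifferentiableAt ℝ (fun y : C4 => y.2.1 ⬝ᵥ solY H S Ω y - y.1) x :=
    dzy.sub differentiableAt_fst
  have e1 : fderiv ℝ (model H S Ω) x v
      = (along (v, v) (fun y : C4 => y.2.1 ⬝ᵥ solY H S Ω y - y.1) x).re := by
    rw [along_diag, show model H S Ω = fun x => (x.2.1 ⬝ᵥ solY H S Ω x - x.1).re from
      funext h.model_eq]
    have : HasFDerivAt (fun y : C4 => (y.2.1 ⬝ᵥ solY H S Ω y - y.1).re) _ x :=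
      Complex.reCLM.hasFDerivAt.comp x dF.hasFDerivAt
    rw [this.fderiv]
    rfl
  have dU := alongV_solU_eq hx (v, v)
  have hu := solU_eq hx
  rw [matA_mulVec_star_solU] at hu
  set u := solU H S Ω x
  set y := solY H S Ω x with hy
  set T := bigS S Ω x.2.2
  set d := alongV (v, v) (solU H S Ω) x
  have hT : Tᵀ = T := bigS_transpose h.transpose_S Ω x.2.2
  have eY : alongV (v, v) (solY H S Ω) x = H *ᵥ star d := alongV_solY_eq hx (v, v)
  have ez : x.2.1 = u - T *ᵥ y := by rw [eq_sub_iff_add_eq]; exact hu.symm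
  have eT : T *ᵥ (H *ᵥ star d) = d - solQ H S Ω x v := by
    rw [eq_sub_iff_add_eq, Matrix.mulVec_mulVec, add_comm]
    exact dU.symm
  have e2 : x.2.1 ⬝ᵥ (H *ᵥ star d) = u ⬝ᵥ (H *ᵥ star d) - y ⬝ᵥ d + y ⬝ᵥ solQ H S Ω x v := by
    rw [ez, sub_dotProduct, ← dotProduct_mulVec_symm hT, eT, dotProduct_sub]
    ring
  have e3 : (u ⬝ᵥ (H *ᵥ star d)).re = (y ⬝ᵥ d).re := by
    have : star (u ⬝ᵥ (H *ᵥ star d)) = y ⬝ᵥ d := by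
      rw [star_dotProduct_eq, star_mulVec_eq, star_star, h.conj_H,
        dotProduct_mulVec_symm h.transpose_H]
      rfl
    rw [← this]
    exact (Complex.conj_re _).symm
  rw [e1, along_sub dzy differentiableAt_fst, along_w, along_dotProduct dz dY, alongV_z, eY, e2,
    solForm]
  rw [← hy, solQ, ← hy]
  simp only [Complex.add_re, Complex.sub_re, e3, dotProduct_add, dotProduct_smul, smul_eq_mul,
    dotProduct_comm v.2.1 y, Complex.mul_re, Complex.re_ofNat, Complex.im_ofNat]
  ring

theorem solForm_smul (x v : C4) (c : ℂ) : solForm H S Ω x (c • v) = c * solForm H S Ω x v := by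
  simp only [solForm, Prod.smul_fst, Prod.smul_snd, dotProduct_smul, smul_eq_mul]
  ring

theorem IsModelData.mem_holTangent_iff (h : IsModelData H S) {x : C4} (hx : IsRegular H S Ω x)
    (v : C4) : v ∈ holTangent (model H S Ω) x ↔ solForm H S Ω x v = 0 := by
  change fderiv ℝ (model H S Ω) x v = 0 ∧ fderiv ℝ (model H S Ω) x (Complex.I • v) = 0 ↔ _
  rw [h.fderiv_model hx, h.fderiv_model hx, solForm_smul]
  simp only [Complex.mul_re, Complex.I_re, Complex.I_im, zero_mul, one_mul, zero_sub, neg_eq_zero]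
  exact ⟨fun e => Complex.ext e.1 e.2, fun e => by rw [e]; exact ⟨rfl, rfl⟩⟩

end

end CR4

end

noncomputable section

namespace CR4

variable {H S Ω : M2}

/-! ### An adapted frame of the model -/

/-- Sections of `ℋ` complementary to the Levi kernel. -/
def frameF (H S Ω : M2) (b : Fin 2 → ℂ) (x : C4) : C4 :=
  (2 * (solY H S Ω x ⬝ᵥ (expU Ω x.2.2 *ᵥ b)), expU Ω x.2.2 *ᵥ b, 0)

/-- A section of the Levi kernel. -/
def frameE (H S Ω : M2) (x : C4) : C4 :=
  (-(solY H S Ω x ⬝ᵥ (bigS' S Ω x.2.2 *ᵥ solY H S Ω x)),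
    -(bigS' S Ω x.2.2 *ᵥ solY H S Ω x), 1)

theorem contDiffAt_expU (i j : Fin 2) (x : C4) (n : WithTop ℕ∞) :
    ContDiffAt ℝ n (fun y : C4 => expU Ω y.2.2 i j) x :=
  contDiffAt_comp_zeta (hasDerivM_expU Ω) i j x n

theorem contDiffAt_bigS' (i j : Fin 2) (x : C4) (n : WithTop ℕ∞) :
    ContDiffAt ℝ n (fun y : C4 => bigS' S Ω y.2.2 i j) x :=
  contDiffAt_comp_zeta (hasDerivM_bigS' S Ω) i j x n

theorem contDiffAt_expU_mulVec (b : Fin 2 → ℂ) (i : Fin 2) (x : C4) (n : WithTop ℕ∞) :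
    ContDiffAt ℝ n (fun y : C4 => (expU Ω y.2.2 *ᵥ b) i) x :=
  contDiffAt_mulVec (G := fun _ => b) (fun i j => contDiffAt_expU i j x n)
    (fun _ => contDiffAt_const) i

theorem contDiffAt_bigS'_mulVec {x : C4} (hx : IsRegular H S Ω x) (i : Fin 2) (n : WithTop ℕ∞) :
    ContDiffAt ℝ n (fun y : C4 => (bigS' S Ω y.2.2 *ᵥ solY H S Ω y) i) x :=
  contDiffAt_mulVec (fun i j => contDiffAt_bigS' i j x n) (fun i => contDiffAt_solY hx i n) i

theorem contDiffAt_frameF {x : C4} (hx : IsRegular H S Ω x) (b : Fin 2 → ℂ) (n : WithTop ℕ∞) :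
    ContDiffAt ℝ n (frameF H S Ω b) x :=
  (contDiffAt_const.mul (contDiffAt_dotProduct (fun i => contDiffAt_solY hx i n)
    (fun i => contDiffAt_expU_mulVec b i x n))).prodMk
    ((contDiffAt_pi.2 fun i => contDiffAt_expU_mulVec b i x n).prodMk contDiffAt_const)

theorem contDiffAt_frameE {x : C4} (hx : IsRegular H S Ω x) (n : WithTop ℕ∞) :
    ContDiffAt ℝ n (frameE H S Ω) x :=
  (contDiffAt_dotProduct (fun i => contDiffAt_solY hx i n)
    (fun i => contDiffAt_bigS'_mulVec hx i n)).neg.prodMk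
    ((contDiffAt_pi.2 fun i => contDiffAt_bigS'_mulVec hx i n).neg.prodMk contDiffAt_const)

theorem along_frameF {x : C4} (hx : IsRegular H S Ω x) (b : Fin 2 → ℂ) (Z : C4 × C4) :
    along Z (frameF H S Ω b) x =
      (2 * (alongV Z (solY H S Ω) x ⬝ᵥ (expU Ω x.2.2 *ᵥ b)
          + Z.1.2.2 * (solY H S Ω x ⬝ᵥ ((expU Ω x.2.2 * Ω) *ᵥ b))),
        Z.1.2.2 • ((expU Ω x.2.2 * Ω) *ᵥ b), 0) := by
  have dY : ∀ i, DifferentiableAt ℝ (fun y : C4 => solY H S Ω y i) x := fun i =>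
    (contDiffAt_solY hx i 1).differentiableAt (by simp)
  have dU : ∀ i, DifferentiableAt ℝ (fun y : C4 => (expU Ω y.2.2 *ᵥ b) i) x := fun i =>
    (contDiffAt_expU_mulVec b i x 1).differentiableAt (by simp)
  have dU' : DifferentiableAt ℝ (fun y : C4 => expU Ω y.2.2 *ᵥ b) x := differentiableAt_pi.2 dU
  have dUU : ∀ i j, DifferentiableAt ℝ (fun y : C4 => expU Ω y.2.2 i j) x := fun i j =>
    (contDiffAt_expU i j x 1).differentiableAt (by simp)
  have dYU : DifferentiableAt ℝ (fun y : C4 => solY H S Ω y ⬝ᵥ (expU Ω y.2.2 *ᵥ b)) x :=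
    (contDiffAt_dotProduct (fun i => contDiffAt_solY hx i 1)
      (fun i => contDiffAt_expU_mulVec b i x 1)).differentiableAt (by simp)
  have eU : alongV Z (fun y : C4 => expU Ω y.2.2 *ᵥ b) x
      = Z.1.2.2 • ((expU Ω x.2.2 * Ω) *ᵥ b) := by
    rw [alongV_mulVec dUU (G := fun _ => b) (fun i => differentiableAt_const _), alongV_const,
      Matrix.mulVec_zero, add_zero, alongM_comp_zeta (hasDerivM_expU Ω x.2.2), Matrix.smul_mulVec]
  change along Z (fun y => (2 * (solY H S Ω y ⬝ᵥ (expU Ω y.2.2 *ᵥ b)), expU Ω y.2.2 *ᵥ b,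
    (0 : ℂ))) x = _
  rw [along_prodMk ((differentiableAt_const _).fun_mul dYU) (dU'.prodMk (differentiableAt_const _)),
    along_prodMk dU' (differentiableAt_const _), along_mul (differentiableAt_const _) dYU,
    along_const, along_const, along_pi dU, eU, along_dotProduct dY dU, eU, dotProduct_smul,
    zero_mul, zero_add, smul_eq_mul]

theorem along_frameE (hS : Sᵀ = S) {x : C4} (hx : IsRegular H S Ω x) {Z : C4 × C4}
    (hZ : Z.1.2.2 = 0) :
    along Z (frameE H S Ω) x =
      (-(2 * (solY H S Ω x ⬝ᵥ (bigS' S Ω x.2.2 *ᵥ alongV Z (solY H S Ω) x))),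
        -(bigS' S Ω x.2.2 *ᵥ alongV Z (solY H S Ω) x), 0) := by
  have dY : ∀ i, DifferentiableAt ℝ (fun y : C4 => solY H S Ω y i) x := fun i =>
    (contDiffAt_solY hx i 1).differentiableAt (by simp)
  have dT : ∀ i, DifferentiableAt ℝ (fun y : C4 => (bigS' S Ω y.2.2 *ᵥ solY H S Ω y) i) x :=
    fun i => (contDiffAt_bigS'_mulVec hx i 1).differentiableAt (by simp)
  have dT' : DifferentiableAt ℝ (fun y : C4 => bigS' S Ω y.2.2 *ᵥ solY H S Ω y) x :=
    differentiableAt_pi.2 dT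
  have dTT : ∀ i j, DifferentiableAt ℝ (fun y : C4 => bigS' S Ω y.2.2 i j) x := fun i j =>
    (contDiffAt_bigS' i j x 1).differentiableAt (by simp)
  have dYT : DifferentiableAt ℝ
      (fun y : C4 => solY H S Ω y ⬝ᵥ (bigS' S Ω y.2.2 *ᵥ solY H S Ω y)) x :=
    (contDiffAt_dotProduct (fun i => contDiffAt_solY hx i 1)
      (fun i => contDiffAt_bigS'_mulVec hx i 1)).differentiableAt (by simp)
  have eT : alongV Z (fun y : C4 => bigS' S Ω y.2.2 *ᵥ solY H S Ω y) x
      = bigS' S Ω x.2.2 *ᵥ alongV Z (solY H S Ω) x := by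
    rw [alongV_mulVec dTT dY, alongM_comp_zeta (hasDerivM_bigS' S Ω x.2.2), hZ, zero_smul,
      Matrix.zero_mulVec, zero_add]
  change along Z (fun y => (-(solY H S Ω y ⬝ᵥ (bigS' S Ω y.2.2 *ᵥ solY H S Ω y)),
    -(bigS' S Ω y.2.2 *ᵥ solY H S Ω y), (1 : ℂ))) x = _
  rw [along_prodMk dYT.fun_neg (dT'.fun_neg.prodMk (differentiableAt_const _)),
    along_prodMk dT'.fun_neg (differentiableAt_const _), along_const, along_neg, along_neg,
    along_pi dT, eT, along_dotProduct dY dT, eT,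
    dotProduct_mulVec_symm (bigS'_transpose hS Ω x.2.2) (alongV Z (solY H S Ω) x),
    dotProduct_comm _ (solY H S Ω x), two_mul]

/-- The z-component of e is chosen for this: y is then constant along e and along conj(e), which
makes the Levi form degenerate in this direction. -/
theorem solQ_frameE (x : C4) : solQ H S Ω x (frameE H S Ω x) = 0 := by
  simp [solQ, frameE]

theorem solQ_frameF (b : Fin 2 → ℂ) (x : C4) :
    solQ H S Ω x (frameF H S Ω b x) = expU Ω x.2.2 *ᵥ b := by
  simp [solQ, frameF]

theorem solForm_frameE (x : C4) : solForm H S Ω x (frameE H S Ω x) = 0 := by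
  simp [solForm, frameE]
  ring

theorem solForm_frameF (b : Fin 2 → ℂ) (x : C4) :
    solForm H S Ω x (frameF H S Ω b x) = 0 := by
  simp [solForm, frameF]

/-- The matrix of the Levi form of the model. -/
def leviM (H S Ω : M2) (x : C4) : M2 :=
  (expU Ω x.2.2)ᵀ * matK H S Ω x.2.2 * conjM (expU Ω x.2.2)

/-- The matrix of the brackets `[e, f]` of the model. -/
def omM (H S Ω : M2) (x : C4) : M2 :=
  Ω + S * ((expU Ω x.2.2)ᵀ * matL H S Ω x.2.2 * expU Ω x.2.2)

theorem frameF_add (b b' : Fin 2 → ℂ) (x : C4) :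
    frameF H S Ω (b + b') x = frameF H S Ω b x + frameF H S Ω b' x := by
  simp only [frameF, Matrix.mulVec_add, dotProduct_add, mul_add, Prod.mk_add_mk, add_zero]

theorem frameF_smul (c : ℂ) (b : Fin 2 → ℂ) (x : C4) :
    frameF H S Ω (c • b) x = c • frameF H S Ω b x := by
  simp [frameF, Matrix.mulVec_smul]
  ring

theorem sum_smul_frameF (c : Fin 2 → ℂ) (x : C4) :
    ∑ l, c l • frameF H S Ω (Pi.single l 1) x = frameF H S Ω c x := by
  simp only [Fin.sum_univ_two, ← frameF_smul, ← frameF_add]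
  congr 1
  ext i
  fin_cases i <;> simp

theorem sum_col_smul_frameF (M : M2) (k : Fin 2) (x : C4) :
    ∑ l, M l k • frameF H S Ω (Pi.single l 1) x = frameF H S Ω (M *ᵥ Pi.single k 1) x := by
  rw [← sum_smul_frameF]
  refine Finset.sum_congr rfl fun l _ => ?_
  rw [Matrix.mulVec_single_one]
  rfl

theorem along_antihol_frameE_frameF {x : C4} (hx : IsRegular H S Ω x) (b : Fin 2 → ℂ) :
    along (0, frameE H S Ω x) (frameF H S Ω b) x = 0 := by
  rw [along_frameF hx, alongV_solY hx, solQ_frameE]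
  simp [solQ]

theorem along_antihol_frameE_frameE (hS : Sᵀ = S) {x : C4} (hx : IsRegular H S Ω x) :
    along (0, frameE H S Ω x) (frameE H S Ω) x = 0 := by
  rw [along_frameE hS hx rfl, alongV_solY hx, solQ_frameE]
  simp [solQ]

theorem alongV_antihol_solY {x : C4} (hx : IsRegular H S Ω x) (b : Fin 2 → ℂ) :
    alongV (0, frameF H S Ω b x) (solY H S Ω) x
      = (matK H S Ω x.2.2 * conjM (expU Ω x.2.2)) *ᵥ star b := by
  rw [alongV_solY hx, solQ_frameF, star_mulVec_eq, Matrix.mulVec_mulVec]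
  simp [solQ]

theorem along_antihol_frameF_frameF {x : C4} (hx : IsRegular H S Ω x) (a b : Fin 2 → ℂ) :
    along (0, frameF H S Ω b x) (frameF H S Ω a) x
      = (2 * (a ⬝ᵥ (leviM H S Ω x *ᵥ star b)), 0, 0) := by
  rw [along_frameF hx, alongV_antihol_solY hx]
  have e : ((matK H S Ω x.2.2 * conjM (expU Ω x.2.2)) *ᵥ star b) ⬝ᵥ (expU Ω x.2.2 *ᵥ a)
      = a ⬝ᵥ (leviM H S Ω x *ᵥ star b) := by
    rw [dotProduct_comm, ← Matrix.vecMul_transpose, ← Matrix.dotProduct_mulVec,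
      Matrix.mulVec_mulVec, leviM, mul_assoc]
  rw [e]
  simp

/-- The left factor of 𝐒' = exp(ζΩ) S exp(ζΩ)ᵀ is absorbed by `frameF`. This is the purpose of
twisting that frame by exp(ζΩ): the constant matrix S is what remains in the brackets. -/
theorem frameE_derivative_eq (hS : Sᵀ = S) {x : C4} (hx : IsRegular H S Ω x) {Z : C4 × C4}
    (hZ : Z.1.2.2 = 0) : along Z (frameE H S Ω) x
      = - frameF H S Ω ((S * (expU Ω x.2.2)ᵀ) *ᵥ alongV Z (solY H S Ω) x) x := by
  rw [along_frameE hS hx hZ, frameF, Matrix.mulVec_mulVec, bigS', mul_assoc]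
  simp

theorem along_antihol_frameF_frameE (hS : Sᵀ = S) {x : C4} (hx : IsRegular H S Ω x)
    (b : Fin 2 → ℂ) : along (0, frameF H S Ω b x) (frameE H S Ω) x
      = - frameF H S Ω ((S * leviM H S Ω x) *ᵥ star b) x := by
  rw [frameE_derivative_eq hS hx rfl, alongV_antihol_solY hx, Matrix.mulVec_mulVec, leviM]
  simp only [mul_assoc]

theorem along_hol_frameF_frameE (hS : Sᵀ = S) {x : C4} (hx : IsRegular H S Ω x)
    (b : Fin 2 → ℂ) : along (frameE H S Ω x, 0) (frameF H S Ω b) x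
      - along (frameF H S Ω b x, 0) (frameE H S Ω) x = frameF H S Ω (omM H S Ω x *ᵥ b) x := by
  rw [frameE_derivative_eq hS hx rfl, along_frameF hx, alongV_solY hx, alongV_solY hx,
    solQ_frameF, solQ_frameE, omM, Matrix.add_mulVec, frameF_add, sub_neg_eq_add]
  have e0 : solQ H S Ω x 0 = 0 := by simp [solQ]
  rw [e0, star_zero, Matrix.mulVec_zero, Matrix.mulVec_zero, add_zero, add_zero,
    zero_dotProduct]
  refine congrArg₂ _ ?_ ?_
  · simp only [frameF, frameE, one_mul, one_smul, zero_add, Matrix.mulVec_mulVec]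
  · simp only [Matrix.mulVec_mulVec, mul_assoc]

/-- Hermitian symmetry follows from H being real symmetric and 𝐒(ζ) symmetric, with the inverse
moved across H by `mul_inv_one_sub`. -/
theorem IsModelData.matK_transpose (h : IsModelData H S) (ζ : ℂ) :
    (matK H S Ω ζ)ᵀ = conjM (matK H S Ω ζ) := by
  have hT := bigS_transpose h.transpose_S Ω ζ
  have e : conjM (matA H S Ω ζ) = conjM (bigS S Ω ζ) * H := by rw [matA, conjM_mul, h.conj_H]
  rw [matK, conjM_mul, conjM_conjM, h.conj_H, conjM_matP, Matrix.transpose_mul,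
    Matrix.transpose_nonsing_inv, h.transpose_H, matP, Matrix.transpose_sub, Matrix.transpose_one,
    Matrix.transpose_mul, e, matA, Matrix.transpose_mul, Matrix.transpose_mul, h.transpose_H, hT,
    ← conjM_transpose, hT, mul_assoc, mul_assoc, ← mul_inv_one_sub]
  simp only [mul_assoc]

theorem IsModelData.leviM_transpose (h : IsModelData H S) (x : C4) :
    (leviM H S Ω x)ᵀ = conjM (leviM H S Ω x) := by
  rw [leviM, Matrix.transpose_mul, Matrix.transpose_mul, Matrix.transpose_transpose,
    h.matK_transpose, conjM_mul, conjM_mul, conjM_conjM, conjM_transpose, mul_assoc]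

theorem IsModelData.det_leviM_ne (h : IsModelData H S) {x : C4} (hx : IsRegular H S Ω x) :
    (leviM H S Ω x).det ≠ 0 := by
  have hP : (matP H S Ω x.2.2).det ≠ 0 := by
    rw [matP, Matrix.det_nonsing_inv, Ring.inverse_eq_inv']
    exact inv_ne_zero hx
  rw [leviM, matK, Matrix.det_mul, Matrix.det_mul, Matrix.det_mul, Matrix.det_transpose, conjM_det,
    conjM_det]
  have hU := det_expU_ne Ω x.2.2
  have hc : ∀ z : ℂ, z ≠ 0 → (starRingEnd ℂ) z ≠ 0 := fun z hz => by simpa using hz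
  exact mul_ne_zero (mul_ne_zero hU (mul_ne_zero h.det_H (hc _ hP))) (hc _ hU)

theorem contDiffAt_conjM_entries {F : C4 → M2} {x : C4} {n : WithTop ℕ∞}
    (hF : ∀ i j, ContDiffAt ℝ n (fun y => F y i j) x) (i j : Fin 2) :
    ContDiffAt ℝ n (fun y => conjM (F y) i j) x :=
  contDiffAt_conj (hF i j)

theorem contDiffAt_matK {x : C4} (hx : IsRegular H S Ω x) (i j : Fin 2) (n : WithTop ℕ∞) :
    ContDiffAt ℝ n (fun y : C4 => matK H S Ω y.2.2 i j) x :=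
  contDiffAt_mul_entries (F := fun _ => H) (fun _ _ => contDiffAt_const)
    (contDiffAt_conjM_entries fun i j => contDiffAt_matP hx i j n) i j

theorem contDiffAt_leviM {x : C4} (hx : IsRegular H S Ω x) (i j : Fin 2) (n : WithTop ℕ∞) :
    ContDiffAt ℝ n (fun y : C4 => leviM H S Ω y i j) x :=
  contDiffAt_mul_entries (contDiffAt_mul_entries (F := fun y : C4 => (expU Ω y.2.2)ᵀ)
      (fun i j => contDiffAt_expU j i x n) (fun i j => contDiffAt_matK hx i j n))
    (contDiffAt_conjM_entries fun i j => contDiffAt_expU i j x n) i j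

theorem contDiffAt_omM {x : C4} (hx : IsRegular H S Ω x) (i j : Fin 2) (n : WithTop ℕ∞) :
    ContDiffAt ℝ n (fun y : C4 => omM H S Ω y i j) x := by
  simp only [omM, Matrix.add_apply]
  refine contDiffAt_const.add (contDiffAt_mul_entries (F := fun _ => S) (fun _ _ => contDiffAt_const)
    (contDiffAt_mul_entries (contDiffAt_mul_entries (F := fun y : C4 => (expU Ω y.2.2)ᵀ)
      (fun i j => contDiffAt_expU j i x n) ?_) (fun i j => contDiffAt_expU i j x n)) i j)
  exact contDiffAt_mul_entries (fun i j => contDiffAt_matK hx i j n)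
    (contDiffAt_conjM_entries fun i j => contDiffAt_matA i j x n)

theorem linearIndependent_frame (x : C4) : LinearIndependent ℂ
    ![frameF H S Ω (Pi.single 0 1) x, frameF H S Ω (Pi.single 1 1) x, frameE H S Ω x] := by
  rw [Fintype.linearIndependent_iff]
  intro c hc
  have e : c 0 • frameF H S Ω (Pi.single 0 1) x + c 1 • frameF H S Ω (Pi.single 1 1) x
      = frameF H S Ω ![c 0, c 1] x := by
    have := sum_smul_frameF (H := H) (S := S) (Ω := Ω) ![c 0, c 1] x
    rwa [Fin.sum_univ_two] at this
  simp only [Fin.sum_univ_three, Matrix.cons_val_zero, Matrix.cons_val_one, Matrix.cons_val_two,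
    e] at hc
  have h2 : c 2 = 0 := by
    have := congrArg (fun v : C4 => v.2.2) hc
    simpa [frameF, frameE] using this
  have h01 : ![c 0, c 1] = 0 := by
    have := congrArg (fun v : C4 => v.2.1) hc
    simp only [h2, zero_smul, add_zero] at this
    exact Matrix.eq_zero_of_mulVec_eq_zero (det_expU_ne Ω x.2.2) this
  intro i
  fin_cases i
  · exact congrFun h01 0
  · exact congrFun h01 1
  · exact h2

theorem eventually_isRegular : ∀ᶠ x in 𝓝 (0 : C4), IsRegular H S Ω x :=
  (isRegular_of_zeta_eq_zero rfl).eventually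

/-- The adapted frame of the model. -/
def IsModelData.frame (h : IsModelData H S) (Ω : M2) : AdaptedFrame (model H S Ω) 0 where
  -- Only Re w enters the defining function linearly, so i∂/∂w is tangent. Its factor i also turns
  -- the bracket −2 `levi` ∂/∂w into 2i `levi` g.
  g _ := (Complex.I, 0, 0)
  f k := frameF H S Ω (Pi.single k 1)
  e := frameE H S Ω
  levi := leviM H S Ω
  -- Dividing by `levi` leaves S^{0,2} constantly equal to S.
  xi x := S * leviM H S Ω x
  om := omM H S Ω
  smooth_g := contDiffAt_const
  smooth_f k := contDiffAt_frameF (isRegular_of_zeta_eq_zero rfl) _ _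
  smooth_e := contDiffAt_frameE (isRegular_of_zeta_eq_zero rfl) _
  smooth_levi i j := contDiffAt_leviM (isRegular_of_zeta_eq_zero rfl) i j _
  smooth_xi i j := contDiffAt_mul_entries (F := fun _ => S) (fun _ _ => contDiffAt_const)
    (fun i j => contDiffAt_leviM (isRegular_of_zeta_eq_zero rfl) i j _) i j
  smooth_om i j := contDiffAt_omM (isRegular_of_zeta_eq_zero rfl) i j _
  tangent_g := eventually_isRegular.mono fun x hx _ => by
    rw [h.fderiv_model hx]
    simp [solForm]
  tangent_f k := eventually_isRegular.mono fun x hx _ => by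
    rw [h.mem_holTangent_iff hx, solForm_frameF]
  tangent_e := eventually_isRegular.mono fun x hx _ => by
    rw [h.mem_holTangent_iff hx, solForm_frameE]
  isFrame := eventually_isRegular.mono fun x hx _ => by
    refine ⟨?_, linearIndependent_frame x⟩
    rw [h.mem_holTangent_iff hx]
    simp [solForm]
  levi_ff := eventually_isRegular.mono fun x hx _ a b => by
    have hs : ∀ k : Fin 2, star (Pi.single k 1 : Fin 2 → ℂ) = Pi.single k 1 := fun k => by
      ext i; fin_cases k <;> fin_cases i <;> simp
    have hl : (starRingEnd ℂ) (leviM H S Ω x a b) = leviM H S Ω x b a :=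
      (congrFun (congrFun (h.leviM_transpose x) a) b).symm
    have hz : ∀ {v : C4}, v = 0 → v ∈ holTangent (model H S Ω) x := fun e => e ▸ zero_mem _
    rw [bracket_hol_antihol_fst, bracket_hol_antihol_snd, along_antihol_frameF_frameF hx,
      along_antihol_frameF_frameF hx, hs, hs, Matrix.mulVec_single_one, Matrix.mulVec_single_one,
      single_one_dotProduct, single_one_dotProduct, Matrix.col_apply,
      Matrix.col_apply, map_mul, map_mul, hl, Complex.conj_I]
    constructor
    · apply hz
      ext1
      · simp only [Prod.fst_sub, Prod.fst_neg, Prod.smul_fst, smul_eq_mul, Prod.fst_zero]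
        linear_combination (-2 * leviM H S Ω x a b) * Complex.I_mul_I
      · simp
    · apply hz
      ext1
      · simp only [Prod.fst_sub, Prod.smul_fst, smul_eq_mul, Prod.fst_zero, map_ofNat]
        linear_combination (2 * leviM H S Ω x b a) * Complex.I_mul_I
      · simp
  levi_ef := eventually_isRegular.mono fun x hx _ b => by
    rw [InHH, bracket_hol_antihol_fst, bracket_hol_antihol_snd, along_antihol_frameE_frameF hx,
      along_antihol_frameF_frameE h.transpose_S hx, neg_neg, h.mem_holTangent_iff hx,
      solForm_frameF]
    exact ⟨rfl, zero_mem _⟩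
  levi_ee := eventually_isRegular.mono fun x hx _ => by
    rw [InHH, bracket_hol_antihol_fst, bracket_hol_antihol_snd,
      along_antihol_frameE_frameE h.transpose_S hx, neg_zero]
    exact ⟨zero_mem _, zero_mem _⟩
  levi_nondeg := eventually_isRegular.mono fun x hx _ => isUnit_iff_ne_zero.2 (h.det_leviM_ne hx)
  xi_spec := eventually_isRegular.mono fun x hx _ k => by
    have hs : star (Pi.single k 1 : Fin 2 → ℂ) = Pi.single k 1 := by
      ext i; fin_cases k <;> fin_cases i <;> simp
    rw [bracket_hol_antihol_fst, bracket_hol_antihol_snd, along_antihol_frameE_frameF hx,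
      along_antihol_frameF_frameE h.transpose_S hx, neg_neg, hs, sum_col_smul_frameF, sub_self]
    exact ⟨zero_mem _, zero_mem _⟩
  om_spec := eventually_isRegular.mono fun x hx _ k => by
    rw [bracket_hol_hol_fst, bracket_hol_hol_snd, along_hol_frameF_frameE h.transpose_S hx,
      sum_col_smul_frameF, sub_self]
    exact ⟨zero_mem _, zero_mem _⟩

end CR4

end

noncomputable section

namespace CR4

variable {H S Ω : M2}

/-! ### The modified symbol of the model -/

theorem leviM_zero : leviM H S Ω 0 = H := by
  simp [leviM, matK, matP_zero, expU_zero, conjM_one]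

theorem omM_zero : omM H S Ω 0 = Ω := by
  simp [omM, matL, matA_zero, conjM_zero]

theorem frameE_zero : frameE H S Ω 0 = (0, 0, 1) := by
  simp [frameE, solY_zero]

/-- With A = 𝐒(ζ)H one has conj(P) = 1 + conj(A) A conj(P). As A and conj(A) vanish at 0, conj(P) −
1 vanishes there to second order. -/
theorem alongM_conjM_matP_zero : alongM ((0, 0, 1), 0)
    (fun x : C4 => conjM (matP H S Ω x.2.2)) 0 = 0 := by
  have h0 : IsRegular H S Ω 0 := isRegular_of_zeta_eq_zero rfl
  have e : (fun x : C4 => conjM (matP H S Ω x.2.2)) =ᶠ[𝓝 0] fun x : C4 =>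
      1 + conjM (matA H S Ω x.2.2) * (matA H S Ω x.2.2 * conjM (matP H S Ω x.2.2)) := by
    filter_upwards [eventually_isRegular (H := H) (S := S) (Ω := Ω)] with x hx
    have hd : IsUnit (1 - conjM (matA H S Ω x.2.2) * matA H S Ω x.2.2).det := by
      rw [Matrix.det_one_sub_mul_comm]
      exact isUnit_iff_ne_zero.2 hx
    have := Matrix.mul_nonsing_inv _ hd
    rw [sub_mul, one_mul, ← conjM_matP, sub_eq_iff_eq_add, mul_assoc] at this
    exact this
  have dA : ∀ i j, DifferentiableAt ℝ (fun y : C4 => matA H S Ω y.2.2 i j) 0 := fun i j =>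
    (contDiffAt_matA i j 0 1).differentiableAt (by simp)
  have dA' : ∀ i j, DifferentiableAt ℝ (fun y : C4 => conjM (matA H S Ω y.2.2) i j) 0 := fun i j =>
    (contDiffAt_conjM_entries (fun i j => contDiffAt_matA i j 0 1) i j).differentiableAt (by simp)
  have cP : ∀ i j, ContDiffAt ℝ 1 (fun y : C4 => conjM (matP H S Ω y.2.2) i j) 0 :=
    contDiffAt_conjM_entries (fun i j => contDiffAt_matP h0 i j 1)
  have dAP : ∀ i j, DifferentiableAt ℝ
      (fun y : C4 => (matA H S Ω y.2.2 * conjM (matP H S Ω y.2.2)) i j) 0 := fun i j =>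
    (contDiffAt_mul_entries (fun i j => contDiffAt_matA i j 0 1) cP i j).differentiableAt (by simp)
  have dAAP : ∀ i j, DifferentiableAt ℝ (fun y : C4 => (conjM (matA H S Ω y.2.2) *
      (matA H S Ω y.2.2 * conjM (matP H S Ω y.2.2))) i j) 0 := fun i j =>
    (contDiffAt_mul_entries (contDiffAt_conjM_entries fun i j => contDiffAt_matA i j 0 1)
      (contDiffAt_mul_entries (fun i j => contDiffAt_matA i j 0 1) cP) i j).differentiableAt
      (by simp)
  have e1 : ∀ Z, alongM Z (fun x : C4 => 1 + conjM (matA H S Ω x.2.2) *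
      (matA H S Ω x.2.2 * conjM (matP H S Ω x.2.2))) 0 = alongM Z (fun x : C4 =>
        conjM (matA H S Ω x.2.2) * (matA H S Ω x.2.2 * conjM (matP H S Ω x.2.2))) 0 := by
    intro Z
    ext i j
    simp only [alongM, Matrix.of_apply, Matrix.add_apply]
    rw [along_add (differentiableAt_const _) (dAAP i j), along_const, zero_add]
  rw [alongM_congr e, e1, alongM_mul dA' dAP]
  simp [matA_zero, conjM_zero]

/-- Only the factor exp(ζΩ)ᵀ contributes: the middle factor is stationary at 0 and the last one is
antiholomorphic in ζ. -/
theorem alongM_leviM_zero : alongM ((0, 0, 1), 0) (leviM H S Ω) 0 = Ωᵀ * H := by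
  have h0 : IsRegular H S Ω 0 := isRegular_of_zeta_eq_zero rfl
  have dU : ∀ i j, DifferentiableAt ℝ (fun y : C4 => expU Ω y.2.2 i j) 0 := fun i j =>
    (contDiffAt_expU i j 0 1).differentiableAt (by simp)
  have dU' : ∀ i j, DifferentiableAt ℝ (fun y : C4 => conjM (expU Ω y.2.2) i j) 0 := fun i j =>
    (contDiffAt_conjM_entries (fun i j => contDiffAt_expU i j 0 1) i j).differentiableAt (by simp)
  have dP : ∀ i j, DifferentiableAt ℝ (fun y : C4 => conjM (matP H S Ω y.2.2) i j) 0 := fun i j =>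
    (contDiffAt_conjM_entries (fun i j => contDiffAt_matP h0 i j 1) i j).differentiableAt (by simp)
  have dK : ∀ i j, DifferentiableAt ℝ (fun y : C4 => matK H S Ω y.2.2 i j) 0 := fun i j =>
    (contDiffAt_matK h0 i j 1).differentiableAt (by simp)
  have dUK : ∀ i j, DifferentiableAt ℝ
      (fun y : C4 => ((expU Ω y.2.2)ᵀ * matK H S Ω y.2.2) i j) 0 := fun i j =>
    (contDiffAt_mul_entries (F := fun y : C4 => (expU Ω y.2.2)ᵀ)
      (fun i j => contDiffAt_expU j i 0 1) (fun i j => contDiffAt_matK h0 i j 1)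
      i j).differentiableAt (by simp)
  have eK : alongM ((0, 0, 1), 0) (fun y : C4 => matK H S Ω y.2.2) 0 = 0 := by
    have := alongM_mul (F := fun _ => H) (fun _ _ => differentiableAt_const _) dP ((0, 0, 1), 0)
    rwa [alongM_conjM_matP_zero, alongM_const, zero_mul, mul_zero, add_zero] at this
  have eU : alongM ((0, 0, 1), 0) (fun y : C4 => expU Ω y.2.2) 0 = Ω := by
    rw [alongM_comp_zeta (hasDerivM_expU Ω _)]
    simp [expU_zero]
  have eU' : alongM ((0, 0, 1), 0) (fun y : C4 => conjM (expU Ω y.2.2)) 0 = 0 := by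
    rw [alongM_conjM dU, alongM_comp_zeta (hasDerivM_expU Ω _)]
    simp [conjM_zero]
  change alongM _ (fun y : C4 => (expU Ω y.2.2)ᵀ * matK H S Ω y.2.2 * conjM (expU Ω y.2.2)) 0 = _
  rw [alongM_mul dUK dU', alongM_mul (F := fun y : C4 => (expU Ω y.2.2)ᵀ) (fun i j => dU j i) dK,
    eK, eU', alongM_transpose, eU]
  simp [matK, matP_zero, expU_zero, conjM_one]

theorem IsModelData.isTwoNondegenerate (h : IsModelData H S) (hS : S ≠ 0) (Ω : M2) :
    IsTwoNondegenerate (model H S Ω) 0 := by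
  have h0 : IsRegular H S Ω 0 := isRegular_of_zeta_eq_zero rfl
  refine ⟨h.analyticAt_model h0, ?_, fun e => ?_, h.frame Ω, fun e => hS ?_⟩
  · rw [h.model_eq]
    simp
  · have := h.fderiv_model h0 (1, 0, 0)
    rw [e] at this
    simp [solForm] at this
  · change S * leviM H S Ω 0 = 0 at e
    rw [leviM_zero] at e
    have := congrArg (· * H⁻¹) e
    simpa [Matrix.mul_nonsing_inv_cancel_right _ _ (isUnit_iff_ne_zero.2 h.det_H)] using this

theorem IsModelData.derivE_s02 (h : IsModelData H S) (Ω : M2) :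
    (h.frame Ω).derivE (h.frame Ω).s02 = 0 := by
  have e : (h.frame Ω).s02 =ᶠ[𝓝 0] fun _ => S := eventually_isRegular.mono fun x hx =>
    Matrix.mul_nonsing_inv_cancel_right _ _ (isUnit_iff_ne_zero.2 (h.det_leviM_ne hx))
  exact (alongM_congr e _).trans (alongM_const _ _ _)

theorem IsModelData.s0m2_eq (h : IsModelData H S) (Ω : M2) (x : C4) :
    (h.frame Ω).s0m2 x = leviM H S Ω x * (conjM S * (leviM H S Ω x)ᵀ) := by
  rw [h.leviM_transpose, ← conjM_mul]
  rfl

theorem IsModelData.derivE_s0m2 (h : IsModelData H S) (Ω : M2) :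
    (h.frame Ω).derivE (h.frame Ω).s0m2
      = Ωᵀ * (H * conjM S * H) + (H * conjM S * H) * Ω := by
  have h0 : IsRegular H S Ω 0 := isRegular_of_zeta_eq_zero rfl
  have dL : ∀ i j, DifferentiableAt ℝ (fun y : C4 => leviM H S Ω y i j) 0 := fun i j =>
    (contDiffAt_leviM h0 i j 1).differentiableAt (by simp)
  have dSL : ∀ i j, DifferentiableAt ℝ
      (fun y : C4 => (conjM S * (leviM H S Ω y)ᵀ) i j) 0 := fun i j =>
    (contDiffAt_mul_entries (F := fun _ => conjM S) (G := fun y : C4 => (leviM H S Ω y)ᵀ)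
      (fun _ _ => contDiffAt_const) (fun i j => contDiffAt_leviM h0 j i 1) i j).differentiableAt
      (by simp)
  have e : (h.frame Ω).derivE (h.frame Ω).s0m2 = alongM ((0, 0, 1), 0)
      (fun x => leviM H S Ω x * (conjM S * (leviM H S Ω x)ᵀ)) 0 := by
    rw [← show (h.frame Ω).s0m2 = _ from funext (h.s0m2_eq Ω), ← frameE_zero (H := H) (S := S)
      (Ω := Ω)]
    rfl
  rw [e, alongM_mul dL dSL, alongM_mul (F := fun _ => conjM S) (G := fun y => (leviM H S Ω y)ᵀ)
    (fun _ _ => differentiableAt_const _) (fun i j => dL j i), alongM_transpose, alongM_const,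
    alongM_leviM_zero, leviM_zero, h.transpose_H, Matrix.transpose_mul, h.transpose_H,
    Matrix.transpose_transpose, zero_mul, zero_add]
  noncomm_ring

/-- In the explicit frame, S^{0,2} is constant and `om` equals Ω at 0, so N and `g00` are met by
zero. What remains is the condition on the e-derivative of S^{0,-2}, which `IsModelData.derivE_s0m2`
computes. -/
theorem IsModelData.hasModifiedSymbol (h : IsModelData H S) {Ω : M2}
    (hΩ : Ωᵀ * (H * conjM S * H) + (H * conjM S * H) * Ω ∈ Submodule.span ℂ {H * conjM S * H})
    (N : Submodule ℂ M2) : HasModifiedSymbol (model H S Ω) 0 H S Ω N := by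
  refine ⟨h.frame Ω, leviM_zero, ?_, ?_, ?_, ?_⟩
  · exact Matrix.mul_nonsing_inv_cancel_right _ _
      (isUnit_iff_ne_zero.2 (h.det_leviM_ne (isRegular_of_zeta_eq_zero rfl)))
  · rw [h.derivE_s0m2, h.s0m2_eq, leviM_zero, h.transpose_H, ← mul_assoc]
    exact hΩ
  · rw [h.derivE_s02]
    exact zero_mem _
  · rw [show (h.frame Ω).om 0 = Ω from omM_zero, sub_self]
    exact zero_mem _

/-! ### Symmetries of the model -/

/-- The linear map `(w, z, ζ) ↦ (a w, B z, c ζ)`. -/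
def diagMap (a : ℂ) (B : M2) (c : ℂ) : C4 →L[ℂ] C4 :=
  LinearMap.toContinuousLinearMap
    { toFun := fun x => (a * x.1, B *ᵥ x.2.1, c * x.2.2)
      map_add' := fun x y => by simp [mul_add, Matrix.mulVec_add]
      map_smul' := fun r x => by simp [Matrix.mulVec_smul, mul_left_comm] }

theorem diagMap_apply (a : ℂ) (B : M2) (c : ℂ) (x : C4) :
    diagMap a B c x = (a * x.1, B *ᵥ x.2.1, c * x.2.2) := rfl

/-- In the formula for the differential, equivariance replaces cζ𝐒' by B𝐒 + 𝐒Bᵀ − a𝐒. With z = u −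
𝐒y the terms y·B𝐒y cancel, and invariance of H up to scale turns Re 2y·Bu into a Re u·y. -/
theorem IsModelData.fderiv_model_diagMap (h : IsModelData H S) {B : M2} {a : ℝ} {c : ℂ}
    (h1 : Bᵀ * H + H * conjM B = (a : ℂ) • H) (h2 : B * S + S * Bᵀ = ((a : ℂ) + c) • S)
    (h3 : B * Ω - Ω * B = c • Ω) {x : C4} (hx : IsRegular H S Ω x) :
    fderiv ℝ (model H S Ω) x (diagMap a B c x) = a * model H S Ω x := by
  rw [h.fderiv_model hx, h.model_eq]
  have hT : (bigS S Ω x.2.2)ᵀ = bigS S Ω x.2.2 := bigS_transpose h.transpose_S Ω x.2.2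
  have hu := solU_eq hx
  have hq := bigS_equivariant h2 h3 x.2.2
  rw [matA_mulVec_star_solU] at hu
  have hq' : (c * x.2.2) * (solY H S Ω x ⬝ᵥ (bigS' S Ω x.2.2 *ᵥ solY H S Ω x)) =
      2 * (solY H S Ω x ⬝ᵥ (B *ᵥ (bigS S Ω x.2.2 *ᵥ solY H S Ω x)))
        - a * (solY H S Ω x ⬝ᵥ (bigS S Ω x.2.2 *ᵥ solY H S Ω x)) := by
    rw [← smul_eq_mul, ← dotProduct_smul, ← Matrix.smul_mulVec, hq, Matrix.sub_mulVec,
      Matrix.add_mulVec, dotProduct_sub, dotProduct_add, Matrix.smul_mulVec, dotProduct_smul,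
      smul_eq_mul, Matrix.mulVec_mulVec]
    have : solY H S Ω x ⬝ᵥ ((bigS S Ω x.2.2 * Bᵀ) *ᵥ solY H S Ω x)
        = solY H S Ω x ⬝ᵥ ((B * bigS S Ω x.2.2) *ᵥ solY H S Ω x) := by
      rw [Matrix.dotProduct_mulVec, ← Matrix.mulVec_transpose, Matrix.transpose_mul,
        Matrix.transpose_transpose, hT, dotProduct_comm]
    rw [this]
    ring
  have key : (2 * (solY H S Ω x ⬝ᵥ (B *ᵥ solU H S Ω x))).re
      = (a * (solU H S Ω x ⬝ᵥ solY H S Ω x)).re := by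
    set u := solU H S Ω x
    have e1 : solY H S Ω x ⬝ᵥ (B *ᵥ u) = u ⬝ᵥ ((Bᵀ * H) *ᵥ star u) := by
      rw [solY, dotProduct_comm, ← Matrix.vecMul_transpose, ← Matrix.dotProduct_mulVec,
        Matrix.mulVec_mulVec]
    have e2 : star (u ⬝ᵥ ((Bᵀ * H) *ᵥ star u)) = u ⬝ᵥ ((H * conjM B) *ᵥ star u) := by
      rw [star_dotProduct_eq, star_mulVec_eq, star_star, conjM_mul, h.conj_H, dotProduct_comm,
        ← Matrix.vecMul_transpose, ← Matrix.dotProduct_mulVec, Matrix.transpose_mul,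
        h.transpose_H, conjM_transpose, Matrix.transpose_transpose]
    have e3 : u ⬝ᵥ ((Bᵀ * H) *ᵥ star u) + u ⬝ᵥ ((H * conjM B) *ᵥ star u)
        = a * (u ⬝ᵥ solY H S Ω x) := by
      rw [← dotProduct_add, ← Matrix.add_mulVec, h1, Matrix.smul_mulVec, dotProduct_smul,
        smul_eq_mul]
      rfl
    have e4 : (u ⬝ᵥ ((H * conjM B) *ᵥ star u)).re = (u ⬝ᵥ ((Bᵀ * H) *ᵥ star u)).re := by
      rw [← e2]
      exact Complex.conj_re _
    rw [e1, ← e3, Complex.add_re, e4, two_mul, Complex.add_re]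
  have ez : x.2.1 = solU H S Ω x - bigS S Ω x.2.2 *ᵥ solY H S Ω x := by
    rw [eq_sub_iff_add_eq]
    exact hu.symm
  rw [solForm, diagMap_apply]
  dsimp only
  rw [hq', ← Complex.re_ofReal_mul, ez, Matrix.mulVec_sub, dotProduct_sub, sub_dotProduct,
    dotProduct_comm _ (solY H S Ω x), dotProduct_comm _ (solY H S Ω x)]
  rw [dotProduct_comm (solU H S Ω x)] at key
  set p := solY H S Ω x ⬝ᵥ (B *ᵥ solU H S Ω x)
  set q := solY H S Ω x ⬝ᵥ solU H S Ω x
  set r := solY H S Ω x ⬝ᵥ (bigS S Ω x.2.2 *ᵥ solY H S Ω x)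
  set s := solY H S Ω x ⬝ᵥ (B *ᵥ (bigS S Ω x.2.2 *ᵥ solY H S Ω x))
  rw [show 2 * (p - s) + (2 * s - a * r) - a * x.1 = 2 * p - a * (r + x.1) by ring,
    show a * (q - r - x.1) = a * q - a * (r + x.1) by ring, Complex.sub_re, key, Complex.sub_re]

theorem IsModelData.diagMap_mem_linearIsotropy (h : IsModelData H S) {B : M2} {a : ℝ} {c : ℂ}
    (h1 : Bᵀ * H + H * conjM B = (a : ℂ) • H) (h2 : B * S + S * Bᵀ = ((a : ℂ) + c) • S)
    (h3 : B * Ω - Ω * B = c • Ω) : diagMap a B c ∈ linearIsotropy (model H S Ω) 0 := by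
  refine ⟨diagMap a B c, ⟨(diagMap a B c).analyticAt 0, ?_⟩, map_zero _,
    (diagMap a B c).fderiv⟩
  exact eventually_isRegular.mono fun x hx e => by
    rw [h.fderiv_model_diagMap h1 h2 h3 hx, e, mul_zero]

/-- The map f factors through the quotient by P, and the factored map sends the image of I onto a
space containing A. -/
theorem finrank_le_finrank_map_mkQ {V W : Type*} [AddCommGroup V] [Module ℝ V]
    [FiniteDimensional ℝ V] [AddCommGroup W] [Module ℝ W] [FiniteDimensional ℝ W]
    (I P : Submodule ℝ V) (A : Submodule ℝ W) (f : V →ₗ[ℝ] W) (hP : P ≤ LinearMap.ker f)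
    (hA : A ≤ I.map f) : Module.finrank ℝ A ≤ Module.finrank ℝ (I.map P.mkQ) := by
  have e : I.map f = (I.map P.mkQ).map (P.liftQ f hP) := by
    rw [← Submodule.map_comp, Submodule.liftQ_mkQ]
  exact (Submodule.finrank_mono (hA.trans e.le)).trans (Submodule.finrank_map_le _ _)

/-- Positive weight sends ℋ into 𝒦, hence acts as zero on ℋ / 𝒦. -/
theorem AdaptedFrame.positiveWeight_le_ker {ρ : C4 → ℝ} {p : C4} (φ : AdaptedFrame ρ p)
    (h : IsHypersurface ρ p) : positiveWeight ρ p ≤ LinearMap.ker φ.isotropyMatrix := by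
  rintro L ⟨-, h2, -⟩
  have hp := (φ.eventually_isGood h).self_of_nhds h.zero
  rw [LinearMap.mem_ker]
  ext l k
  have := h2 _ (hp.tangent_f k)
  rw [φ.leviKernel_eq h] at this
  exact congrFun ((mem_span_iff hp _).1 this).2 l

theorem IsModelData.isotropyMatrix_diagMap (h : IsModelData H S) (hS : S ≠ 0) (Ω : M2) (a c : ℂ)
    (B : M2) : (h.frame Ω).isotropyMatrix (diagMap a B c) = B := by
  have hh := (h.isTwoNondegenerate hS Ω).isHypersurface
  have hp := ((h.frame Ω).eventually_isGood hh).self_of_nhds hh.zero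
  have f0 : ∀ b : Fin 2 → ℂ, frameF H S Ω b 0 = (0, b, 0) := fun b => by
    simp [frameF, solY_zero, expU_zero]
  ext l k
  have e : diagMap a B c ((h.frame Ω).f k 0) = ∑ l, B l k • (h.frame Ω).f l 0 := by
    change diagMap a B c (frameF H S Ω (Pi.single k 1) 0)
      = ∑ l, B l k • frameF H S Ω (Pi.single l 1) 0
    rw [sum_col_smul_frameF, f0, f0, diagMap_apply, mul_zero, mul_zero]
  change ((h.frame Ω).coframe 0 (diagMap a B c ((h.frame Ω).f k 0))).2.1 l = B l k
  rw [e]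
  simp only [map_sum, map_smul, AdaptedFrame.coframe_f hp.unit, Prod.snd_sum, Prod.fst_sum,
    Finset.sum_apply, Prod.smul_snd, Prod.smul_fst, Pi.smul_apply, Pi.single_apply, smul_eq_mul,
    mul_ite, mul_one, mul_zero, Finset.sum_ite_eq, Finset.mem_univ, if_true]

theorem IsModelData.finrank_symbolAlgebra_le (h : IsModelData H S) (hS : S ≠ 0) (Ω : M2) :
    Module.finrank ℝ (symbolAlgebra H S Ω) ≤ degreeZeroIsotropyDim (model H S Ω) 0 := by
  have hh := (h.isTwoNondegenerate hS Ω).isHypersurface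
  have : FiniteDimensional ℂ (C4 →L[ℂ] C4) :=
    LinearEquiv.finiteDimensional (LinearMap.toContinuousLinearMap (𝕜 := ℂ) (E := C4) (F' := C4))
  have : FiniteDimensional ℝ (C4 →L[ℂ] C4) := FiniteDimensional.complexToReal _
  refine finrank_le_finrank_map_mkQ _ _ _ (h.frame Ω).isotropyMatrix
    ((h.frame Ω).positiveWeight_le_ker hh) ?_
  rintro B ⟨a, c, h1, h2, h3⟩
  exact ⟨diagMap a B c, h.diagMap_mem_linearIsotropy h1 h2 h3,
    h.isotropyMatrix_diagMap hS Ω a c B⟩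

/-! ### The rows of the table -/

theorem IsTableSymbol.isModelData {N : Submodule ℂ M2} (hs : IsTableSymbol H S Ω N) :
    IsModelData H S := by
  cases hs with
  | row1 ε hε l τ hl hτ =>
    rcases hε with rfl | rfl <;> constructor <;>
      simp [Matrix.det_fin_two, ← Matrix.ext_iff, Fin.forall_fin_two, conjM]
  | row3 ε hε =>
    rcases hε with rfl | rfl <;> constructor <;>
      simp [Matrix.det_fin_two, ← Matrix.ext_iff, Fin.forall_fin_two, conjM]
  | row4 ε hε τ hτ =>
    rcases hε with rfl | rfl <;> constructor <;>
      simp [Matrix.det_fin_two, ← Matrix.ext_iff, Fin.forall_fin_two, conjM]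
  | _ => constructor <;> simp [Matrix.det_fin_two, ← Matrix.ext_iff, Fin.forall_fin_two, conjM]

theorem conjM_fin_two (a b c d : ℂ) : conjM !![a, b; c, d] =
    !![(starRingEnd ℂ) a, (starRingEnd ℂ) b; (starRingEnd ℂ) c, (starRingEnd ℂ) d] := by
  ext i j
  fin_cases i <;> fin_cases j <;> rfl

theorem transpose_fin_two (a b c d : ℂ) : !![a, b; c, d]ᵀ = !![a, c; b, d] := by
  ext i j
  fin_cases i <;> fin_cases j <;> rfl

/-- With T = H conj(S) H, the product TΩ is skew in the first two rows, where T is diagonal, and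
zero in the fourth. In the sixth row the sum is 2τT, and in the other rows Ω = 0. -/
theorem IsTableSymbol.omega_mem_span {N : Submodule ℂ M2} (hs : IsTableSymbol H S Ω N) :
    Ωᵀ * (H * conjM S * H) + (H * conjM S * H) * Ω ∈ Submodule.span ℂ {H * conjM S * H} := by
  have ext2 : ∀ {A B : M2}, A 0 0 = B 0 0 → A 0 1 = B 0 1 → A 1 0 = B 1 0 → A 1 1 = B 1 1 →
      A = B := by
    intro A B h1 h2 h3 h4
    ext i j
    fin_cases i <;> fin_cases j <;> assumption
  rw [Submodule.mem_span_singleton]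
  cases hs with
  | row1 ε hε l τ hl hτ =>
    refine ⟨0, ?_⟩
    have e : ε * ε = 1 := by rcases hε with rfl | rfl <;> ring
    rw [conjM_fin_two, transpose_fin_two]
    simp only [Matrix.mul_fin_two]
    apply ext2 <;> simp
    · linear_combination (-(τ * l : ℂ)) * e
    · linear_combination (-(τ * l : ℂ)) * e
  | row2 θ τ hθ hθ' hτ =>
    refine ⟨0, ?_⟩
    have e : (starRingEnd ℂ) (Complex.exp (Complex.I * θ)) * Complex.exp (Complex.I * θ) = 1 := by
      rw [← Complex.exp_conj, ← Complex.exp_add]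
      simp
    rw [conjM_fin_two, transpose_fin_two]
    simp only [Matrix.mul_fin_two]
    apply ext2 <;> simp only [zero_smul, Matrix.zero_apply, Matrix.add_apply, Matrix.of_apply,
      Matrix.cons_val_zero, Matrix.cons_val_one, map_one, map_zero]
    · ring
    · linear_combination (τ : ℂ) * e
    · linear_combination (τ : ℂ) * e
    · ring
  | row4 ε hε τ hτ =>
    refine ⟨0, ?_⟩
    rw [conjM_fin_two, transpose_fin_two]
    simp only [Matrix.mul_fin_two]
    apply ext2 <;> simp
  | row6 τ hτ =>
    refine ⟨2 * τ, ?_⟩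
    rw [conjM_fin_two, transpose_fin_two]
    simp only [Matrix.mul_fin_two]
    apply ext2 <;> simp
    ring
  | _ => exact ⟨0, by simp⟩

end CR4

end

/-! ### Comparison of a hypersurface with its model. -/

theorem corollary2p5 (H S Ω : CR4.M2) (N : Submodule ℂ CR4.M2)
    (hsymb : CR4.IsTableSymbol H S Ω N) :
    CR4.IsTwoNondegenerate (CR4.model H S Ω) 0 ∧
    CR4.HasModifiedSymbol (CR4.model H S Ω) 0 H S Ω N ∧
    ∀ (ρ : CR4.C4 → ℝ) (p : CR4.C4),
      CR4.IsTwoNondegenerate ρ p → CR4.HasModifiedSymbol ρ p H S Ω N →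
        CR4.degreeZeroIsotropyDim ρ p ≤ CR4.degreeZeroIsotropyDim (CR4.model H S Ω) 0 :=
  ⟨hsymb.isModelData.isTwoNondegenerate hsymb.ne_zero Ω,
    hsymb.isModelData.hasModifiedSymbol hsymb.omega_mem_span N, fun _ _ hρ hsym =>
      (CR4.degreeZeroIsotropyDim_le hsymb hρ.isHypersurface hsym).trans
        (hsymb.isModelData.finrank_symbolAlgebra_le hsymb.ne_zero Ω)⟩
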